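/- **Setting.** Let $k_1,k_2\ge 0$ be integers, $\psi\in\,]0,\pi[$, and let $\Lambda=\Lambda^0\oplus\Lambda^1$ (even and odd part) be the complex Grassmann algebra on $N\ge k_1k_2$ pairs of generators $\eta_j,\eta_j^*$, with the antilinear conjugation that satisfies $(ab)^*=b^*a^*$ and exchanges $\eta_j$ and $\eta_j^*$. The body of an element of $\Lambda$ is its component of degree $0$. A $U(k_1/k_2)$-symmetric supermatrix with Wick rotation $e^{\imath\psi}$ is $$\Sigma=\begin{bmatrix}\Sigma_1&e^{\imath\psi/2}\alpha^\dagger\\ e^{\imath\psi/2}\alpha&e^{\imath\psi}\Sigma_2\end{bmatrix},$$ where $\Sigma_j$ is a $k_j\times k_j$ matrix with entries in $\Lambda^0$ and Hermitian body, and the entries $\alpha_{nm}$ of the $k_2\times k_1$ matrix $\alpha$ and those of $\alpha^\dagger$, $(\alpha^\dagger)_{mn}=\alpha_{nm}^*$, are independent elements of $\Lambda^1$. ${\rm Herm}(2,k)$ denotes the space of complex Hermitian $k\times k$ matrices. A superfunction is $f(\sigma)=\sum_{J}f_{J}(x)\prod_n(\alpha_n^*)^{j_{1n}}\alpha_n^{j_{2n}}$,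 with $J=(j_1,j_2)$, $j_1,j_2\in\{0,1\}^{k_1k_2}$, $n$ running over the pairs of row and column indices of $\alpha$ in lexicographic order, and $f_J$ complex functions of $x=(\sigma_1,\sigma_2)\in{\rm Herm}(2,k_1)\times{\rm Herm}(2,k_2)$. It is evaluated at even coordinates with values in $\Lambda^0$ by Taylor expansion about their body. Write $|J|$ for the degree of the monomial of $J$, and $f(x)=f_{0,0}(x)$ for the value of $f$ at a supermatrix without Grassmann variables. The Grassmann integral is normalized by $\int\eta\,d\eta=\int\eta^*d\eta^*=(2\pi)^{-1/2}$, that is, $\int f(\sigma)\,d[\eta]=(2\pi)^{-k_1k_2}f_{1,\dots,1}(x)$, the coefficient being that of $\prod_n\alpha_n^*\alpha_n$. Further $d[\sigma_j]=\prod_n d\sigma_{nnj}\prod_{n<m}d{\rm Re}\,\sigma_{nmj}\,d{\rm Im}\,\sigma_{nmj}$. **Theorem 4.1.** Let $f$ be a superfunction on the $U(k_1/k_2)$-symmetric supermatrices whose coefficients $f_J$ are of class $C^N$. Assume: 1. (invariance) $f(U^{-1}\Sigma U)=f(\Sigma)$ for all $\Sigma$ as above and all $U\in U(k_1/k_2)$,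 that is, all $(k_1/k_2)$-supermatrices $U$ over $\Lambda$ with entries in $\Lambda^0$ in the diagonal blocks and in $\Lambda^1$ in the off-diagonal blocks and with $U^\dagger U=UU^\dagger=1$; 2. (zero boundary condition at infinity) $\|x\|^{(k_1-k_2)^2+|J|}f_J(x)\to0$ as $\|x\|\to\infty$, for every $J$ except that of the top monomial; 3. (the integrals exist) $\int f(\sigma)\,d[\eta]$ is Lebesgue integrable over ${\rm Herm}(2,k_1)\times{\rm Herm}(2,k_2)$ and, if $k_1\ne k_2$, the integrand on the right-hand side below is Lebesgue integrable over ${\rm Herm}(2,|k_1-k_2|)$. Then $$\int\limits_{{\rm Herm}(2,k_1)\times{\rm Herm}(2,k_2)}\int f(\sigma)\,d[\eta]\,d[\sigma_2]\,d[\sigma_1]=\begin{cases}\displaystyle(-1)^{k_1k_2}2^{-k_2(k_2-1)}\imath^{k_2^2}\Big(\frac{e^{\imath\psi}}2\Big)^{k_2(k_1-k_2)}\int\limits_{{\rm Herm}(2,k_1-k_2)}f(\tilde\sigma_1)\,d[\tilde\sigma_1],&k_1>k_2,\\[2ex] 2^{-k(k-1)}(-\imath)^{k^2}f(0),&k_1=k_2=k,\\[1ex]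 \displaystyle2^{-k_1(k_1-1)}(-\imath)^{k_1^2}\Big(\frac{e^{-\imath\psi}}2\Big)^{k_1(k_2-k_1)}\int\limits_{{\rm Herm}(2,k_2-k_1)}f(e^{\imath\psi}\tilde\sigma_2)\,d[\tilde\sigma_2],&k_1<k_2,\end{cases}$$ where $\tilde\sigma_1$, respectively $e^{\imath\psi}\tilde\sigma_2$, stands for the supermatrix that has this matrix in the upper left corner of the boson–boson, respectively fermion–fermion, block and zeros elsewhere. -/

import Mathlib

open scoped ContDiff

noncomputable section

namespace SuperInt

/-! ### Complex Grassmann algebras -/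

/-- The complex Grassmann algebra on `N` pairs of generators `η_j`, `η_j^*`. -/
abbrev Grassmann (N : ℕ) : Type := ExteriorAlgebra ℂ (Fin N ⊕ Fin N → ℂ)

/-- The generator `η_j`. -/
def eta {N : ℕ} (j : Fin N) : Grassmann N := ExteriorAlgebra.ι ℂ (Pi.single (Sum.inl j) 1)

/-- The generator `η_j^*`. -/
def etaStar {N : ℕ} (j : Fin N) : Grassmann N := ExteriorAlgebra.ι ℂ (Pi.single (Sum.inr j) 1)

/-- The even (commuting) elements `Λ⁰`. -/
def evenPart (N : ℕ) : Submodule ℂ (Grassmann N) :=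
  CliffordAlgebra.evenOdd (0 : QuadraticForm ℂ (Fin N ⊕ Fin N → ℂ)) 0

/-- The odd (anticommuting) elements `Λ¹`. -/
def oddPart (N : ℕ) : Submodule ℂ (Grassmann N) :=
  CliffordAlgebra.evenOdd (0 : QuadraticForm ℂ (Fin N ⊕ Fin N → ℂ)) 1

/-- The body of an element: its component of degree zero, a complex number. -/
def body {N : ℕ} : Grassmann N →ₐ[ℂ] ℂ := ExteriorAlgebra.algebraMapInv

/-- The soul of an element: the element minus its body; it is nilpotent. -/
def soul {N : ℕ} (a : Grassmann N) : Grassmann N := a - algebraMap ℂ (Grassmann N) (body a)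

/-- The opposite algebra with the complex conjugate scalar multiplication.  It serves only to
construct the complex conjugation of the Grassmann algebra. -/
def ConjOp (A : Type) : Type := Aᵐᵒᵖ

instance (A : Type) [Ring A] : Ring (ConjOp A) := inferInstanceAs (Ring Aᵐᵒᵖ)

instance (A : Type) [Ring A] [Algebra ℂ A] : Algebra ℂ (ConjOp A) :=
  RingHom.toAlgebra' (S := ConjOp A)
    ((algebraMap ℂ Aᵐᵒᵖ).comp (starRingEnd ℂ))
    (fun c x => Algebra.commutes (A := Aᵐᵒᵖ) (starRingEnd ℂ c) x)

/-- The antilinear exchange of `η_j` and `η_j^*` on the span of the generators. -/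
def conjVec {N : ℕ} (v : Fin N ⊕ Fin N → ℂ) : Fin N ⊕ Fin N → ℂ :=
  fun s => starRingEnd ℂ (v s.swap)

/-- The identity map onto the conjugate opposite algebra. -/
def ConjOp.mk {A : Type} (a : A) : ConjOp A := (MulOpposite.op a : Aᵐᵒᵖ)

/-- The inverse of `ConjOp.mk`. -/
def ConjOp.out {A : Type} (a : ConjOp A) : A := MulOpposite.unop (α := A) a

/-- The conjugation of the generators, as a linear map into the conjugate opposite algebra. -/
def conjLin (N : ℕ) : (Fin N ⊕ Fin N → ℂ) →ₗ[ℂ] ConjOp (Grassmann N) where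
  toFun v := ConjOp.mk (ExteriorAlgebra.ι ℂ (conjVec v))
  map_add' v w := by
    have : conjVec (v + w) = conjVec v + conjVec w := by ext s; simp [conjVec]
    rw [this, map_add]; rfl
  map_smul' c v := by
    have : conjVec (c • v) = starRingEnd ℂ c • conjVec v := by ext s; simp [conjVec]
    have h : ExteriorAlgebra.ι ℂ (conjVec (c • v)) = ExteriorAlgebra.ι ℂ (conjVec v) *
        algebraMap ℂ (Grassmann N) (starRingEnd ℂ c) := by
      rw [this, map_smul, Algebra.smul_def, Algebra.commutes]
    exact congrArg ConjOp.mk h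

theorem conjLin_mul_self {N : ℕ} (v : Fin N ⊕ Fin N → ℂ) : conjLin N v * conjLin N v = 0 :=
  congrArg ConjOp.mk (ExteriorAlgebra.ι_sq_zero (R := ℂ) (conjVec v))

/-- The conjugation as a linear multiplicative map into the conjugate opposite algebra. -/
def conjHom (N : ℕ) : Grassmann N →ₐ[ℂ] ConjOp (Grassmann N) :=
  ExteriorAlgebra.lift ℂ ⟨conjLin N, conjLin_mul_self⟩

/-- Complex conjugation on the Grassmann algebra: the antilinear map with `(a b)^* = b^* a^*`
that exchanges the generators `η_j` and `η_j^*`. -/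
def conj {N : ℕ} (a : Grassmann N) : Grassmann N :=
  (conjHom N a).out

theorem conj_mul {N : ℕ} (a b : Grassmann N) : conj (a * b) = conj b * conj a := by
  unfold conj; rw [map_mul]; rfl

theorem conj_add {N : ℕ} (a b : Grassmann N) : conj (a + b) = conj a + conj b := by
  unfold conj; rw [map_add]; rfl

theorem conj_algebraMap {N : ℕ} (c : ℂ) :
    conj (algebraMap ℂ (Grassmann N) c) = algebraMap ℂ (Grassmann N) (starRingEnd ℂ c) := by
  unfold conj; rw [AlgHom.commutes]; rfl

theorem conj_ι {N : ℕ} (v : Fin N ⊕ Fin N → ℂ) :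
    conj (ExteriorAlgebra.ι ℂ v) = ExteriorAlgebra.ι ℂ (conjVec v) :=
  congrArg ConjOp.out (ExteriorAlgebra.lift_ι_apply ℂ (conjLin N) conjLin_mul_self v)

theorem conj_eta {N : ℕ} (j : Fin N) : conj (eta j) = etaStar j := by
  unfold eta etaStar
  rw [conj_ι]; congr 1; ext s
  rcases s with s | s <;> simp [conjVec, Pi.single_apply]

theorem conj_etaStar {N : ℕ} (j : Fin N) : conj (etaStar j) = eta j := by
  unfold eta etaStar
  rw [conj_ι]; congr 1; ext s
  rcases s with s | s <;> simp [conjVec, Pi.single_apply]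

/-! ### Supermatrices and the supergroup `U(k₁/k₂)` -/

/-- `(k₁/k₂)`-supermatrices, in boson-fermion block notation. -/
abbrev SuperMatrix (N k₁ k₂ : ℕ) : Type :=
  Matrix (Fin k₁ ⊕ Fin k₂) (Fin k₁ ⊕ Fin k₂) (Grassmann N)

/-- The diagonal blocks have even entries and the off-diagonal blocks have odd entries. -/
def IsEvenSuperMatrix {N k₁ k₂ : ℕ} (M : SuperMatrix N k₁ k₂) : Prop :=
  (∀ i j, M (Sum.inl i) (Sum.inl j) ∈ evenPart N) ∧
  (∀ i j, M (Sum.inr i) (Sum.inr j) ∈ evenPart N) ∧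
  (∀ i j, M (Sum.inl i) (Sum.inr j) ∈ oddPart N) ∧
  (∀ i j, M (Sum.inr i) (Sum.inl j) ∈ oddPart N)

/-- The adjoint `M†`: transposition and complex conjugation. -/
def superAdjoint {N k₁ k₂ : ℕ} (M : SuperMatrix N k₁ k₂) : SuperMatrix N k₁ k₂ :=
  Matrix.of fun i j => conj (M j i)

/-- The unitary supergroup `U(k₁/k₂)` over the Grassmann algebra: `U† U = U U† = 1`. -/
def IsUnitarySuperMatrix {N k₁ k₂ : ℕ} (U : SuperMatrix N k₁ k₂) : Prop :=
  IsEvenSuperMatrix U ∧ superAdjoint U * U = 1 ∧ U * superAdjoint U = 1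

/-! ### The space of `U(k₁/k₂)`-symmetric supermatrices -/

/-- Hermitian matrices in their real coordinates: `H n n = a (n, n)`, and for `n < m` the numbers
`a (n, m)` and `a (m, n)` are the real and the imaginary part of `H n m`.  The coordinates may lie
in any complex algebra (real numbers plus even nilpotents, for supermatrices). -/
def hermMatrix {A : Type} [Ring A] [Algebra ℂ A] {k : ℕ} (a : Fin k × Fin k → A) :
    Matrix (Fin k) (Fin k) A :=
  Matrix.of fun n m =>
    if n < m then a (n, m) + Complex.I • a (m, n)
    else if m < n then a (m, n) - Complex.I • a (n, m)
    else a (n, n)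

/-- Labels of the real coordinates of the two Hermitian blocks. -/
abbrev EvenIdx (k₁ k₂ : ℕ) : Type := (Fin k₁ × Fin k₁) ⊕ (Fin k₂ × Fin k₂)

/-- Labels of the entries of the `k₂ × k₁` block `α` of anticommuting variables. -/
abbrev OddIdx (k₁ k₂ : ℕ) : Type := Fin k₂ × Fin k₁

/-- The coordinate space of `Herm(2,k₁) × Herm(2,k₂)`.  Its Lebesgue measure is
`d[σ₂] d[σ₁] = ∏ dσ_{nn} ∏_{n<m} d Re σ_{nm} d Im σ_{nm}` over both blocks. -/
abbrev HermPair (k₁ k₂ : ℕ) : Type := EvenIdx k₁ k₂ → ℝ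

/-- A point, over the Grassmann algebra, of the superspace of `U(k₁/k₂)`-symmetric supermatrices:
even coordinates with real body for the two Hermitian blocks, and the odd coordinates `α`, `α^*`,
which are independent of each other. -/
structure SymPoint (N k₁ k₂ : ℕ) where
  even : EvenIdx k₁ k₂ → Grassmann N
  alpha : OddIdx k₁ k₂ → Grassmann N
  alphaStar : OddIdx k₁ k₂ → Grassmann N
  even_mem : ∀ p, even p ∈ evenPart N
  alpha_mem : ∀ q, alpha q ∈ oddPart N
  alphaStar_mem : ∀ q, alphaStar q ∈ oddPart N
  body_real : ∀ p, (body (even p)).im = 0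

/-- The supermatrix
`[[Σ₁, e^{iψ/2} α†], [e^{iψ/2} α, e^{iψ} Σ₂]]` with the given coordinates. -/
def SymPoint.toMatrix {N k₁ k₂ : ℕ} (ψ : ℝ) (z : SymPoint N k₁ k₂) : SuperMatrix N k₁ k₂ :=
  Matrix.fromBlocks
    (hermMatrix fun p => z.even (Sum.inl p))
    (Matrix.of fun i j => Complex.exp (Complex.I * ψ / 2) • z.alphaStar (j, i))
    (Matrix.of fun j i => Complex.exp (Complex.I * ψ / 2) • z.alpha (j, i))
    (Complex.exp (Complex.I * ψ) • hermMatrix fun p => z.even (Sum.inr p))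

/-! ### Superfunctions -/

/-- Multi-indices `(j₁, j₂)`: the sets of the `η^*` and of the `η` that occur in a monomial. -/
abbrev MonIdx (k₁ k₂ : ℕ) : Type := Finset (OddIdx k₁ k₂) × Finset (OddIdx k₁ k₂)

/-- A superfunction `f(x, η) = ∑ f_{j₁ j₂}(x) ∏ₙ (η_n^*)^{j₁ n} η_n^{j₂ n}`, given by its
complex-valued coefficients. -/
abbrev Superfunction (k₁ k₂ : ℕ) : Type := MonIdx k₁ k₂ → HermPair k₁ k₂ → ℂ

/-- The body `f(x, 0)` of a superfunction, a function on pairs of Hermitian matrices. -/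
def Superfunction.atBody {k₁ k₂ : ℕ} (f : Superfunction k₁ k₂) : HermPair k₁ k₂ → ℂ :=
  f (∅, ∅)

/-- The ordered monomial `∏ₙ (α_n^*)^{j₁ n} α_n^{j₂ n}` at a point. -/
def SymPoint.monomial {N k₁ k₂ : ℕ} (z : SymPoint N k₁ k₂) (J : MonIdx k₁ k₂) : Grassmann N :=
  ((List.finRange k₂ ×ˢ List.finRange k₁).map fun q =>
    (if q ∈ J.1 then z.alphaStar q else 1) * (if q ∈ J.2 then z.alpha q else 1)).prod

/-- The real body of the even coordinates. -/
def SymPoint.base {N k₁ k₂ : ℕ} (z : SymPoint N k₁ k₂) : HermPair k₁ k₂ :=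
  fun p => (body (z.even p)).re

/-- The value of an ordinary function at the even coordinates, by Taylor expansion about their
body.  The souls are even, so that products of more than `N` of them vanish. -/
def SymPoint.taylor {N k₁ k₂ : ℕ} (z : SymPoint N k₁ k₂) (g : HermPair k₁ k₂ → ℂ) :
    Grassmann N :=
  ∑ j ∈ Finset.range (N + 1), ∑ i : Fin j → EvenIdx k₁ k₂,
    ((Nat.factorial j : ℂ)⁻¹ * iteratedFDeriv ℝ j g z.base (fun l => Pi.single (i l) 1)) •
      (List.ofFn fun l => soul (z.even (i l))).prod

/-- The value of a superfunction at a point. -/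
def Superfunction.eval {N k₁ k₂ : ℕ} (f : Superfunction k₁ k₂) (z : SymPoint N k₁ k₂) :
    Grassmann N :=
  ∑ J : MonIdx k₁ k₂, z.taylor (f J) * z.monomial J

/-- Invariance under `U(k₁/k₂)`: `f(U⁻¹ Σ U) = f(Σ)`. -/
def Superfunction.IsInvariant {k₁ k₂ : ℕ} (N : ℕ) (ψ : ℝ) (f : Superfunction k₁ k₂) : Prop :=
  ∀ (U : SuperMatrix N k₁ k₂) (z w : SymPoint N k₁ k₂), IsUnitarySuperMatrix U →
    w.toMatrix ψ = superAdjoint U * z.toMatrix ψ * U → f.eval w = f.eval z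

/-- Zero boundary condition at infinity.  Up to the coefficient of the top monomial, whose
integral is taken, every coefficient is `o(‖x‖^{-(k₁-k₂)² - m})`, where `m` is the degree of its
monomial.  For `k₁ = k₂` this says for the body that `f(x, 0)` tends to zero. -/
def Superfunction.VanishesAtInfinity {k₁ k₂ : ℕ} (f : Superfunction k₁ k₂) : Prop :=
  ∀ J : MonIdx k₁ k₂, J ≠ (Finset.univ, Finset.univ) →
    Filter.Tendsto
      (fun x => (‖x‖ : ℂ) ^ (((k₁ : ℤ) - k₂).natAbs ^ 2 + (J.1.card + J.2.card)) * f J x)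
      (Filter.cocompact (HermPair k₁ k₂)) (nhds 0)

/-- The Berezin integral `∫ f(x, η) d[η]` with `∫ η dη = ∫ η^* dη^* = (2π)^{-1/2}` and
`d[η] = ∏ dη_n dη_n^*`: the coefficient of `∏ₙ η_n^* η_n` times `(2π)^{-k₁ k₂}`. -/
def Superfunction.berezin {k₁ k₂ : ℕ} (f : Superfunction k₁ k₂) (x : HermPair k₁ k₂) : ℂ :=
  f (Finset.univ, Finset.univ) x / (2 * Real.pi : ℂ) ^ (k₁ * k₂)

/-! ### Embeddings of smaller Hermitian matrices -/

/-- A Hermitian `d × d` matrix as the upper left corner of a `k × k` matrix, with zeros elsewhere,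
in coordinates. -/
def padZero {d : ℕ} (k : ℕ) (a : Fin d × Fin d → ℝ) : Fin k × Fin k → ℝ :=
  fun p => if h : p.1.val < d ∧ p.2.val < d then a (⟨p.1.val, h.1⟩, ⟨p.2.val, h.2⟩) else 0

/-- The embedding of `Herm(2,d)` in the boson-boson block. -/
def embedBoson {d : ℕ} (k₁ k₂ : ℕ) (a : Fin d × Fin d → ℝ) : HermPair k₁ k₂ :=
  Sum.elim (padZero k₁ a) 0

/-- The embedding of `Herm(2,d)` in the fermion-fermion block; the supermatrix at this point has
the fermion-fermion block `e^{iψ} σ`, as the coordinates are those of `Σ₂` in `e^{iψ} Σ₂`. -/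
def embedFermion {d : ℕ} (k₁ k₂ : ℕ) (a : Fin d × Fin d → ℝ) : HermPair k₁ k₂ :=
  Sum.elim 0 (padZero k₂ a)

end SuperInt

end

/-!
The integral localizes, one pair of odd variables at a time, by means of a single odd symmetry.

Let `b` be the real `k₁ × k₂` matrix that pairs as many boson as fermion indices as possible.
Invariance under the odd rotations `1 + [[0, u b e], [-ū b† e, 0]]`, with an odd vector `e` and a
phase `u`, splits into two complex directions, and the one belonging to `b` annihilates the
superfunction (`etaStar_mul_variation`).  This vector field `Q` has `Q α = 0`,
`Q α_q^* = e^{-iψ/2} m_q(x)` and `Q x = ∑ α_q V_q`, where the entries of `m = σ₁ b - e^{iψ} b σ₂` are linear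
in the body `x`.  The components of `Q f = 0` along the monomials of odd degree are the Ward
identities (`ward_identity`): on the plane where `m_q` vanishes for all `q` before `t`, `m_t`
times the coefficient of the pairs from `t` on is the derivative along `V_t` of the coefficient of
the pairs after `t`, up to derivatives along `V_q` with `q` after `t`.

The entries `m_q` and the real coordinates `Y` of the corner that `b` leaves out are coordinates
of the space of pairs of Hermitian matrices, and in them `V_q` is a multiple of `∂/∂m̄_q`
(`oddDeriv_eq_dbarAt`).  Division by `m_t` therefore produces the Cauchy kernel `1 / m_t`, and as
`∂/∂m̄ (1 / m)` is `π` times the delta function, integration by parts turns the integral over the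
plane into that over the plane with `m_t = 0` as well (`tendsto_planeIntegral_add`).  The kernel
is regularized as `m̄ / (|m|² + s²)` and the integrals are cut off at radius `R`; the terms in
which a derivative hits a cutoff tend to zero by the boundary condition
(`norm_integral_error_le`).  After `k₁ k₂` steps the integral of `f(0, Y)` over the corner is left
(`integral_eq_of_localization`).

The remaining constants are the factors of the vectors `V_q` (`prod_dbarFactor`) and the Jacobian
of the coordinates (`map_coordEquiv`), which is read off from Gaussian integrals: a shear
diagonalizes the quadratic form `∑ |m_q|² + ∑ Y²` (`sum_sq_coordMap`).
-/

noncomputable section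

namespace SuperInt

variable {N k₁ k₂ : ℕ}

local notation "ι" => ExteriorAlgebra.ι ℂ

/-! ### Interior products and odd vectors -/

/-- The interior product with a linear form, an odd derivation of the Grassmann algebra. -/
def interior (d : Module.Dual ℂ (Fin N ⊕ Fin N → ℂ)) : Grassmann N →ₗ[ℂ] Grassmann N :=
  CliffordAlgebra.contractLeft (Q := (0 : QuadraticForm ℂ (Fin N ⊕ Fin N → ℂ))) d

theorem interior_ι_mul (d : Module.Dual ℂ (Fin N ⊕ Fin N → ℂ)) (v : Fin N ⊕ Fin N → ℂ)
    (x : Grassmann N) : interior d (ι v * x) = d v • x - ι v * interior d x :=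
  CliffordAlgebra.contractLeft_ι_mul (Q := (0 : QuadraticForm ℂ (Fin N ⊕ Fin N → ℂ))) d v x

theorem interior_one (d : Module.Dual ℂ (Fin N ⊕ Fin N → ℂ)) :
    interior d (1 : Grassmann N) = 0 :=
  CliffordAlgebra.contractLeft_one (Q := (0 : QuadraticForm ℂ (Fin N ⊕ Fin N → ℂ))) d

theorem interior_interior (d : Module.Dual ℂ (Fin N ⊕ Fin N → ℂ)) (x : Grassmann N) :
    interior d (interior d x) = 0 :=
  CliffordAlgebra.contractLeft_contractLeft d x

theorem interior_comm (d d' : Module.Dual ℂ (Fin N ⊕ Fin N → ℂ)) (x : Grassmann N) :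
    interior d (interior d' x) = -interior d' (interior d x) :=
  CliffordAlgebra.contractLeft_comm d d' x

theorem interior_add (d d' : Module.Dual ℂ (Fin N ⊕ Fin N → ℂ)) (x : Grassmann N) :
    interior (d + d') x = interior d x + interior d' x := by
  simp [interior]

theorem interior_smul (c : ℂ) (d : Module.Dual ℂ (Fin N ⊕ Fin N → ℂ)) (x : Grassmann N) :
    interior (c • d) x = c • interior d x := by
  simp [interior]

theorem ι_mul_ι_comm (v w : Fin N ⊕ Fin N → ℂ) :
    (ι v * ι w : Grassmann N) = -(ι w * ι v) :=
  eq_neg_of_add_eq_zero_left (ExteriorAlgebra.ι_add_mul_swap v w)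

theorem ι_mul_self (v : Fin N ⊕ Fin N → ℂ) : (ι v * ι v : Grassmann N) = 0 :=
  ExteriorAlgebra.ι_sq_zero v

theorem ι_mul_ι_mul_ι_self (v w : Fin N ⊕ Fin N → ℂ) :
    (ι v * ι w * ι v : Grassmann N) = 0 := by
  rw [mul_assoc, ι_mul_ι_comm w v, mul_neg, ← mul_assoc, ι_mul_self, zero_mul, neg_zero]

theorem ι_mem_oddPart (v : Fin N ⊕ Fin N → ℂ) : ι v ∈ oddPart N :=
  CliffordAlgebra.ι_mem_evenOdd_one (0 : QuadraticForm ℂ (Fin N ⊕ Fin N → ℂ)) v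

theorem ι_mul_ι_mem_evenPart (v w : Fin N ⊕ Fin N → ℂ) : ι v * ι w ∈ evenPart N :=
  CliffordAlgebra.ι_mul_ι_mem_evenOdd_zero (0 : QuadraticForm ℂ (Fin N ⊕ Fin N → ℂ)) v w

theorem algebraMap_mem_evenPart (c : ℂ) : algebraMap ℂ (Grassmann N) c ∈ evenPart N :=
  CliffordAlgebra.one_le_evenOdd_zero (0 : QuadraticForm ℂ (Fin N ⊕ Fin N → ℂ))
    (Submodule.algebraMap_mem c)

theorem body_ι (v : Fin N ⊕ Fin N → ℂ) : body (ι v : Grassmann N) = 0 := by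
  simp [body, ExteriorAlgebra.algebraMapInv]

theorem body_algebraMap (c : ℂ) : body (algebraMap ℂ (Grassmann N) c) = c := by
  simp

theorem body_ι_mul (v : Fin N ⊕ Fin N → ℂ) (x : Grassmann N) : body (ι v * x) = 0 := by
  rw [map_mul, body_ι, zero_mul]

theorem conj_smul (c : ℂ) (a : Grassmann N) : conj (c • a) = starRingEnd ℂ c • conj a := by
  rw [Algebra.smul_def, conj_mul, conj_algebraMap, Algebra.smul_def, Algebra.commutes]

theorem conj_zero : conj (0 : Grassmann N) = 0 := by
  simpa using conj_smul 0 (0 : Grassmann N)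

theorem conj_one : conj (1 : Grassmann N) = 1 := by
  simpa using conj_algebraMap (N := N) 1

/-! ### Hermitian coordinates of arbitrary matrices -/

/-- The inverse of `hermMatrix`, with values in a complex vector space: the coordinates `a (n, n)`,
and `a (n, m)`, `a (m, n)` for `n < m`, of an arbitrary matrix. -/
def hermCoord {A : Type} [AddCommGroup A] [Module ℂ A] {k : ℕ} (M : Fin k → Fin k → A) :
    Fin k × Fin k → A := fun p =>
  if p.1 < p.2 then (1 / 2 : ℂ) • (M p.1 p.2 + M p.2 p.1)
  else if p.2 < p.1 then (1 / (2 * Complex.I)) • (M p.2 p.1 - M p.1 p.2)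
  else M p.1 p.1

theorem hermMatrix_hermCoord {A V : Type} [Ring A] [Algebra ℂ A] [AddCommGroup V] [Module ℂ V]
    {k : ℕ} (φ : V →ₗ[ℂ] A) (M : Fin k → Fin k → V) (n m : Fin k) :
    hermMatrix (fun p => φ (hermCoord M p)) n m = φ (M n m) := by
  have hI : Complex.I * (1 / (2 * Complex.I)) = 1 / 2 := by field_simp
  rcases lt_trichotomy n m with h | h | h
  · simp only [hermMatrix, hermCoord, Matrix.of_apply, h, h.not_gt, if_true, if_false, map_smul,
      smul_smul, hI, map_add, map_sub]
    module
  · subst h; simp [hermMatrix, hermCoord]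
  · simp only [hermMatrix, hermCoord, Matrix.of_apply, h, h.not_gt, if_true, if_false, map_smul,
      smul_smul, hI, map_add, map_sub]
    module

theorem hermCoord_sum_smul {V κ : Type} [AddCommGroup V] [Module ℂ V] [Fintype κ] {k : ℕ}
    (c : κ → Fin k → Fin k → ℂ) (y : κ → V) (p : Fin k × Fin k) :
    hermCoord (fun n m => ∑ q, c q n m • y q) p = ∑ q, hermCoord (c q) p • y q := by
  unfold hermCoord
  split_ifs
  · simp only [← Finset.sum_add_distrib, Finset.smul_sum]
    exact Finset.sum_congr rfl fun q _ => by simp only [smul_eq_mul]; module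
  · simp only [← Finset.sum_sub_distrib, Finset.smul_sum]
    exact Finset.sum_congr rfl fun q _ => by simp only [smul_eq_mul]; module
  · rfl

theorem hermMatrix_map {A B : Type} [Ring A] [Algebra ℂ A] [Ring B] [Algebra ℂ B] {k : ℕ}
    (φ : A →ₗ[ℂ] B) (a : Fin k × Fin k → A) (n m : Fin k) :
    hermMatrix (fun p => φ (a p)) n m = φ (hermMatrix a n m) := by
  simp only [hermMatrix, Matrix.of_apply]
  split_ifs <;> simp

theorem hermMatrix_add {A : Type} [Ring A] [Algebra ℂ A] {k : ℕ} (a b : Fin k × Fin k → A)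
    (n m : Fin k) : hermMatrix (fun p => a p + b p) n m = hermMatrix a n m + hermMatrix b n m := by
  simp only [hermMatrix, Matrix.of_apply]
  split_ifs
  · module
  · module
  · rfl

/-! ### First-order variation of a superfunction -/

/-- A point whose even coordinates are the real numbers `x p` plus a multiple of one odd vector `e`,
and whose odd coordinates are vectors. -/
def vecPoint (x : HermPair k₁ k₂) (e : Fin N ⊕ Fin N → ℂ) (Δ : EvenIdx k₁ k₂ → Fin N ⊕ Fin N → ℂ)
    (a s : OddIdx k₁ k₂ → Fin N ⊕ Fin N → ℂ) : SymPoint N k₁ k₂ where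
  even p := algebraMap ℂ (Grassmann N) (x p : ℂ) + ι e * ι (Δ p)
  alpha q := ι (a q)
  alphaStar q := ι (s q)
  even_mem p := Submodule.add_mem _ (algebraMap_mem_evenPart _) (ι_mul_ι_mem_evenPart _ _)
  alpha_mem q := ι_mem_oddPart _
  alphaStar_mem q := ι_mem_oddPart _
  body_real p := by rw [map_add, body_algebraMap, body_ι_mul]; simp

theorem base_vecPoint (x : HermPair k₁ k₂) (e : Fin N ⊕ Fin N → ℂ)
    (Δ : EvenIdx k₁ k₂ → Fin N ⊕ Fin N → ℂ) (a s : OddIdx k₁ k₂ → Fin N ⊕ Fin N → ℂ) :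
    (vecPoint x e Δ a s).base = x := by
  funext p
  simp only [SymPoint.base, vecPoint]
  rw [map_add, body_algebraMap, body_ι_mul]; simp

theorem soul_vecPoint (x : HermPair k₁ k₂) (e : Fin N ⊕ Fin N → ℂ)
    (Δ : EvenIdx k₁ k₂ → Fin N ⊕ Fin N → ℂ) (a s : OddIdx k₁ k₂ → Fin N ⊕ Fin N → ℂ)
    (p : EvenIdx k₁ k₂) : soul ((vecPoint x e Δ a s).even p) = ι e * ι (Δ p) := by
  simp only [soul, vecPoint]
  rw [map_add, body_algebraMap, body_ι_mul]; simp

/-- As the souls are multiples of one odd vector, the Taylor expansion stops at first order. -/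
theorem taylor_vecPoint (hN : 1 ≤ N) (x : HermPair k₁ k₂) (e : Fin N ⊕ Fin N → ℂ)
    (Δ : EvenIdx k₁ k₂ → Fin N ⊕ Fin N → ℂ) (a s : OddIdx k₁ k₂ → Fin N ⊕ Fin N → ℂ)
    (g : HermPair k₁ k₂ → ℂ) :
    (vecPoint x e Δ a s).taylor g = algebraMap ℂ (Grassmann N) (g x) +
      ι e * ι (∑ p, fderiv ℝ g x (Pi.single p 1) • Δ p) := by
  unfold SymPoint.taylor
  rw [base_vecPoint]
  obtain ⟨M, rfl⟩ : ∃ M, N = M + 1 := ⟨N - 1, by omega⟩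
  rw [Finset.sum_range_succ', Finset.sum_range_succ']
  simp only [soul_vecPoint]
  have h0 : ∀ j ∈ Finset.range M, ∑ i : Fin (j + 1 + 1) → EvenIdx k₁ k₂,
      ((Nat.factorial (j + 1 + 1) : ℂ)⁻¹ *
        iteratedFDeriv ℝ (j + 1 + 1) g x (fun l => Pi.single (i l) 1)) •
      (List.ofFn fun l => (ι e * ι (Δ (i l)) : Grassmann (M + 1))).prod = 0 := by
    intro j _
    refine Finset.sum_eq_zero fun i _ => ?_
    rw [List.ofFn_succ, List.ofFn_succ, List.prod_cons, List.prod_cons, ← mul_assoc, ← mul_assoc,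
      ι_mul_ι_mul_ι_self]
    simp
  rw [Finset.sum_eq_zero h0, zero_add]
  refine (add_comm _ _).trans ?_
  congr 1
  · rw [Algebra.algebraMap_eq_smul_one]
    simp
  · rw [← (Equiv.funUnique (Fin 1) (EvenIdx k₁ k₂)).symm.sum_comp]
    rw [map_sum, Finset.mul_sum]
    refine Finset.sum_congr rfl fun p _ => ?_
    rw [map_smul, mul_smul_comm]
    simp [iteratedFDeriv_one_apply]

/-- If each odd vector `v` is shifted by `d v • e`, a product of odd vectors changes by `e` times
its interior product with `d`, exactly: the higher orders contain the square of `e`. -/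
theorem prod_first_order (e : Fin N ⊕ Fin N → ℂ) (d : Module.Dual ℂ (Fin N ⊕ Fin N → ℂ))
    (a s : OddIdx k₁ k₂ → Fin N ⊕ Fin N → ℂ) (J : MonIdx k₁ k₂) (l : List (OddIdx k₁ k₂)) :
    (l.map fun q => (if q ∈ J.1 then (ι (s q + d (s q) • e) : Grassmann N) else 1) *
        (if q ∈ J.2 then ι (a q + d (a q) • e) else 1)).prod =
      (l.map fun q => (if q ∈ J.1 then (ι (s q) : Grassmann N) else 1) *
        (if q ∈ J.2 then ι (a q) else 1)).prod +
      ι e * interior d (l.map fun q => (if q ∈ J.1 then (ι (s q) : Grassmann N) else 1) *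
        (if q ∈ J.2 then ι (a q) else 1)).prod := by
  have key : ∀ (v : Fin N ⊕ Fin N → ℂ) (P : Grassmann N),
      ι (v + d v • e) * (P + ι e * interior d P) = ι v * P + ι e * interior d (ι v * P) := by
    intro v P
    have h1 : (ι e * (ι e * interior d P) : Grassmann N) = 0 := by
      rw [← mul_assoc, ι_mul_self, zero_mul]
    have h2 : (ι v * (ι e * interior d P) : Grassmann N) = -(ι e * (ι v * interior d P)) := by
      rw [← mul_assoc, ι_mul_ι_comm, neg_mul, mul_assoc]
    rw [interior_ι_mul, map_add, map_smul, add_mul, mul_add, mul_add, smul_mul_assoc,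
      smul_mul_assoc, h1, h2, mul_sub, mul_smul_comm]
    module
  induction l with
  | nil => simp [interior_one]
  | cons q l ih =>
    simp only [List.map_cons, List.prod_cons]
    rw [ih]
    by_cases h1 : q ∈ J.1 <;> by_cases h2 : q ∈ J.2 <;>
      simp only [h1, h2, if_true, if_false, one_mul, mul_one, mul_assoc, key]

theorem monomial_first_order (x : HermPair k₁ k₂) (e : Fin N ⊕ Fin N → ℂ)
    (Δ : EvenIdx k₁ k₂ → Fin N ⊕ Fin N → ℂ) (d : Module.Dual ℂ (Fin N ⊕ Fin N → ℂ))
    (a s : OddIdx k₁ k₂ → Fin N ⊕ Fin N → ℂ) (J : MonIdx k₁ k₂) :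
    (vecPoint x e Δ (fun q => a q + d (a q) • e) (fun q => s q + d (s q) • e)).monomial J =
      (vecPoint x 0 0 a s).monomial J + ι e * interior d ((vecPoint x 0 0 a s).monomial J) :=
  prod_first_order e d a s J _

/-- The variation of a superfunction along a vector field with even components `Δ` and odd
components given by the linear form `d`, at the point with body `x` and odd coordinates `a`, `s`. -/
def Superfunction.variation (f : Superfunction k₁ k₂) (x : HermPair k₁ k₂)
    (a s : OddIdx k₁ k₂ → Fin N ⊕ Fin N → ℂ) (Δ : EvenIdx k₁ k₂ → Fin N ⊕ Fin N → ℂ)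
    (d : Module.Dual ℂ (Fin N ⊕ Fin N → ℂ)) : Grassmann N :=
  ∑ J, (ι (∑ p, fderiv ℝ (f J) x (Pi.single p 1) • Δ p) * (vecPoint x 0 0 a s).monomial J +
    f J x • interior d ((vecPoint x 0 0 a s).monomial J))

/-- The value of a superfunction at a point moved along an odd vector `e` is of first order in
`e`. -/
theorem eval_first_order (hN : 1 ≤ N) (f : Superfunction k₁ k₂) (x : HermPair k₁ k₂)
    (e : Fin N ⊕ Fin N → ℂ) (Δ : EvenIdx k₁ k₂ → Fin N ⊕ Fin N → ℂ)
    (d : Module.Dual ℂ (Fin N ⊕ Fin N → ℂ)) (a s : OddIdx k₁ k₂ → Fin N ⊕ Fin N → ℂ) :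
    f.eval (vecPoint x e Δ (fun q => a q + d (a q) • e) (fun q => s q + d (s q) • e)) =
      f.eval (vecPoint x 0 0 a s) + ι e * f.variation x a s Δ d := by
  unfold Superfunction.eval Superfunction.variation
  rw [Finset.mul_sum, ← Finset.sum_add_distrib]
  refine Finset.sum_congr rfl fun J _ => ?_
  rw [monomial_first_order, taylor_vecPoint hN, taylor_vecPoint hN]
  have h : ∀ P : Grassmann N, ∀ v : Fin N ⊕ Fin N → ℂ, ι e * ι v * (ι e * P) = 0 := by
    intro P v
    rw [← mul_assoc, ι_mul_ι_mul_ι_self, zero_mul]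
  have hc : ∀ P : Grassmann N, algebraMap ℂ (Grassmann N) (f J x) * P = f J x • P :=
    fun P => (Algebra.smul_def _ _).symm
  rw [add_mul, mul_add, mul_add, h, map_zero (ι), zero_mul, add_zero, add_zero, mul_add, hc, hc,
    mul_smul_comm, mul_assoc]
  abel

theorem variation_add (f : Superfunction k₁ k₂) (x : HermPair k₁ k₂)
    (a s : OddIdx k₁ k₂ → Fin N ⊕ Fin N → ℂ) (Δ Δ' : EvenIdx k₁ k₂ → Fin N ⊕ Fin N → ℂ)
    (d d' : Module.Dual ℂ (Fin N ⊕ Fin N → ℂ)) :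
    f.variation x a s (Δ + Δ') (d + d') = f.variation x a s Δ d + f.variation x a s Δ' d' := by
  unfold Superfunction.variation
  rw [← Finset.sum_add_distrib]
  refine Finset.sum_congr rfl fun J _ => ?_
  simp only [Pi.add_apply, smul_add, Finset.sum_add_distrib, map_add, interior_add, add_mul]
  abel

theorem variation_smul (f : Superfunction k₁ k₂) (x : HermPair k₁ k₂)
    (a s : OddIdx k₁ k₂ → Fin N ⊕ Fin N → ℂ) (Δ : EvenIdx k₁ k₂ → Fin N ⊕ Fin N → ℂ)
    (d : Module.Dual ℂ (Fin N ⊕ Fin N → ℂ)) (c : ℂ) :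
    f.variation x a s (c • Δ) (c • d) = c • f.variation x a s Δ d := by
  unfold Superfunction.variation
  rw [Finset.smul_sum]
  refine Finset.sum_congr rfl fun J _ => ?_
  simp only [Pi.smul_apply, smul_comm _ c, ← Finset.smul_sum, map_smul, interior_smul,
    smul_mul_assoc, smul_add]

/-! ### Infinitesimal odd rotations -/

/-- The boson-boson block of the body of a supermatrix. -/
def bosonBlock (x : HermPair k₁ k₂) : Matrix (Fin k₁) (Fin k₁) ℂ :=
  hermMatrix fun p => (x (Sum.inl p) : ℂ)

/-- The fermion-fermion block of the body of a supermatrix, without the Wick rotation. -/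
def fermionBlock (x : HermPair k₁ k₂) : Matrix (Fin k₂) (Fin k₂) ℂ :=
  hermMatrix fun p => (x (Sum.inr p) : ℂ)

/-- The square root `e^{iψ/2}` of the Wick phase. -/
def halfPhase (ψ : ℝ) : ℂ := Complex.exp (Complex.I * ψ / 2)

theorem halfPhase_ne_zero (ψ : ℝ) : halfPhase ψ ≠ 0 := Complex.exp_ne_zero _

theorem halfPhase_sq (ψ : ℝ) : halfPhase ψ ^ 2 = Complex.exp (Complex.I * ψ) := by
  rw [halfPhase, ← Complex.exp_nat_mul]; congr 1; push_cast; ring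

/-- The supermatrix `[[1, u b e], [-ū b† e, 1]]` with an odd vector `e` and a real matrix `b`.  It
is unitary for real `e`, without corrections of higher order, as `e` squares to zero. -/
def oddRotation (b : Fin k₁ → Fin k₂ → ℝ) (u : ℂ) (e : Fin N ⊕ Fin N → ℂ) :
    SuperMatrix N k₁ k₂ :=
  Matrix.fromBlocks 1 (Matrix.of fun i j => (u * b i j) • ι e)
    (-Matrix.of fun j i => (starRingEnd ℂ u * b i j) • ι e) 1

/-- The change of the even coordinates under `oddRotation`, up to the factor `e`, in terms of the
odd coordinates `a` of `α` and `s` of `α^*`.  The phase `u` and its conjugate `u'` are independent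
arguments, so that the part linear in `u` can be split off. -/
def evenVariation (ψ : ℝ) (b : Fin k₁ → Fin k₂ → ℝ) (u u' : ℂ)
    (a s : OddIdx k₁ k₂ → Fin N ⊕ Fin N → ℂ) : EvenIdx k₁ k₂ → Fin N ⊕ Fin N → ℂ :=
  Sum.elim
    (hermCoord fun n m => -(∑ j, (u * halfPhase ψ * b n j) • a (j, m)) +
      ∑ j, (u' * halfPhase ψ * b m j) • s (j, n))
    (hermCoord fun n m => -(∑ i, (u * (halfPhase ψ)⁻¹ * b i m) • a (n, i)) +
      ∑ i, (u' * (halfPhase ψ)⁻¹ * b i n) • s (m, i))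

/-- The change `σ₁ b - e^{iψ} b σ₂` of the boson-fermion block under an odd rotation. -/
def upperVariation (ψ : ℝ) (b : Fin k₁ → Fin k₂ → ℝ) (x : HermPair k₁ k₂) (i : Fin k₁)
    (j : Fin k₂) : ℂ :=
  ∑ l, bosonBlock x i l * b l j - halfPhase ψ ^ 2 * ∑ l, b i l * fermionBlock x l j

/-- The change `b† σ₁ - e^{iψ} σ₂ b†` of the fermion-boson block under an odd rotation. -/
def lowerVariation (ψ : ℝ) (b : Fin k₁ → Fin k₂ → ℝ) (x : HermPair k₁ k₂) (j : Fin k₂)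
    (i : Fin k₁) : ℂ :=
  ∑ l, b l j * bosonBlock x l i - halfPhase ψ ^ 2 * ∑ l, fermionBlock x j l * b i l

theorem oddBlock_mul_mul_oddBlock {κ μ ν π : Type} [Fintype μ] [Fintype ν]
    (e : Fin N ⊕ Fin N → ℂ) (c : κ → μ → ℂ) (X : Matrix μ ν (Grassmann N)) (c' : ν → π → ℂ)
    (hX : ∀ i j, ι e * X i j * ι e = 0) :
    (Matrix.of fun i j => c i j • (ι e : Grassmann N)) * X *
      (Matrix.of fun i j => c' i j • (ι e : Grassmann N)) = 0 := by
  ext i j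
  rw [Matrix.mul_apply]
  refine Finset.sum_eq_zero fun n _ => ?_
  rw [Matrix.mul_apply, Finset.sum_mul]
  refine Finset.sum_eq_zero fun m _ => ?_
  simp only [Matrix.of_apply, smul_mul_assoc, mul_smul_comm, hX, smul_zero]

theorem superAdjoint_oddRotation (b : Fin k₁ → Fin k₂ → ℝ) (u : ℂ) {e : Fin N ⊕ Fin N → ℂ}
    (he : conjVec e = e) :
    superAdjoint (oddRotation b u e) = Matrix.fromBlocks 1
      (-Matrix.of fun i j => (u * b i j) • (ι e : Grassmann N))
      (Matrix.of fun j i => (starRingEnd ℂ u * b i j) • ι e) 1 := by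
  have hneg : ∀ y : Grassmann N, conj (-y) = -conj y := fun y => by
    simpa using conj_smul (-1) y
  ext (i | i) (j | j)
  · simp only [superAdjoint, oddRotation, Matrix.of_apply, Matrix.fromBlocks_apply₁₁,
      Matrix.one_apply]
    by_cases h : j = i
    · simp [h, conj_one]
    · simp [h, Ne.symm h, conj_zero]
  · simp [superAdjoint, oddRotation, hneg, conj_smul, conj_ι, he]
  · simp [superAdjoint, oddRotation, conj_smul, conj_ι, he]
  · simp only [superAdjoint, oddRotation, Matrix.of_apply, Matrix.fromBlocks_apply₂₂,
      Matrix.one_apply]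
    by_cases h : j = i
    · simp [h, conj_one]
    · simp [h, Ne.symm h, conj_zero]

theorem isUnitary_oddRotation (b : Fin k₁ → Fin k₂ → ℝ) (u : ℂ) {e : Fin N ⊕ Fin N → ℂ}
    (he : conjVec e = e) : IsUnitarySuperMatrix (oddRotation b u e) := by
  have h1 : ∀ k (i j : Fin k), (1 : Matrix (Fin k) (Fin k) (Grassmann N)) i j ∈ evenPart N := by
    intro k i j
    rw [Matrix.one_apply]
    split_ifs
    · simpa using algebraMap_mem_evenPart (N := N) 1
    · exact zero_mem _
  have h2 : ∀ {κ μ ν : Type} [Fintype μ] (c : κ → μ → ℂ) (c' : μ → ν → ℂ),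
      (Matrix.of fun i j => c i j • (ι e : Grassmann N)) *
        (Matrix.of fun i j => c' i j • (ι e : Grassmann N)) = 0 := by
    intro κ μ ν _ c c'
    ext i j
    rw [Matrix.mul_apply]
    refine Finset.sum_eq_zero fun n _ => ?_
    simp only [Matrix.of_apply, smul_mul_assoc, mul_smul_comm, ι_mul_self, smul_zero]
  refine ⟨⟨fun i j => h1 _ i j, fun i j => h1 _ i j, fun i j => ?_, fun i j => ?_⟩, ?_, ?_⟩
  · exact Submodule.smul_mem _ _ (ι_mem_oddPart e)
  · exact Submodule.neg_mem _ (Submodule.smul_mem _ _ (ι_mem_oddPart e))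
  · rw [superAdjoint_oddRotation b u he, oddRotation, Matrix.fromBlocks_multiply]
    simp only [Matrix.one_mul, Matrix.mul_one, Matrix.neg_mul, Matrix.mul_neg, h2, neg_zero,
      add_zero, zero_add, add_neg_cancel, Matrix.fromBlocks_one]
  · rw [superAdjoint_oddRotation b u he, oddRotation, Matrix.fromBlocks_multiply]
    simp only [Matrix.one_mul, Matrix.mul_one, Matrix.neg_mul, Matrix.mul_neg, h2, neg_zero,
      add_zero, zero_add, neg_add_cancel, Matrix.fromBlocks_one]

theorem toMatrix_vecPoint (ψ : ℝ) (x : HermPair k₁ k₂) (e : Fin N ⊕ Fin N → ℂ)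
    (M₁ : Fin k₁ → Fin k₁ → Fin N ⊕ Fin N → ℂ) (M₂ : Fin k₂ → Fin k₂ → Fin N ⊕ Fin N → ℂ)
    (a s : OddIdx k₁ k₂ → Fin N ⊕ Fin N → ℂ) :
    (vecPoint x e (Sum.elim (hermCoord M₁) (hermCoord M₂)) a s).toMatrix ψ =
      Matrix.fromBlocks
        ((bosonBlock x).map (algebraMap ℂ (Grassmann N)) + Matrix.of fun n m => ι e * ι (M₁ n m))
        (Matrix.of fun i j => halfPhase ψ • ι (s (j, i)))
        (Matrix.of fun j i => halfPhase ψ • ι (a (j, i)))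
        ((halfPhase ψ ^ 2 • fermionBlock x).map (algebraMap ℂ (Grassmann N)) +
          halfPhase ψ ^ 2 • Matrix.of fun n m => ι e * ι (M₂ n m)) := by
  have key : ∀ {k : ℕ} (y : Fin k × Fin k → ℂ) (M : Fin k → Fin k → Fin N ⊕ Fin N → ℂ),
      hermMatrix (fun p => algebraMap ℂ (Grassmann N) (y p) + ι e * ι (hermCoord M p)) =
        (hermMatrix y).map (algebraMap ℂ (Grassmann N)) +
          Matrix.of fun n m => ι e * ι (M n m) := by
    intro k y M
    ext n m
    rw [hermMatrix_add, Matrix.add_apply]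
    congr 1
    · exact hermMatrix_map (Algebra.linearMap ℂ (Grassmann N)) y n m
    · exact hermMatrix_hermCoord ((LinearMap.mulLeft ℂ (ι e : Grassmann N)).comp (ι)) M n m
  unfold SymPoint.toMatrix
  congr 1
  · exact key _ M₁
  · rw [halfPhase_sq]
    refine (congrArg _ (key (fun p => (x (Sum.inr p) : ℂ)) M₂)).trans ?_
    rw [smul_add]
    congr 1
    ext n m
    rw [Matrix.smul_apply, Matrix.map_apply, Matrix.map_apply, Matrix.smul_apply, smul_eq_mul,
      map_mul, Algebra.smul_def]
    rfl

/-- Conjugation with `oddRotation` moves the coordinates to first order in `e` only: all terms of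
second order contain `e` twice. -/
theorem toMatrix_oddRotation (ψ : ℝ) (b : Fin k₁ → Fin k₂ → ℝ) (u : ℂ)
    {e : Fin N ⊕ Fin N → ℂ} (he : conjVec e = e) (x : HermPair k₁ k₂)
    (a s : OddIdx k₁ k₂ → Fin N ⊕ Fin N → ℂ) (d : Module.Dual ℂ (Fin N ⊕ Fin N → ℂ))
    (ha : ∀ q, d (a q) = starRingEnd ℂ u * ((halfPhase ψ)⁻¹ * lowerVariation ψ b x q.1 q.2))
    (hs : ∀ q, d (s q) = u * ((halfPhase ψ)⁻¹ * upperVariation ψ b x q.2 q.1)) :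
    (vecPoint x e (evenVariation ψ b u (starRingEnd ℂ u) a s)
        (fun q => a q + d (a q) • e) (fun q => s q + d (s q) • e)).toMatrix ψ =
      superAdjoint (oddRotation b u e) * (vecPoint x 0 0 a s).toMatrix ψ * oddRotation b u e := by
  have hz : (0 : EvenIdx k₁ k₂ → Fin N ⊕ Fin N → ℂ) =
      Sum.elim (hermCoord 0) (hermCoord 0) := by
    funext p; rcases p with p | p <;> simp [hermCoord]
  have hph := halfPhase_ne_zero ψ
  rw [hz, toMatrix_vecPoint, evenVariation, toMatrix_vecPoint, superAdjoint_oddRotation b u he,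
    oddRotation]
  set S := (bosonBlock x).map (algebraMap ℂ (Grassmann N)) with hS
  set T := (halfPhase ψ ^ 2 • fermionBlock x).map (algebraMap ℂ (Grassmann N)) with hT
  set B : Matrix (Fin k₁) (Fin k₂) (Grassmann N) :=
    Matrix.of fun i j => (u * b i j) • (ι e : Grassmann N) with hB
  set C : Matrix (Fin k₂) (Fin k₁) (Grassmann N) :=
    Matrix.of fun j i => (starRingEnd ℂ u * b i j) • (ι e : Grassmann N) with hC
  set G : Matrix (Fin k₂) (Fin k₁) (Grassmann N) :=
    Matrix.of fun j i => halfPhase ψ • (ι (a (j, i)) : Grassmann N) with hG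
  set H : Matrix (Fin k₁) (Fin k₂) (Grassmann N) :=
    Matrix.of fun i j => halfPhase ψ • (ι (s (j, i)) : Grassmann N) with hH
  have hsc : ∀ c : ℂ, (ι e * algebraMap ℂ (Grassmann N) c * ι e : Grassmann N) = 0 := fun c => by
    rw [← Algebra.commutes, mul_assoc, ι_mul_self, mul_zero]
  have hod : ∀ (c : ℂ) (v : Fin N ⊕ Fin N → ℂ), (ι e * (c • ι v) * ι e : Grassmann N) = 0 :=
    fun c v => by rw [mul_smul_comm, smul_mul_assoc, ι_mul_ι_mul_ι_self, smul_zero]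
  have hBTC : B * T * C = 0 := oddBlock_mul_mul_oddBlock e _ T _ fun i j => hsc _
  have hCSB : C * S * B = 0 := oddBlock_mul_mul_oddBlock e _ S _ fun i j => hsc _
  have hBGB : B * G * B = 0 := oddBlock_mul_mul_oddBlock e _ G _ fun i j => hod _ _
  have hCHC : C * H * C = 0 := oddBlock_mul_mul_oddBlock e _ H _ fun i j => hod _ _
  have hzero : ∀ k, (Matrix.of fun n m => ι (0 : Fin N ⊕ Fin N → ℂ) *
      ι ((0 : Fin k → Fin k → Fin N ⊕ Fin N → ℂ) n m) : Matrix (Fin k) (Fin k) (Grassmann N)) = 0 :=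
    fun k => by ext; simp
  rw [hzero, hzero, smul_zero, add_zero, add_zero, Matrix.fromBlocks_multiply,
    Matrix.fromBlocks_multiply]
  simp only [Matrix.one_mul, Matrix.mul_one, Matrix.neg_mul, Matrix.mul_neg, Matrix.add_mul, hBTC,
    hCSB, hBGB, hCHC, neg_zero, add_zero, zero_add]
  congr 1
  · rw [add_assoc]
    congr 1
    ext n m
    simp only [Matrix.of_apply, Matrix.add_apply, Matrix.neg_apply, Matrix.mul_apply, hB, hG, hH,
      hC, smul_mul_assoc, mul_smul_comm, map_add, map_neg, map_sum, map_smul, mul_add, mul_neg,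
      Finset.mul_sum]
    congr 1
    · rw [neg_inj]
      exact Finset.sum_congr rfl fun j _ => by module
    · rw [← Finset.sum_neg_distrib]
      refine Finset.sum_congr rfl fun j _ => ?_
      rw [ι_mul_ι_comm (s (j, n)) e]
      module
  · ext n m
    simp only [Matrix.of_apply, Matrix.add_apply, Matrix.neg_apply, Matrix.mul_apply, hB, hH,
      hS, hT, Matrix.map_apply, hs, upperVariation, mul_smul_comm, map_add, map_smul,
      Matrix.smul_apply, ← Algebra.commutes, ← Algebra.smul_def, smul_smul, ← Finset.sum_smul,
      smul_eq_mul]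
    have h1 : ∑ i, u * b i m * bosonBlock x n i = u * ∑ i, bosonBlock x n i * b i m := by
      rw [Finset.mul_sum]; exact Finset.sum_congr rfl fun i _ => by ring
    have h2 : ∑ i, u * b n i * (halfPhase ψ ^ 2 * fermionBlock x i m) =
        u * (halfPhase ψ ^ 2 * ∑ i, b n i * fermionBlock x i m) := by
      rw [Finset.mul_sum, Finset.mul_sum]; exact Finset.sum_congr rfl fun i _ => by ring
    rw [h1, h2, smul_add, smul_smul, mul_left_comm, mul_inv_cancel_left₀ hph]
    module
  · ext n m
    simp only [Matrix.of_apply, Matrix.add_apply, Matrix.neg_apply, Matrix.mul_apply, hC, hG,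
      hS, hT, Matrix.map_apply, ha, lowerVariation, mul_smul_comm, map_add, map_smul,
      Matrix.smul_apply, ← Algebra.commutes, ← Algebra.smul_def, smul_smul, ← Finset.sum_smul,
      smul_eq_mul]
    have h1 : ∑ i, starRingEnd ℂ u * b i n * bosonBlock x i m =
        starRingEnd ℂ u * ∑ i, b i n * bosonBlock x i m := by
      rw [Finset.mul_sum]; exact Finset.sum_congr rfl fun i _ => by ring
    have h2 : ∑ i, starRingEnd ℂ u * b m i * (halfPhase ψ ^ 2 * fermionBlock x n i) =
        starRingEnd ℂ u * (halfPhase ψ ^ 2 * ∑ i, fermionBlock x n i * b m i) := by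
      rw [Finset.mul_sum, Finset.mul_sum]; exact Finset.sum_congr rfl fun i _ => by ring
    rw [h1, h2, smul_add, smul_smul, mul_left_comm, mul_inv_cancel_left₀ hph]
    module
  · rw [add_comm (C * H), add_left_comm]
    congr 1
    ext n m
    simp only [Matrix.of_apply, Matrix.add_apply, Matrix.smul_apply, Matrix.mul_apply, hB, hG, hH,
      hC, smul_mul_assoc, mul_smul_comm, map_add, map_neg, map_sum, map_smul, mul_add, mul_neg,
      Finset.mul_sum, smul_add, smul_neg, Finset.smul_sum]
    congr 1
    · rw [← Finset.sum_neg_distrib]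
      refine Finset.sum_congr rfl fun j _ => ?_
      rw [ι_mul_ι_comm (a (n, j)) e]
      match_scalars
      field_simp
    · refine Finset.sum_congr rfl fun j _ => ?_
      match_scalars
      field_simp

theorem hermCoord_linear {V : Type} [AddCommGroup V] [Module ℂ V] {k : ℕ} (u u' : ℂ)
    (M M' : Fin k → Fin k → V) (p : Fin k × Fin k) :
    hermCoord (fun n m => u • M n m + u' • M' n m) p = u • hermCoord M p + u' • hermCoord M' p := by
  unfold hermCoord
  split_ifs
  · module
  · module
  · rfl

theorem evenVariation_linear (ψ : ℝ) (b : Fin k₁ → Fin k₂ → ℝ) (u u' : ℂ)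
    (a s : OddIdx k₁ k₂ → Fin N ⊕ Fin N → ℂ) : evenVariation ψ b u u' a s =
      u • evenVariation ψ b 1 0 a s + u' • evenVariation ψ b 0 1 a s := by
  funext p
  rcases p with p | p <;>
  · simp only [evenVariation, Sum.elim_inl, Sum.elim_inr, Pi.add_apply, Pi.smul_apply,
      ← hermCoord_linear]
    congr 1
    funext n m
    simp [Finset.smul_sum, smul_smul, mul_assoc]

/-! ### The Ward identity of one nilpotent odd symmetry -/

/-- The generators `η_q`, as vectors, for an injection of the odd indices into the generators. -/
def etaVec (ν : OddIdx k₁ k₂ → Fin N) (q : OddIdx k₁ k₂) : Fin N ⊕ Fin N → ℂ :=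
  Pi.single (Sum.inl (ν q)) 1

/-- The generators `η_q^*`, as vectors. -/
def etaStarVec (ν : OddIdx k₁ k₂ → Fin N) (q : OddIdx k₁ k₂) : Fin N ⊕ Fin N → ℂ :=
  Pi.single (Sum.inr (ν q)) 1

/-- The linear form that reads off the `η_q^*`-component. -/
def etaStarForm (ν : OddIdx k₁ k₂ → Fin N) (q : OddIdx k₁ k₂) :
    Module.Dual ℂ (Fin N ⊕ Fin N → ℂ) := LinearMap.proj (Sum.inr (ν q))

/-- The linear form that reads off the `η_q`-component. -/
def etaForm (ν : OddIdx k₁ k₂ → Fin N) (q : OddIdx k₁ k₂) :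
    Module.Dual ℂ (Fin N ⊕ Fin N → ℂ) := LinearMap.proj (Sum.inl (ν q))

/-- The variation of an invariant superfunction under the nilpotent matrix `[[0, b], [0, 0]]`
is annihilated by each generator `η_t^*`.  The real odd vectors `c η_t + c̄ η_t^*` and the phases
`u` separate this complex direction from its conjugate. -/
theorem etaStar_mul_variation (hN : 1 ≤ N) {ψ : ℝ} {f : Superfunction k₁ k₂}
    (hinv : f.IsInvariant N ψ) {ν : OddIdx k₁ k₂ → Fin N} (hν : Function.Injective ν)
    (b : Fin k₁ → Fin k₂ → ℝ) (x : HermPair k₁ k₂) (t : OddIdx k₁ k₂) :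
    ι (etaStarVec ν t) * f.variation x (etaVec ν) (etaStarVec ν)
      (evenVariation ψ b 1 0 (etaVec ν) (etaStarVec ν))
      (∑ q, ((halfPhase ψ)⁻¹ * upperVariation ψ b x q.2 q.1) • etaStarForm ν q) = 0 := by
  set a := etaVec ν (k₁ := k₁) (k₂ := k₂) with ha
  set s := etaStarVec ν (k₁ := k₁) (k₂ := k₂) with hs
  set d₁ : Module.Dual ℂ (Fin N ⊕ Fin N → ℂ) :=
    ∑ q, ((halfPhase ψ)⁻¹ * upperVariation ψ b x q.2 q.1) • etaStarForm ν q with hd₁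
  set d₂ : Module.Dual ℂ (Fin N ⊕ Fin N → ℂ) :=
    ∑ q, ((halfPhase ψ)⁻¹ * lowerVariation ψ b x q.1 q.2) • etaForm ν q with hd₂
  set P := f.variation x a s (evenVariation ψ b 1 0 a s) d₁ with hP
  set P' := f.variation x a s (evenVariation ψ b 0 1 a s) d₂ with hP'
  have key : ∀ c u : ℂ, c • u • (ι (a t) * P) + c • starRingEnd ℂ u • (ι (a t) * P') +
      starRingEnd ℂ c • u • (ι (s t) * P) +
      starRingEnd ℂ c • starRingEnd ℂ u • (ι (s t) * P') = 0 := by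
    intro c u
    set e : Fin N ⊕ Fin N → ℂ := c • a t + starRingEnd ℂ c • s t with he
    have hre : conjVec e = e := by
      funext r
      rcases r with r | r <;> by_cases h : r = ν t <;>
        simp [conjVec, he, ha, hs, etaVec, etaStarVec, h]
    set d : Module.Dual ℂ (Fin N ⊕ Fin N → ℂ) := u • d₁ + starRingEnd ℂ u • d₂ with hd
    have hda : ∀ q, d (a q) =
        starRingEnd ℂ u * ((halfPhase ψ)⁻¹ * lowerVariation ψ b x q.1 q.2) := by
      intro q
      simp [hd, hd₁, hd₂, ha, etaVec, etaForm, etaStarForm, Pi.single_apply, hν.eq_iff]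
    have hds : ∀ q, d (s q) = u * ((halfPhase ψ)⁻¹ * upperVariation ψ b x q.2 q.1) := by
      intro q
      simp [hd, hd₁, hd₂, hs, etaStarVec, etaForm, etaStarForm, Pi.single_apply, hν.eq_iff]
    have h1 := hinv _ _ _ (isUnitary_oddRotation b u hre)
      (toMatrix_oddRotation ψ b u hre x a s d hda hds)
    rw [eval_first_order hN, add_eq_left, evenVariation_linear, hd, variation_add, variation_smul,
      variation_smul, ← hP, ← hP', he, map_add, map_smul, map_smul, add_mul, mul_add, mul_add] at h1
    simp only [smul_mul_assoc, mul_smul_comm] at h1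
    rw [← h1]
    module
  have k1 := key 1 1
  have k2 := key 1 Complex.I
  have k3 := key Complex.I 1
  have k4 := key Complex.I Complex.I
  simp only [map_one, Complex.conj_I, one_smul, neg_smul, smul_neg, smul_smul, Complex.I_mul_I,
    neg_neg] at k1 k2 k3 k4
  -- Weights `1, -i, i, 1` at `(c, u) = (1,1), (1,i), (i,1), (i,i)` keep the terms with `c̄ u` and
  -- cancel those with `c u`, `c ū` and `c̄ ū`.
  have h := congrArg₂ (· + ·) (congrArg₂ (· + ·) k1 (congrArg (fun y => -Complex.I • y) k2))
    (congrArg₂ (· + ·) (congrArg (fun y => Complex.I • y) k3) k4)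
  simp only [smul_add, smul_neg, smul_smul, neg_smul, neg_mul, Complex.I_mul_I, smul_zero, add_zero,
    neg_neg, one_smul, one_mul] at h
  have h4 : (4 : ℂ) • (ι (s t) * P) = 0 := by
    rw [← h]; module
  exact (smul_eq_zero.mp h4).resolve_left (by norm_num)

/-! ### Coefficients of monomials -/

/-- The body of an iterated interior product, with the first linear form of the list innermost. -/
def extract : List (Module.Dual ℂ (Fin N ⊕ Fin N → ℂ)) → Grassmann N →ₗ[ℂ] ℂ
  | [] => body.toLinearMap
  | d :: ds => (extract ds).comp (interior d)

theorem extract_cons (d : Module.Dual ℂ (Fin N ⊕ Fin N → ℂ))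
    (ds : List (Module.Dual ℂ (Fin N ⊕ Fin N → ℂ))) (y : Grassmann N) :
    extract (d :: ds) y = extract ds (interior d y) := rfl

theorem extract_ι_mul (ds : List (Module.Dual ℂ (Fin N ⊕ Fin N → ℂ))) {v : Fin N ⊕ Fin N → ℂ}
    (h : ∀ d ∈ ds, d v = 0) (y : Grassmann N) : extract ds (ι v * y) = 0 := by
  induction ds generalizing y with
  | nil => exact body_ι_mul v y
  | cons d ds ih =>
    rw [extract_cons, interior_ι_mul, h d (by simp), zero_smul, zero_sub, map_neg,
      ih (fun d' hd' => h d' (by simp [hd'])), neg_zero]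

theorem extract_of_interior_eq_zero (ds : List (Module.Dual ℂ (Fin N ⊕ Fin N → ℂ)))
    {d : Module.Dual ℂ (Fin N ⊕ Fin N → ℂ)} (hd : d ∈ ds) {y : Grassmann N}
    (hy : interior d y = 0) : extract ds y = 0 := by
  induction ds generalizing y with
  | nil => simp at hd
  | cons d' ds ih =>
    rw [extract_cons]
    rcases List.mem_cons.mp hd with rfl | hd
    · rw [hy, map_zero]
    · exact ih hd (by rw [interior_comm, hy, map_zero, neg_zero])

/-- The elements of degree `k` of the Grassmann algebra. -/
def homogeneous (N k : ℕ) : Submodule ℂ (Grassmann N) :=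
  Submodule.span ℂ {y | ∃ vs : List (Fin N ⊕ Fin N → ℂ), vs.length = k ∧ y = (vs.map (ι)).prod}

theorem prod_mem_homogeneous (vs : List (Fin N ⊕ Fin N → ℂ)) :
    (vs.map (ι)).prod ∈ homogeneous N vs.length :=
  Submodule.subset_span ⟨vs, rfl, rfl⟩

theorem ι_mul_mem_homogeneous (v : Fin N ⊕ Fin N → ℂ) {k : ℕ} {y : Grassmann N}
    (hy : y ∈ homogeneous N k) : ι v * y ∈ homogeneous N (k + 1) := by
  induction hy using Submodule.span_induction with
  | mem y hy =>
    obtain ⟨vs, hvs, rfl⟩ := hy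
    exact Submodule.subset_span ⟨v :: vs, by simp [hvs], by simp⟩
  | zero => rw [mul_zero]; exact zero_mem _
  | add y z _ _ hy hz => rw [mul_add]; exact add_mem hy hz
  | smul c y _ hy => rw [mul_smul_comm]; exact Submodule.smul_mem _ _ hy

theorem interior_mem_homogeneous (d : Module.Dual ℂ (Fin N ⊕ Fin N → ℂ)) {k : ℕ}
    {y : Grassmann N} (hy : y ∈ homogeneous N (k + 1)) : interior d y ∈ homogeneous N k := by
  induction hy using Submodule.span_induction with
  | mem y hy =>
    obtain ⟨vs, hvs, rfl⟩ := hy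
    induction vs generalizing k with
    | nil => simp at hvs
    | cons v vs ih =>
      have hk : vs.length = k := by simpa using hvs
      rw [List.map_cons, List.prod_cons, interior_ι_mul]
      refine sub_mem (Submodule.smul_mem _ _ (hk ▸ prod_mem_homogeneous vs)) ?_
      cases k with
      | zero =>
        rw [List.length_eq_zero_iff] at hk
        subst hk
        simp [interior_one]
      | succ k => exact ι_mul_mem_homogeneous v (ih hk)
  | zero => rw [map_zero]; exact zero_mem _
  | add y z _ _ hy hz => rw [map_add]; exact add_mem hy hz
  | smul c y _ hy => rw [map_smul]; exact Submodule.smul_mem _ _ hy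

/-- Only the part of degree equal to the number of linear forms survives. -/
theorem extract_homogeneous (ds : List (Module.Dual ℂ (Fin N ⊕ Fin N → ℂ))) {k : ℕ}
    {y : Grassmann N} (hy : y ∈ homogeneous N k) (hk : k ≠ ds.length) : extract ds y = 0 := by
  induction ds generalizing k y with
  | nil =>
    induction hy using Submodule.span_induction with
    | mem y hy =>
      obtain ⟨vs, rfl, rfl⟩ := hy
      cases vs with
      | nil => simp at hk
      | cons v vs => exact body_ι_mul v _
    | zero => exact map_zero _
    | add y z _ _ hy hz => rw [map_add, hy, hz, add_zero]
    | smul c y _ hy => rw [map_smul, hy, smul_zero]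
  | cons d ds ih =>
    rw [extract_cons]
    cases k with
    | zero =>
      have : interior d y = 0 := by
        induction hy using Submodule.span_induction with
        | mem y hy =>
          obtain ⟨vs, hvs, rfl⟩ := hy
          rw [List.length_eq_zero_iff] at hvs
          subst hvs
          exact interior_one d
        | zero => exact map_zero _
        | add y z _ _ hy hz => rw [map_add, hy, hz, add_zero]
        | smul c y _ hy => rw [map_smul, hy, smul_zero]
      rw [this, map_zero]
    | succ k => exact ih (interior_mem_homogeneous d hy) (by simpa using hk)

/-- The product of the generators in `J` along a list of odd indices. -/
def genProd (ν : OddIdx k₁ k₂ → Fin N) (J : MonIdx k₁ k₂) (l : List (OddIdx k₁ k₂)) :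
    Grassmann N :=
  (l.map fun q => (if q ∈ J.1 then (ι (etaStarVec ν q) : Grassmann N) else 1) *
    (if q ∈ J.2 then ι (etaVec ν q) else 1)).prod

/-- The linear forms that read off `η_q^*` and `η_q` for `q` in a list. -/
def pairForms (ν : OddIdx k₁ k₂ → Fin N) (l : List (OddIdx k₁ k₂)) :
    List (Module.Dual ℂ (Fin N ⊕ Fin N → ℂ)) :=
  l.flatMap fun q => [etaStarForm ν q, etaForm ν q]

theorem genProd_cons (ν : OddIdx k₁ k₂ → Fin N) (J : MonIdx k₁ k₂) (q : OddIdx k₁ k₂)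
    (l : List (OddIdx k₁ k₂)) : genProd ν J (q :: l) =
      (if q ∈ J.1 then (ι (etaStarVec ν q) : Grassmann N) else 1) *
        ((if q ∈ J.2 then ι (etaVec ν q) else 1) * genProd ν J l) := by
  simp [genProd, mul_assoc]

theorem pairForms_cons (ν : OddIdx k₁ k₂ → Fin N) (q : OddIdx k₁ k₂) (l : List (OddIdx k₁ k₂)) :
    pairForms ν (q :: l) = etaStarForm ν q :: etaForm ν q :: pairForms ν l := rfl

section forms

variable {ν : OddIdx k₁ k₂ → Fin N}

theorem etaForm_etaStarVec (p q : OddIdx k₁ k₂) : etaForm ν p (etaStarVec ν q) = 0 := by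
  simp [etaForm, etaStarVec]

theorem etaStarForm_etaVec (p q : OddIdx k₁ k₂) : etaStarForm ν p (etaVec ν q) = 0 := by
  simp [etaStarForm, etaVec]

theorem etaForm_etaVec (hν : Function.Injective ν) (p q : OddIdx k₁ k₂) :
    etaForm ν p (etaVec ν q) = if p = q then 1 else 0 := by
  simp [etaForm, etaVec, Pi.single_apply, hν.eq_iff]

theorem etaStarForm_etaStarVec (hν : Function.Injective ν) (p q : OddIdx k₁ k₂) :
    etaStarForm ν p (etaStarVec ν q) = if p = q then 1 else 0 := by
  simp [etaStarForm, etaStarVec, Pi.single_apply, hν.eq_iff]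

theorem interior_genProd_of_notMem {d : Module.Dual ℂ (Fin N ⊕ Fin N → ℂ)} (J : MonIdx k₁ k₂)
    {l : List (OddIdx k₁ k₂)} (h : ∀ q ∈ l, d (etaVec ν q) = 0 ∧ d (etaStarVec ν q) = 0) :
    interior d (genProd ν J l) = 0 := by
  induction l with
  | nil => exact interior_one d
  | cons q l ih =>
    have ih := ih fun q' hq' => h q' (by simp [hq'])
    obtain ⟨h1, h2⟩ := h q (by simp)
    rw [genProd_cons]
    split_ifs <;> simp [interior_ι_mul, h1, h2, ih]

theorem extract_genProd (hν : Function.Injective ν) (J : MonIdx k₁ k₂)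
    {l : List (OddIdx k₁ k₂)} (hl : l.Nodup) :
    extract (pairForms ν l) (genProd ν J l) = if ∀ q ∈ l, q ∈ J.1 ∧ q ∈ J.2 then 1 else 0 := by
  induction l with
  | nil => simp [pairForms, genProd, extract]
  | cons q l ih =>
    obtain ⟨hq, hl⟩ := List.nodup_cons.mp hl
    have ih := ih hl
    have hne : ∀ r ∈ l, q ≠ r := fun r hr h => hq (h ▸ hr)
    have hz : interior (etaForm ν q) (genProd ν J l) = 0 :=
      interior_genProd_of_notMem J fun r hr =>
        ⟨by rw [etaForm_etaVec hν, if_neg (hne r hr)], etaForm_etaStarVec q r⟩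
    have hz' : interior (etaStarForm ν q) (genProd ν J l) = 0 :=
      interior_genProd_of_notMem J fun r hr =>
        ⟨etaStarForm_etaVec q r, by rw [etaStarForm_etaStarVec hν, if_neg (hne r hr)]⟩
    rw [pairForms_cons, extract_cons, extract_cons, genProd_cons]
    by_cases h1 : q ∈ J.1 <;> by_cases h2 : q ∈ J.2 <;>
      simp [h1, h2, interior_ι_mul, hz, hz', etaForm_etaVec hν, etaStarForm_etaStarVec hν,
        etaStarForm_etaVec, ih]

theorem mem_pairForms_apply (hν : Function.Injective ν) {l : List (OddIdx k₁ k₂)}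
    {q : OddIdx k₁ k₂} (hq : q ∉ l) {d : Module.Dual ℂ (Fin N ⊕ Fin N → ℂ)}
    (hd : d ∈ pairForms ν l) : d (etaVec ν q) = 0 ∧ d (etaStarVec ν q) = 0 := by
  obtain ⟨r, hr, hd⟩ := List.mem_flatMap.mp hd
  have hne : r ≠ q := fun h => hq (h ▸ hr)
  simp only [List.mem_cons, List.not_mem_nil, or_false] at hd
  rcases hd with rfl | rfl
  · exact ⟨etaStarForm_etaVec r q, by rw [etaStarForm_etaStarVec hν, if_neg hne]⟩
  · exact ⟨by rw [etaForm_etaVec hν, if_neg hne], etaForm_etaStarVec r q⟩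

theorem extract_genProd_append (hν : Function.Injective ν) (J : MonIdx k₁ k₂)
    (l₁ l : List (OddIdx k₁ k₂)) (hd : ∀ q ∈ l₁, q ∉ l) :
    extract (pairForms ν l) (genProd ν J (l₁ ++ l)) =
      if ∀ q ∈ l₁, q ∉ J.1 ∧ q ∉ J.2 then extract (pairForms ν l) (genProd ν J l) else 0 := by
  induction l₁ with
  | nil => simp
  | cons q l₁ ih =>
    have ih := ih fun r hr => hd r (by simp [hr])
    have hq := hd q (by simp)
    rw [List.cons_append, genProd_cons]
    by_cases h1 : q ∈ J.1
    · rw [if_pos h1, extract_ι_mul _ fun d hd => (mem_pairForms_apply hν hq hd).2]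
      simp [h1]
    · by_cases h2 : q ∈ J.2
      · rw [if_neg h1, if_pos h2, one_mul,
          extract_ι_mul _ fun d hd => (mem_pairForms_apply hν hq hd).1]
        simp [h2]
      · simp [h1, h2, ih]

/-- The iterated interior product reads off the coefficient of the product of all pairs in `l`. -/
theorem extract_pairForms (hν : Function.Injective ν) (J : MonIdx k₁ k₂)
    {l₁ l : List (OddIdx k₁ k₂)} (hnd : (l₁ ++ l).Nodup) (hall : ∀ q, q ∈ l₁ ++ l) :
    extract (pairForms ν l) (genProd ν J (l₁ ++ l)) =
      if J = (l.toFinset, l.toFinset) then 1 else 0 := by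
  obtain ⟨-, hl, hd⟩ := List.nodup_append.mp hnd
  have hd' : ∀ q ∈ l₁, q ∉ l := fun q hq hq' => hd q hq q hq' rfl
  rw [extract_genProd_append hν J l₁ l hd', extract_genProd hν J hl, ← ite_and]
  congr 1
  refine propext ⟨fun ⟨h1, h2⟩ => ?_, ?_⟩
  · refine Prod.ext (Finset.ext fun q => ?_) (Finset.ext fun q => ?_) <;>
      rcases List.mem_append.mp (hall q) with h | h
    · simp [hd' q h, h1 q h]
    · simp [h, h2 q h]
    · simp [hd' q h, h1 q h]
    · simp [h, h2 q h]
  · rintro rfl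
    exact ⟨fun q hq => by simp [hd' q hq], fun q hq => by simp [hq]⟩

theorem genProd_mem_homogeneous (J : MonIdx k₁ k₂) {l : List (OddIdx k₁ k₂)} (hl : l.Nodup)
    (hall : ∀ q, q ∈ l) : genProd ν J l ∈ homogeneous N (J.1.card + J.2.card) := by
  have key : ∀ l : List (OddIdx k₁ k₂), genProd ν J l ∈ homogeneous N
      (l.map fun q => (if q ∈ J.1 then 1 else 0) + (if q ∈ J.2 then 1 else 0)).sum := by
    intro l
    induction l with
    | nil => exact prod_mem_homogeneous []
    | cons q l ih =>
      rw [genProd_cons, List.map_cons, List.sum_cons]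
      split_ifs <;> try simp only [one_mul, zero_add, add_zero]
      · have := ι_mul_mem_homogeneous (etaStarVec ν q) (ι_mul_mem_homogeneous (etaVec ν q) ih)
        convert this using 1
        ring_nf
      · rw [add_comm]; exact ι_mul_mem_homogeneous _ ih
      · rw [add_comm]; exact ι_mul_mem_homogeneous _ ih
      · exact ih
  have hu : l.toFinset = Finset.univ := by ext q; simp [hall q]
  have h := key l
  rw [← List.sum_toFinset _ hl, hu, Finset.sum_add_distrib] at h
  simpa using h

end forms

/-! ### The Ward identity in components -/

/-- The complex vector on the even coordinates that multiplies `α_q` in the odd vector field. -/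
def oddDirection (ψ : ℝ) (b : Fin k₁ → Fin k₂ → ℝ) (q : OddIdx k₁ k₂) : EvenIdx k₁ k₂ → ℂ :=
  Sum.elim (hermCoord fun n m => if m = q.2 then -(halfPhase ψ * b n q.1) else 0)
    (hermCoord fun n m => if n = q.1 then -((halfPhase ψ)⁻¹ * b q.2 m) else 0)

/-- The derivative of a function along `oddDirection`. -/
def oddDeriv (ψ : ℝ) (b : Fin k₁ → Fin k₂ → ℝ) (q : OddIdx k₁ k₂) (g : HermPair k₁ k₂ → ℂ)
    (x : HermPair k₁ k₂) : ℂ :=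
  ∑ p, oddDirection ψ b q p * fderiv ℝ g x (Pi.single p 1)

theorem evenVariation_eq_sum (ψ : ℝ) (b : Fin k₁ → Fin k₂ → ℝ)
    (a s : OddIdx k₁ k₂ → Fin N ⊕ Fin N → ℂ) (p : EvenIdx k₁ k₂) :
    evenVariation ψ b 1 0 a s p = ∑ q, oddDirection ψ b q p • a q := by
  rcases p with p | p <;>
    simp only [evenVariation, oddDirection, Sum.elim_inl, Sum.elim_inr, ← hermCoord_sum_smul] <;>
    congr 1 <;> funext n m
  · rw [Fintype.sum_prod_type]
    simp [ite_smul]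
  · rw [Fintype.sum_prod_type, Finset.sum_comm]
    simp [ite_smul]

/-- The component of the Ward identity along the product of all pairs in `t :: l₂` except `α_t^*`,
at a body where the vector field vanishes along the `α_q^*` with `q` in `l₁`.  The terms with
coefficients `C` come from the other directions `α_q`; by homogeneity they involve only monomials
of the degree of the product of all pairs in `l₂`. -/
theorem ward_identity (hN : 1 ≤ N) {ψ : ℝ} {f : Superfunction k₁ k₂}
    (hinv : f.IsInvariant N ψ) {ν : OddIdx k₁ k₂ → Fin N} (hν : Function.Injective ν)
    (b : Fin k₁ → Fin k₂ → ℝ) {l₁ l₂ : List (OddIdx k₁ k₂)} {t : OddIdx k₁ k₂}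
    (hl : List.finRange k₂ ×ˢ List.finRange k₁ = l₁ ++ t :: l₂) :
    ∃ C : MonIdx k₁ k₂ → OddIdx k₁ k₂ → ℂ,
      (∀ J q, C J q ≠ 0 → J.1.card + J.2.card = 2 * l₂.length) ∧
      ∀ x : HermPair k₁ k₂, (∀ q ∈ l₁, upperVariation ψ b x q.2 q.1 = 0) →
        (halfPhase ψ)⁻¹ * upperVariation ψ b x t.2 t.1 *
            f ((t :: l₂).toFinset, (t :: l₂).toFinset) x +
          oddDeriv ψ b t (f (l₂.toFinset, l₂.toFinset)) x +
          ∑ q ∈ l₂.toFinset, ∑ J, C J q * oddDeriv ψ b q (f J) x = 0 := by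
  set l₀ := List.finRange k₂ ×ˢ List.finRange k₁ with hl₀
  have hnd : l₀.Nodup := List.Nodup.product (List.nodup_finRange _) (List.nodup_finRange _)
  have hall : ∀ q, q ∈ l₀ := fun q => by
    rw [hl₀]; exact List.mem_product.mpr ⟨List.mem_finRange _, List.mem_finRange _⟩
  have hl' : l₀ = (l₁ ++ [t]) ++ l₂ := by rw [hl]; simp
  have hndl := hnd
  rw [hl] at hndl
  obtain ⟨-, hnd2, hdis⟩ := List.nodup_append.mp hndl
  have ht2 : t ∉ l₂ := (List.nodup_cons.mp hnd2).1
  have ht1 : t ∉ l₁ := fun h => hdis t h t (by simp) rfl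
  have h12 : ∀ q ∈ l₁, q ∉ l₂ := fun q h h' => hdis q h q (by simp [h']) rfl
  set E := extract (etaForm ν t :: pairForms ν l₂) with hE
  have hEt : ∀ (d) (_ : d ∈ etaForm ν t :: pairForms ν l₂), d (etaStarVec ν t) = 0 := by
    intro d hd
    rcases List.mem_cons.mp hd with rfl | hd
    · exact etaForm_etaStarVec t t
    · exact (mem_pairForms_apply hν ht2 hd).2
  have hE1 : ∀ q ∈ l₁, ∀ d ∈ etaForm ν t :: pairForms ν l₂, d (etaVec ν q) = 0 := by
    intro q hq d hd
    rcases List.mem_cons.mp hd with rfl | hd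
    · rw [etaForm_etaVec hν, if_neg fun h : t = q => ht1 (h ▸ hq)]
    · exact (mem_pairForms_apply hν (h12 q hq) hd).1
  have hmon : ∀ (x : HermPair k₁ k₂) J,
      (vecPoint x 0 0 (etaVec ν) (etaStarVec ν)).monomial J = genProd ν J l₀ := fun _ _ => rfl
  refine ⟨fun J q => E (ι (etaVec ν q) * genProd ν J l₀), fun J q h => ?_, fun x hx => ?_⟩
  · by_contra hne
    refine h (extract_homogeneous _
      (ι_mul_mem_homogeneous _ (genProd_mem_homogeneous J hnd hall)) ?_)
    have hlen : (pairForms ν l₂).length = 2 * l₂.length := by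
      simp [pairForms, List.length_flatMap, mul_comm]
    rw [List.length_cons, hlen]
    omega
  · have hB := etaStar_mul_variation hN hinv hν b x t
    set d₁ : Module.Dual ℂ (Fin N ⊕ Fin N → ℂ) :=
      ∑ q, ((halfPhase ψ)⁻¹ * upperVariation ψ b x q.2 q.1) • etaStarForm ν q with hd₁
    set B := f.variation x (etaVec ν) (etaStarVec ν)
      (evenVariation ψ b 1 0 (etaVec ν) (etaStarVec ν)) d₁ with hBdef
    have hEB : E B = 0 := by
      have h1 := congrArg E (congrArg (interior (etaStarForm ν t)) hB)
      rw [interior_ι_mul, etaStarForm_etaStarVec hν, if_pos rfl, one_smul, map_sub,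
        hE, extract_ι_mul _ hEt, map_zero, map_zero, sub_zero] at h1
      exact h1
    have hCt : ∀ J, E (ι (etaVec ν t) * genProd ν J l₀) =
        if J = (l₂.toFinset, l₂.toFinset) then 1 else 0 := by
      intro J
      rw [hE, extract_cons, interior_ι_mul, etaForm_etaVec hν, if_pos rfl, one_smul, map_sub,
        extract_ι_mul _ fun d hd => (mem_pairForms_apply hν ht2 hd).1, sub_zero, hl']
      exact extract_pairForms hν J (hl' ▸ hnd) (hl' ▸ hall)
    have hDt : ∀ J, E (interior (etaStarForm ν t) (genProd ν J l₀)) =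
        if J = ((t :: l₂).toFinset, (t :: l₂).toFinset) then 1 else 0 := by
      intro J
      rw [hE, ← extract_cons, ← pairForms_cons, hl]
      exact extract_pairForms hν J (hl ▸ hnd) (hl ▸ hall)
    have hD2 : ∀ q ∈ l₂, ∀ J, E (interior (etaStarForm ν q) (genProd ν J l₀)) = 0 := by
      intro q hq J
      refine extract_of_interior_eq_zero _ (d := etaStarForm ν q) ?_ (interior_interior _ _)
      exact List.mem_cons_of_mem _ (List.mem_flatMap.mpr ⟨q, hq, by simp⟩)
    have hsum : ∀ F : OddIdx k₁ k₂ → ℂ, (∀ q ∈ l₁, F q = 0) →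
        ∑ q, F q = F t + ∑ q ∈ l₂.toFinset, F q := by
      intro F hF
      rw [← Finset.sum_insert (by simpa using ht2)]
      refine (Finset.sum_subset (Finset.subset_univ _) fun q _ hq => ?_).symm
      have := hall q
      rw [hl] at this
      simp only [List.mem_append, List.mem_cons] at this
      simp only [Finset.mem_insert, List.mem_toFinset, not_or] at hq
      exact hF q (this.resolve_right fun h => h.elim hq.1 hq.2)
    have hexp : E B = ∑ J, (∑ q, oddDeriv ψ b q (f J) x * E (ι (etaVec ν q) * genProd ν J l₀) +
        f J x * ∑ q, (halfPhase ψ)⁻¹ * upperVariation ψ b x q.2 q.1 *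
          E (interior (etaStarForm ν q) (genProd ν J l₀))) := by
      rw [hBdef, Superfunction.variation, map_sum]
      refine Finset.sum_congr rfl fun J _ => ?_
      rw [map_add, map_smul, smul_eq_mul, hmon]
      congr 1
      · have h1 : ∑ p, fderiv ℝ (f J) x (Pi.single p 1) •
            evenVariation ψ b 1 0 (etaVec ν) (etaStarVec ν) p =
            ∑ q, oddDeriv ψ b q (f J) x • etaVec ν q := by
          simp only [evenVariation_eq_sum, oddDeriv, Finset.smul_sum, Finset.sum_smul]
          rw [Finset.sum_comm]
          refine Finset.sum_congr rfl fun q _ => Finset.sum_congr rfl fun p _ => ?_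
          rw [smul_smul, mul_comm]
        rw [h1, map_sum, Finset.sum_mul, map_sum]
        refine Finset.sum_congr rfl fun q _ => ?_
        rw [map_smul, smul_mul_assoc, map_smul, smul_eq_mul]
      · congr 1
        have h2 : interior d₁ (genProd ν J l₀) = ∑ q, ((halfPhase ψ)⁻¹ *
            upperVariation ψ b x q.2 q.1) • interior (etaStarForm ν q) (genProd ν J l₀) := by
          simp [hd₁, interior]
        rw [h2, map_sum]
        exact Finset.sum_congr rfl fun q _ => by rw [map_smul, smul_eq_mul]
    rw [hexp, Finset.sum_add_distrib] at hEB
    have e1 : ∀ J, ∑ q, oddDeriv ψ b q (f J) x * E (ι (etaVec ν q) * genProd ν J l₀) =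
        oddDeriv ψ b t (f J) x * (if J = (l₂.toFinset, l₂.toFinset) then 1 else 0) +
        ∑ q ∈ l₂.toFinset, E (ι (etaVec ν q) * genProd ν J l₀) * oddDeriv ψ b q (f J) x := by
      intro J
      rw [hsum _ fun q hq => by rw [hE, extract_ι_mul _ (hE1 q hq), mul_zero], hCt]
      congr 1
      exact Finset.sum_congr rfl fun q _ => mul_comm _ _
    have e2 : ∀ J, ∑ q, (halfPhase ψ)⁻¹ * upperVariation ψ b x q.2 q.1 *
          E (interior (etaStarForm ν q) (genProd ν J l₀)) =
        (halfPhase ψ)⁻¹ * upperVariation ψ b x t.2 t.1 *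
          if J = ((t :: l₂).toFinset, (t :: l₂).toFinset) then 1 else 0 := by
      intro J
      rw [hsum _ fun q hq => by rw [hx q hq, mul_zero, zero_mul], hDt,
        Finset.sum_eq_zero fun q hq => by rw [hD2 q (List.mem_toFinset.mp hq), mul_zero], add_zero]
    simp only [e1, e2, Finset.sum_add_distrib] at hEB
    rw [Finset.sum_comm (s := Finset.univ) (t := l₂.toFinset)] at hEB
    rw [← hEB]
    simp only [mul_ite, mul_one, mul_zero, Finset.sum_ite_eq', Finset.mem_univ, if_true]
    ring

end SuperInt

end

noncomputable section

namespace SuperInt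

open MeasureTheory Filter Topology

set_option linter.unusedSectionVars false

variable {ι κ : Type} [Fintype ι] [DecidableEq ι] [Fintype κ]

/-! ### The regularized Cauchy kernel -/

/-- The Wirtinger derivative `∂/∂z̄` of a function on the complex plane. -/
def dbar (w : ℂ → ℂ) (z : ℂ) : ℂ :=
  (1 / 2 : ℂ) * (fderiv ℝ w z 1 + Complex.I * fderiv ℝ w z Complex.I)

theorem dbar_mul {f g : ℂ → ℂ} {z : ℂ} (hf : DifferentiableAt ℝ f z)
    (hg : DifferentiableAt ℝ g z) :
    dbar (fun z => f z * g z) z = dbar f z * g z + f z * dbar g z := by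
  unfold dbar
  rw [fderiv_fun_mul hf hg]
  simp only [add_apply, smul_apply, smul_eq_mul]
  ring

/-- The regularization `z̄ / (|z|² + s²)` of the Cauchy kernel `1 / z`. -/
def cauchyReg (s : ℝ) (z : ℂ) : ℂ := starRingEnd ℂ z / (z * starRingEnd ℂ z + (s : ℂ) ^ 2)

/-- The unnormalized approximate identity `(1 + |z|²)⁻²`, of total mass `π`. -/
def bubble (z : ℂ) : ℝ := ((1 + ‖z‖ ^ 2) ^ 2)⁻¹

theorem mul_conj_add_sq (s : ℝ) (z : ℂ) :
    z * starRingEnd ℂ z + (s : ℂ) ^ 2 = ((‖z‖ ^ 2 + s ^ 2 : ℝ) : ℂ) := by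
  rw [Complex.mul_conj, Complex.normSq_eq_norm_sq]; push_cast; rfl

theorem mul_conj_add_sq_ne_zero {s : ℝ} (hs : 0 < s) (z : ℂ) :
    z * starRingEnd ℂ z + (s : ℂ) ^ 2 ≠ 0 := by
  rw [mul_conj_add_sq]
  exact_mod_cast (by positivity : ‖z‖ ^ 2 + s ^ 2 ≠ 0)

theorem contDiff_cauchyReg {s : ℝ} (hs : 0 < s) : ContDiff ℝ 1 (cauchyReg s) := by
  have h : ContDiff ℝ 1 (fun z : ℂ => starRingEnd ℂ z) := Complex.conjCLE.contDiff
  exact h.mul (((contDiff_id.mul h).add contDiff_const).inv (mul_conj_add_sq_ne_zero hs))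

theorem dbar_conj (z : ℂ) : dbar (fun z => starRingEnd ℂ z) z = 1 := by
  have hc : HasFDerivAt (fun z : ℂ => starRingEnd ℂ z) (Complex.conjCLE : ℂ →L[ℝ] ℂ) z :=
    Complex.conjCLE.hasFDerivAt
  rw [dbar, hc.fderiv]
  norm_num

theorem dbar_id (z : ℂ) : dbar (fun z => z) z = 0 := by
  rw [dbar, fderiv_fun_id]
  simp

theorem dbar_add_const (f : ℂ → ℂ) (c z : ℂ) : dbar (fun z => f z + c) z = dbar f z := by
  simp [dbar]

/-- The `∂/∂z̄`-derivative of the regularized Cauchy kernel is the bubble of width `s`, an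
approximation of `π` times the delta function. -/
theorem dbar_cauchyReg {s : ℝ} (hs : 0 < s) (z : ℂ) :
    dbar (cauchyReg s) z = ((s ^ 2)⁻¹ * bubble (s⁻¹ • z) : ℝ) := by
  have hne := mul_conj_add_sq_ne_zero hs z
  have hc : Differentiable ℝ (fun z : ℂ => starRingEnd ℂ z) := Complex.conjCLE.differentiable
  have hm : Differentiable ℝ (fun z : ℂ => z * starRingEnd ℂ z) := differentiable_id.mul hc
  have hK := ((contDiff_cauchyReg hs).differentiable one_ne_zero) z
  have h := dbar_mul hK ((hm z).add_const ((s : ℂ) ^ 2))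
  have hfun : (fun z => cauchyReg s z * (z * starRingEnd ℂ z + (s : ℂ) ^ 2)) =
      fun z => starRingEnd ℂ z := by
    funext z
    rw [cauchyReg, div_mul_cancel₀ _ (mul_conj_add_sq_ne_zero hs z)]
  rw [hfun, dbar_conj, dbar_add_const, dbar_mul differentiableAt_fun_id (hc z), dbar_id,
    dbar_conj] at h
  have h2 : ((s ^ 2)⁻¹ * bubble (s⁻¹ • z) : ℝ) =
      (s : ℂ) ^ 2 / (z * starRingEnd ℂ z + (s : ℂ) ^ 2) ^ 2 := by
    rw [mul_conj_add_sq, bubble, norm_smul, Real.norm_of_nonneg (by positivity)]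
    rw [← Complex.ofReal_pow, ← Complex.ofReal_pow, ← Complex.ofReal_div, Complex.ofReal_inj]
    field_simp
    ring
  rw [h2, eq_div_iff (pow_ne_zero 2 hne)]
  have h3 : cauchyReg s z * (z * starRingEnd ℂ z + (s : ℂ) ^ 2) = starRingEnd ℂ z :=
    congrFun hfun z
  linear_combination (-(z * starRingEnd ℂ z + (s : ℂ) ^ 2)) * h - z * h3

theorem norm_mul_cauchyReg_le {s : ℝ} (hs : 0 < s) (z : ℂ) : ‖z * cauchyReg s z‖ ≤ 1 := by
  rw [cauchyReg, ← mul_div_assoc, mul_conj_add_sq, Complex.mul_conj, norm_div, Complex.norm_real,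
    Complex.norm_real, Complex.normSq_eq_norm_sq, Real.norm_of_nonneg (by positivity),
    Real.norm_of_nonneg (by positivity)]
  exact div_le_one_of_le₀ (by nlinarith) (by positivity)

theorem norm_cauchyReg_le {s : ℝ} (hs : 0 < s) (z : ℂ) : ‖cauchyReg s z‖ ≤ ‖z‖⁻¹ := by
  rcases eq_or_ne z 0 with rfl | hz
  · simp [cauchyReg]
  · have := norm_mul_cauchyReg_le hs z
    rw [norm_mul] at this
    rwa [← one_div, le_div_iff₀' (norm_pos_iff.mpr hz)]

theorem tendsto_mul_cauchyReg {z : ℂ} (hz : z ≠ 0) :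
    Tendsto (fun s : ℝ => z * cauchyReg s z) (𝓝[>] 0) (𝓝 1) := by
  have hne : z * starRingEnd ℂ z ≠ 0 := by simpa using hz
  have hc : ContinuousAt (fun s : ℝ => z * cauchyReg s z) 0 := by
    unfold cauchyReg
    refine continuousAt_const.mul (continuousAt_const.div (by fun_prop) ?_)
    simpa using hz
  have h0 : z * cauchyReg 0 z = 1 := by
    rw [cauchyReg, ← mul_div_assoc]
    simp [hne]
  have := hc.tendsto
  rw [h0] at this
  exact tendsto_nhdsWithin_of_tendsto_nhds this

theorem bubble_nonneg (z : ℂ) : 0 ≤ bubble z := by unfold bubble; positivity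

theorem continuous_bubble : Continuous bubble := by
  unfold bubble
  exact Continuous.inv₀ (by fun_prop) fun z => by positivity

theorem integrable_bubble : Integrable bubble := by
  have h := (integrable_one_add_norm (E := ℂ) (μ := volume) (r := 4)
    (by simp; norm_num)).const_mul 4
  refine h.mono' continuous_bubble.aestronglyMeasurable (Eventually.of_forall fun z => ?_)
  rw [Real.norm_of_nonneg (bubble_nonneg z), bubble, Real.rpow_neg (by positivity)]
  rw [show (4 : ℝ) = ((4 : ℕ) : ℝ) by norm_num, Real.rpow_natCast, ← div_eq_mul_inv,
    inv_eq_one_div, div_le_div_iff₀ (by positivity) (by positivity)]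
  have h0 := norm_nonneg z
  have h1 : (1 + ‖z‖) ^ 2 ≤ 2 * (1 + ‖z‖ ^ 2) := by nlinarith [sq_nonneg (1 - ‖z‖)]
  calc 1 * (1 + ‖z‖) ^ 4 = ((1 + ‖z‖) ^ 2) ^ 2 := by ring
    _ ≤ (2 * (1 + ‖z‖ ^ 2)) ^ 2 := by gcongr
    _ = _ := by push_cast; ring

theorem integral_bubble : ∫ z, bubble z = Real.pi := by
  have h := integral_fun_norm_addHaar (E := ℂ) volume (fun y : ℝ => ((1 + y ^ 2) ^ 2)⁻¹)
  unfold bubble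
  rw [h]
  have hd : ∀ y ∈ Set.Ici (0 : ℝ), HasDerivAt (fun y : ℝ => -(2 * (1 + y ^ 2))⁻¹)
      (y ^ (2 - 1) • ((1 + y ^ 2) ^ 2)⁻¹) y := by
    intro y _
    have h1 : HasDerivAt (fun y : ℝ => 2 * (1 + y ^ 2)) (2 * (2 * y)) y := by
      simpa using (((hasDerivAt_pow 2 y).const_add 1).const_mul 2)
    refine ((h1.inv (by positivity)).neg).congr_deriv ?_
    simp only [smul_eq_mul]
    field_simp
    norm_num
  have ht : Tendsto (fun y : ℝ => -(2 * (1 + y ^ 2))⁻¹) atTop (𝓝 (-0)) := by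
    refine Tendsto.neg (tendsto_inv_atTop_zero.comp ?_)
    refine Tendsto.const_mul_atTop two_pos (tendsto_atTop_add_const_left _ 1 ?_)
    exact tendsto_pow_atTop two_ne_zero
  have hI := integral_Ioi_of_hasDerivAt_of_nonneg' hd
    (fun y hy => by have := hy.out; simp only [smul_eq_mul]; positivity) ht
  simp only [Complex.finrank_real_complex]
  rw [hI]
  simp [Measure.real, Complex.volume_ball]
  ring

theorem integrable_indicator_norm_inv {ρ : ℝ} :
    Integrable (fun z : ℂ => (Metric.closedBall (0 : ℂ) ρ).indicator (fun z => ‖z‖⁻¹) z) := by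
  have h : LocallyIntegrable (fun z : ℂ => ‖z‖⁻¹) volume := by
    refine locallyIntegrable_of_norm_le_rpow (C := 1) (α := 1) (by simp) (by simp)
      (Eventually.of_forall fun z => ?_) (by fun_prop)
    rw [Real.rpow_neg_one]; simp
  rw [integrable_indicator_iff Metric.isClosed_closedBall.measurableSet]
  exact h.integrableOn_isCompact (isCompact_closedBall 0 ρ)

/-! ### Product weights and integration by parts -/

instance : (volume : Measure ((ι → ℂ) × (κ → ℝ))).IsAddHaarMeasure :=
  Measure.prod.instIsAddHaarMeasure _ _

/-- The projection to the plane on which the complex coordinates outside of `T` vanish. -/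
def planeProj (T : Finset ι) (y : (ι → ℂ) × (κ → ℝ)) : (ι → ℂ) × (κ → ℝ) :=
  (fun q => if q ∈ T then y.1 q else 0, y.2)

theorem continuous_planeProj (T : Finset ι) :
    Continuous (planeProj T : (ι → ℂ) × (κ → ℝ) → (ι → ℂ) × (κ → ℝ)) := by
  refine Continuous.prodMk (continuous_pi fun q => ?_) continuous_snd
  by_cases h : q ∈ T
  · simp only [h, if_true]; fun_prop
  · simp only [h, if_false]; fun_prop

theorem norm_planeProj_le (T : Finset ι) {ρ : ℝ} (hρ : 0 ≤ ρ) {y : (ι → ℂ) × (κ → ℝ)}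
    (h1 : ∀ q ∈ T, ‖y.1 q‖ ≤ ρ) (h2 : ‖y.2‖ ≤ ρ) : ‖planeProj T y‖ ≤ ρ := by
  refine max_le ((pi_norm_le_iff_of_nonneg hρ).mpr fun q => ?_) h2
  by_cases h : q ∈ T
  · simpa [planeProj, h] using h1 q h
  · simpa [planeProj, h] using hρ

theorem le_norm_planeProj (T : Finset ι) {q : ι} (hq : q ∈ T) (y : (ι → ℂ) × (κ → ℝ)) :
    ‖y.1 q‖ ≤ ‖planeProj T y‖ := by
  refine le_trans ?_ (norm_fst_le (planeProj T y))
  refine le_trans ?_ (norm_le_pi_norm _ q)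
  simp [planeProj, hq]

/-- A product of one weight for each complex coordinate and one for the real coordinates. -/
def prodWeight (w : ι → ℂ → ℂ) (v : (κ → ℝ) → ℂ) (y : (ι → ℂ) × (κ → ℝ)) : ℂ :=
  (∏ q, w q (y.1 q)) * v y.2

/-- The derivative `∂/∂m̄_i` of a function of complex coordinates `m` and real coordinates. -/
def dbarAt (i : ι) (h : (ι → ℂ) × (κ → ℝ) → ℂ) (y : (ι → ℂ) × (κ → ℝ)) : ℂ :=
  (1 / 2 : ℂ) * (fderiv ℝ h y (Pi.single i 1, 0) +
    Complex.I * fderiv ℝ h y (Pi.single i Complex.I, 0))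

/-- Continuous integrable weights, with supports in a ball for the coordinates in `T` and the real
coordinates. -/
structure AdmissibleWeight (T : Finset ι) (ρ : ℝ) (w : ι → ℂ → ℂ) (v : (κ → ℝ) → ℂ) : Prop where
  nonneg : 0 ≤ ρ
  cont : ∀ q, Continuous (w q)
  integrable : ∀ q, Integrable (w q)
  support : ∀ q ∈ T, ∀ z, ρ < ‖z‖ → w q z = 0
  contReal : Continuous v
  supportReal : ∀ Y, ρ < ‖Y‖ → v Y = 0

theorem continuous_prodWeight {w : ι → ℂ → ℂ} {v : (κ → ℝ) → ℂ} (hw : ∀ q, Continuous (w q))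
    (hv : Continuous v) : Continuous (prodWeight w v) := by
  unfold prodWeight
  refine Continuous.mul (continuous_finsetProd _ fun q _ => ?_) (hv.comp continuous_snd)
  exact (hw q).comp ((continuous_apply q).comp continuous_fst)

theorem integrable_prodWeight {w : ι → ℂ → ℂ} {v : (κ → ℝ) → ℂ} (hw : ∀ q, Integrable (w q))
    (hv : Integrable v) : Integrable (prodWeight w v) :=
  Integrable.mul_prod (Integrable.fintype_prod (f := w) (μ := fun _ => volume) hw) hv

theorem integral_prodWeight (w : ι → ℂ → ℂ) (v : (κ → ℝ) → ℂ) :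
    ∫ y, prodWeight w v y = (∏ q, ∫ z, w q z) * ∫ Y, v Y := by
  rw [← integral_fintype_prod_volume_eq_prod w]
  exact integral_prod_mul (fun m : ι → ℂ => ∏ q, w q (m q)) v

theorem integrable_of_support {E : Type*} [NormedAddCommGroup E] [ProperSpace E]
    [MeasurableSpace E] [BorelSpace E] {μ : Measure E} [IsFiniteMeasureOnCompacts μ] {ρ : ℝ}
    {v : E → ℂ} (hv : Continuous v) (h : ∀ Y, ρ < ‖Y‖ → v Y = 0) : Integrable v μ := by
  refine hv.integrable_of_hasCompactSupport ?_
  refine HasCompactSupport.intro (isCompact_closedBall (0 : E) ρ) fun Y hY => h Y ?_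
  simpa using hY

theorem exists_bound_on_ball {H : (ι → ℂ) × (κ → ℝ) → ℂ} (hH : Continuous H) (ρ : ℝ) :
    ∃ M, 0 ≤ M ∧ ∀ y, ‖y‖ ≤ ρ → ‖H y‖ ≤ M := by
  obtain ⟨M, hM⟩ := (isCompact_closedBall (0 : (ι → ℂ) × (κ → ℝ)) ρ).exists_bound_of_continuousOn
    hH.continuousOn
  refine ⟨max M 0, le_max_right _ _, fun y hy => (hM y ?_).trans (le_max_left _ _)⟩
  simpa using hy

theorem norm_prodWeight_mul_le {T : Finset ι} {ρ : ℝ} {w : ι → ℂ → ℂ}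
    {v : (κ → ℝ) → ℂ} (hw : ∀ q ∈ T, ∀ z, ρ < ‖z‖ → w q z = 0)
    (hv : ∀ Y, ρ < ‖Y‖ → v Y = 0) {y : (ι → ℂ) × (κ → ℝ)} {c : ℂ} {M : ℝ}
    (hc : (∀ q ∈ T, ‖y.1 q‖ ≤ ρ) → ‖y.2‖ ≤ ρ → ‖c‖ ≤ M) :
    ‖prodWeight w v y * c‖ ≤ ‖prodWeight w v y‖ * M := by
  by_cases h1 : ∀ q ∈ T, ‖y.1 q‖ ≤ ρ
  · by_cases h2 : ‖y.2‖ ≤ ρ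
    · rw [norm_mul]
      exact mul_le_mul_of_nonneg_left (hc h1 h2) (norm_nonneg _)
    · simp [prodWeight, hv _ (not_le.mp h2)]
  · push Not at h1
    obtain ⟨q, hq, h⟩ := h1
    have : ∏ q, w q (y.1 q) = 0 := Finset.prod_eq_zero (Finset.mem_univ q) (hw q hq _ h)
    simp [prodWeight, this]

theorem AdmissibleWeight.integrable_mul {T : Finset ι} {ρ : ℝ} {w : ι → ℂ → ℂ}
    {v : (κ → ℝ) → ℂ} (hwv : AdmissibleWeight T ρ w v) {H : (ι → ℂ) × (κ → ℝ) → ℂ}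
    (hH : Continuous H) : Integrable fun y => prodWeight w v y * H (planeProj T y) := by
  obtain ⟨M, -, hM⟩ := exists_bound_on_ball hH ρ
  refine ((integrable_prodWeight hwv.integrable
    (integrable_of_support hwv.contReal hwv.supportReal)).norm.mul_const M).mono'
    ((continuous_prodWeight hwv.cont hwv.contReal).mul
      (hH.comp (continuous_planeProj T))).aestronglyMeasurable (Eventually.of_forall fun y => ?_)
  exact norm_prodWeight_mul_le hwv.support hwv.supportReal fun h1 h2 =>
    hM _ (norm_planeProj_le T hwv.nonneg h1 h2)

theorem hasLineDerivAt_prodWeight {w : ι → ℂ → ℂ} {v : (κ → ℝ) → ℂ} {i : ι}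
    (hw : Differentiable ℝ (w i)) (c : ℂ) (y : (ι → ℂ) × (κ → ℝ)) :
    HasLineDerivAt ℝ (prodWeight w v)
      (prodWeight (Function.update w i fun z => fderiv ℝ (w i) z c) v y) y (Pi.single i c, 0) := by
  have h := ((hw (y.1 i)).hasFDerivAt.hasLineDerivAt c)
  unfold HasLineDerivAt at h ⊢
  have h2 := (h.mul_const (∏ q ∈ Finset.univ.erase i, w q (y.1 q))).mul_const (v y.2)
  have e1 : (fun t : ℝ => prodWeight w v (y + t • ((Pi.single i c, 0) : (ι → ℂ) × (κ → ℝ)))) =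
      fun t : ℝ => w i (y.1 i + t • c) * (∏ q ∈ Finset.univ.erase i, w q (y.1 q)) * v y.2 := by
    funext t
    unfold prodWeight
    rw [← Finset.mul_prod_erase _ _ (Finset.mem_univ i)]
    congr 2
    · simp
    · refine Finset.prod_congr rfl fun q hq => ?_
      simp [Finset.ne_of_mem_erase hq]
    · simp
  have e2 : prodWeight (Function.update w i fun z => fderiv ℝ (w i) z c) v y =
      fderiv ℝ (w i) (y.1 i) c * (∏ q ∈ Finset.univ.erase i, w q (y.1 q)) * v y.2 := by
    unfold prodWeight
    rw [← Finset.mul_prod_erase _ _ (Finset.mem_univ i)]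
    congr 2
    · simp
    · refine Finset.prod_congr rfl fun q hq => ?_
      rw [Function.update_of_ne (Finset.ne_of_mem_erase hq)]
  rw [e1, e2]
  exact h2

theorem hasLineDerivAt_comp_planeProj {T : Finset ι} {i : ι} (hi : i ∈ T)
    {h : (ι → ℂ) × (κ → ℝ) → ℂ} (hh : Differentiable ℝ h) (c : ℂ) (y : (ι → ℂ) × (κ → ℝ)) :
    HasLineDerivAt ℝ (fun y => h (planeProj T y))
      (fderiv ℝ h (planeProj T y) (Pi.single i c, 0)) y (Pi.single i c, 0) := by
  have h1 := (hh (planeProj T y)).hasFDerivAt.hasLineDerivAt (Pi.single i c, 0)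
  unfold HasLineDerivAt at h1 ⊢
  convert h1 using 3 with t
  refine Prod.ext (funext fun q => ?_) ?_
  · by_cases hq : q ∈ T
    · simp [planeProj, hq]
    · have : q ≠ i := fun h => hq (h ▸ hi)
      simp [planeProj, hq, this]
  · simp [planeProj]

theorem AdmissibleWeight.update {T : Finset ι} {ρ : ℝ} {w : ι → ℂ → ℂ} {v : (κ → ℝ) → ℂ}
    (hwv : AdmissibleWeight T ρ w v) (i : ι) {w' : ℂ → ℂ} (hc : Continuous w')
    (hs : ∀ z, ρ < ‖z‖ → w' z = 0) : AdmissibleWeight T ρ (Function.update w i w') v where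
  nonneg := hwv.nonneg
  cont q := by
    rcases eq_or_ne q i with rfl | h
    · simpa using hc
    · simpa [h] using hwv.cont q
  integrable q := by
    rcases eq_or_ne q i with rfl | h
    · simpa using integrable_of_support hc hs
    · simpa [h] using hwv.integrable q
  support q hq z hz := by
    rcases eq_or_ne q i with rfl | h
    · simpa using hs z hz
    · simpa [h] using hwv.support q hq z hz
  contReal := hwv.contReal
  supportReal := hwv.supportReal

theorem fderiv_eq_zero_of_support {ρ : ℝ} {w : ℂ → ℂ} (hs : ∀ z, ρ < ‖z‖ → w z = 0) {z : ℂ}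
    (hz : ρ < ‖z‖) : fderiv ℝ w z = 0 := by
  have h : w =ᶠ[𝓝 z] fun _ => 0 := by
    filter_upwards [(isOpen_lt continuous_const continuous_norm).mem_nhds hz] with z' hz'
    exact hs z' hz'
  rw [h.fderiv_eq]
  simp

theorem continuous_dbar {w : ℂ → ℂ} (hw : ContDiff ℝ 1 w) : Continuous (dbar w) := by
  have h := hw.continuous_fderiv one_ne_zero
  unfold dbar
  fun_prop

/-- Integration by parts for `∂/∂m̄_i`, `i ∈ T`, on functions of the projection to the plane. -/
theorem integral_mul_dbarAt {T : Finset ι} {ρ : ℝ} {w : ι → ℂ → ℂ} {v : (κ → ℝ) → ℂ}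
    (hwv : AdmissibleWeight T ρ w v) {i : ι} (hi : i ∈ T) (hwi : ContDiff ℝ 1 (w i))
    {h : (ι → ℂ) × (κ → ℝ) → ℂ} (hh : ContDiff ℝ 1 h) :
    ∫ y, prodWeight w v y * dbarAt i h (planeProj T y) =
      -∫ y, prodWeight (Function.update w i (dbar (w i))) v y * h (planeProj T y) := by
  have hcw := hwi.continuous_fderiv one_ne_zero
  have hch := hh.continuous_fderiv one_ne_zero
  have hadm : ∀ c : ℂ, AdmissibleWeight T ρ
      (Function.update w i fun z => fderiv ℝ (w i) z c) v := fun c =>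
    hwv.update i (by fun_prop) fun z hz => by
      rw [fderiv_eq_zero_of_support (hwv.support i hi) hz]; rfl
  have hint : ∀ c : ℂ, Integrable fun y => prodWeight w v y *
      fderiv ℝ h (planeProj T y) (Pi.single i c, 0) := fun c =>
    hwv.integrable_mul (H := fun y => fderiv ℝ h y (Pi.single i c, 0)) (by fun_prop)
  have key : ∀ c : ℂ, ∫ y, prodWeight w v y * fderiv ℝ h (planeProj T y) (Pi.single i c, 0) =
      -∫ y, prodWeight (Function.update w i fun z => fderiv ℝ (w i) z c) v y *
        h (planeProj T y) := by
    intro c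
    exact integral_bilinear_hasLineDerivAt_right_eq_neg_left_of_integrable
      (B := ContinuousLinearMap.mul ℝ ℂ) ((hadm c).integrable_mul hh.continuous) (hint c)
      (hwv.integrable_mul hh.continuous)
      (fun y _ => hasLineDerivAt_prodWeight (hwi.differentiable one_ne_zero) c y)
      (fun y _ => hasLineDerivAt_comp_planeProj hi (hh.differentiable one_ne_zero) c y)
  have hupd : ∀ (g : ℂ → ℂ) (y : (ι → ℂ) × (κ → ℝ)), prodWeight (Function.update w i g) v y =
      g (y.1 i) * (∏ q ∈ Finset.univ.erase i, w q (y.1 q)) * v y.2 := by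
    intro g y
    unfold prodWeight
    rw [← Finset.mul_prod_erase _ _ (Finset.mem_univ i)]
    congr 2
    · simp
    · refine Finset.prod_congr rfl fun q hq => ?_
      rw [Function.update_of_ne (Finset.ne_of_mem_erase hq)]
  have e1 : (fun y => prodWeight w v y * dbarAt i h (planeProj T y)) = fun y =>
      (1 / 2 : ℂ) * (prodWeight w v y * fderiv ℝ h (planeProj T y) (Pi.single i 1, 0) +
        Complex.I * (prodWeight w v y *
          fderiv ℝ h (planeProj T y) (Pi.single i Complex.I, 0))) := by
    funext y; unfold dbarAt; ring
  have e2 : (fun y => prodWeight (Function.update w i (dbar (w i))) v y * h (planeProj T y)) =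
      fun y => (1 / 2 : ℂ) * (prodWeight (Function.update w i fun z => fderiv ℝ (w i) z 1) v y *
          h (planeProj T y) + Complex.I *
        (prodWeight (Function.update w i fun z => fderiv ℝ (w i) z Complex.I) v y *
          h (planeProj T y))) := by
    funext y; simp only [hupd, dbar]; ring
  rw [e1, e2, integral_const_mul, integral_const_mul, integral_add (hint 1)
    ((hint Complex.I).const_mul _), integral_add ((hadm 1).integrable_mul hh.continuous)
    (((hadm Complex.I).integrable_mul hh.continuous).const_mul _), integral_const_mul,
    integral_const_mul, key, key]
  ring

/-! ### Cutoffs -/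

/-- A smooth bump function on the complex plane, equal to one on the unit ball. -/
def planeBump : ContDiffBump (0 : ℂ) := ⟨1, 2, one_pos, one_lt_two⟩

/-- A smooth bump function of the real coordinates, equal to one on the unit ball. -/
def realBump (κ : Type) [Fintype κ] : ContDiffBump (0 : κ → ℝ) := ⟨1, 2, one_pos, one_lt_two⟩

/-- The cutoff at radius `R` on the complex plane. -/
def cut (R : ℝ) (z : ℂ) : ℂ := (planeBump (R⁻¹ • z) : ℝ)

/-- The cutoff at radius `R` of the real coordinates. -/
def cutReal (R : ℝ) (Y : κ → ℝ) : ℂ := (realBump κ (R⁻¹ • Y) : ℝ)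

theorem contDiff_cut (R : ℝ) : ContDiff ℝ 1 (cut R) :=
  Complex.ofRealCLM.contDiff.comp (planeBump.contDiff.comp (contDiff_const_smul _))

theorem continuous_cutReal (R : ℝ) : Continuous (cutReal R : (κ → ℝ) → ℂ) :=
  Complex.continuous_ofReal.comp ((realBump κ).continuous.comp (continuous_const_smul _))

theorem norm_inv_smul {E : Type*} [NormedAddCommGroup E] [NormedSpace ℝ E] {R : ℝ} (hR : 0 < R)
    (z : E) : ‖R⁻¹ • z‖ = ‖z‖ / R := by
  rw [norm_smul, norm_inv, Real.norm_of_nonneg hR.le, inv_mul_eq_div]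

theorem cut_eq_zero {R : ℝ} (hR : 0 < R) {z : ℂ} (hz : 2 * R < ‖z‖) : cut R z = 0 := by
  rw [cut, planeBump.zero_of_le_dist, Complex.ofReal_zero]
  rw [dist_zero_right, norm_inv_smul hR, le_div_iff₀ hR]
  exact hz.le

theorem cutReal_eq_zero {R : ℝ} (hR : 0 < R) {Y : κ → ℝ} (hY : 2 * R < ‖Y‖) :
    cutReal R Y = 0 := by
  rw [cutReal, (realBump κ).zero_of_le_dist, Complex.ofReal_zero]
  rw [dist_zero_right, norm_inv_smul hR, le_div_iff₀ hR]
  exact hY.le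

theorem norm_cut_le (R : ℝ) (z : ℂ) : ‖cut R z‖ ≤ 1 := by
  rw [cut, Complex.norm_real, Real.norm_of_nonneg planeBump.nonneg]
  exact planeBump.le_one

theorem norm_cutReal_le (R : ℝ) (Y : κ → ℝ) : ‖cutReal R Y‖ ≤ 1 := by
  rw [cutReal, Complex.norm_real, Real.norm_of_nonneg (realBump κ).nonneg]
  exact (realBump κ).le_one

theorem cut_eq_one {R : ℝ} (hR : 0 < R) {z : ℂ} (hz : ‖z‖ ≤ R) : cut R z = 1 := by
  rw [cut, planeBump.one_of_mem_closedBall, Complex.ofReal_one]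
  rw [mem_closedBall_zero_iff, norm_inv_smul hR]
  exact div_le_one_of_le₀ hz hR.le

theorem cutReal_eq_one {R : ℝ} (hR : 0 < R) {Y : κ → ℝ} (hY : ‖Y‖ ≤ R) : cutReal R Y = 1 := by
  rw [cutReal, (realBump κ).one_of_mem_closedBall, Complex.ofReal_one]
  rw [mem_closedBall_zero_iff, norm_inv_smul hR]
  exact div_le_one_of_le₀ hY hR.le

theorem dbar_cut (R : ℝ) (z : ℂ) : dbar (cut R) z = (R⁻¹ : ℝ) • dbar (cut 1) (R⁻¹ • z) := by
  have h : cut R = fun z => cut 1 (R⁻¹ • z) := by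
    funext z; simp [cut]
  rw [h]
  unfold dbar
  rw [fderiv_comp_smul]
  simp only [smul_apply, Complex.real_smul]
  ring

theorem dbar_cut_eq_zero_of_lt {R : ℝ} (hR : 0 < R) {z : ℂ} (hz : ‖z‖ < R) :
    dbar (cut R) z = 0 := by
  have h : cut R =ᶠ[𝓝 z] fun _ => 1 := by
    filter_upwards [(isOpen_lt continuous_norm continuous_const).mem_nhds hz] with z' hz'
    exact cut_eq_one hR (le_of_lt hz')
  rw [dbar, h.fderiv_eq]
  simp

theorem dbar_eq_zero_of_support {ρ : ℝ} {w : ℂ → ℂ} (hs : ∀ z, ρ < ‖z‖ → w z = 0) {z : ℂ}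
    (hz : ρ < ‖z‖) : dbar w z = 0 := by
  rw [dbar, fderiv_eq_zero_of_support hs hz]
  simp

theorem exists_norm_dbar_cut_le : ∃ C, 0 ≤ C ∧ ∀ R : ℝ, 0 < R → ∀ z,
    ‖dbar (cut R) z‖ ≤ C / R := by
  obtain ⟨C, hC⟩ := (isCompact_closedBall (0 : ℂ) 2).exists_bound_of_continuousOn
    (continuous_dbar (contDiff_cut 1)).continuousOn
  have hC' : ∀ z, ‖dbar (cut 1) z‖ ≤ max C 0 := by
    intro z
    by_cases hz : ‖z‖ ≤ 2
    · exact (hC z (by simpa using hz)).trans (le_max_left _ _)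
    · rw [dbar_eq_zero_of_support (ρ := 2) (fun z hz => cut_eq_zero one_pos (by linarith))
        (not_le.mp hz)]
      simp
  refine ⟨max C 0, le_max_right _ _, fun R hR z => ?_⟩
  rw [dbar_cut, norm_smul, norm_inv, Real.norm_of_nonneg hR.le, inv_mul_eq_div]
  gcongr
  exact hC' _

/-- The weight of the integrals over the plane of `T`: a cutoff at radius `R` for the coordinates
in the plane, and a fixed bubble for those transversal to it. -/
def planeWeight (T : Finset ι) (R : ℝ) (q : ι) : ℂ → ℂ :=
  if q ∈ T then cut R else fun z => (bubble z : ℂ)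

/-- The integral of `G` over the plane of `T`, cut off at radius `R`, up to one factor `π` for each
transversal coordinate. -/
def planeIntegral (T : Finset ι) (R : ℝ) (G : (ι → ℂ) × (κ → ℝ) → ℂ) : ℂ :=
  ∫ y, prodWeight (planeWeight T R) (cutReal R) y * G (planeProj T y)

theorem admissible_planeWeight (T : Finset ι) {R : ℝ} (hR : 0 < R) :
    AdmissibleWeight T (2 * R) (planeWeight T R) (cutReal R : (κ → ℝ) → ℂ) where
  nonneg := by positivity
  cont q := by
    unfold planeWeight
    split_ifs
    · exact (contDiff_cut R).continuous
    · exact Complex.continuous_ofReal.comp continuous_bubble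
  integrable q := by
    unfold planeWeight
    split_ifs
    · exact integrable_of_support (contDiff_cut R).continuous fun z hz => cut_eq_zero hR hz
    · exact integrable_bubble.ofReal
  support q hq z hz := by
    simp only [planeWeight, hq, if_true]
    exact cut_eq_zero hR hz
  contReal := continuous_cutReal R
  supportReal Y hY := cutReal_eq_zero hR hY

theorem prodWeight_update (w : ι → ℂ → ℂ) (v : (κ → ℝ) → ℂ) (i : ι) (g : ℂ → ℂ)
    (y : (ι → ℂ) × (κ → ℝ)) : prodWeight (Function.update w i g) v y =
      g (y.1 i) * (∏ q ∈ Finset.univ.erase i, w q (y.1 q)) * v y.2 := by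
  unfold prodWeight
  rw [← Finset.mul_prod_erase _ _ (Finset.mem_univ i)]
  congr 2
  · simp
  · refine Finset.prod_congr rfl fun q hq => ?_
    rw [Function.update_of_ne (Finset.ne_of_mem_erase hq)]

/-! ### The error terms at infinity -/

/-- Majorants of the weights in the error terms, with a Cauchy kernel in the coordinate `t`. -/
def errorWeight (T : Finset ι) (t : ι) (R : ℝ) (q : ι) : ℂ → ℝ :=
  if q ∈ T then (Metric.closedBall (0 : ℂ) (2 * R)).indicator 1
  else if q = t then (Metric.closedBall (0 : ℂ) (2 * R)).indicator fun z => ‖z‖⁻¹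
  else bubble

theorem integrable_indicator_ball {E : Type*} [NormedAddCommGroup E] [ProperSpace E]
    [MeasurableSpace E] [BorelSpace E] {μ : Measure E} [IsFiniteMeasureOnCompacts μ] (ρ : ℝ) :
    Integrable ((Metric.closedBall (0 : E) ρ).indicator (1 : E → ℝ)) μ := by
  rw [integrable_indicator_iff Metric.isClosed_closedBall.measurableSet]
  exact integrableOn_const (isCompact_closedBall 0 ρ).measure_lt_top.ne

theorem integrable_errorWeight (T : Finset ι) (t : ι) (R : ℝ) (q : ι) :
    Integrable (errorWeight T t R q) := by
  unfold errorWeight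
  split_ifs
  · exact integrable_indicator_ball _
  · exact integrable_indicator_norm_inv
  · exact integrable_bubble

theorem indicator_ball_scale {E : Type*} [NormedAddCommGroup E] [NormedSpace ℝ E] {R : ℝ}
    (hR : 0 < R) (g : E → ℝ) (z : E) : (Metric.closedBall (0 : E) (2 * R)).indicator g z =
      (Metric.closedBall (0 : E) (2 * 1)).indicator (fun z => g (R • z)) (R⁻¹ • z) := by
  have h : z ∈ Metric.closedBall (0 : E) (2 * R) ↔ R⁻¹ • z ∈ Metric.closedBall (0 : E) (2 * 1) := by
    rw [mem_closedBall_zero_iff, mem_closedBall_zero_iff, norm_inv_smul hR, div_le_iff₀ hR, mul_one]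
  by_cases hz : z ∈ Metric.closedBall (0 : E) (2 * R)
  · rw [Set.indicator_of_mem hz, Set.indicator_of_mem (h.mp hz), smul_inv_smul₀ hR.ne']
  · rw [Set.indicator_of_notMem hz, Set.indicator_of_notMem (fun h' => hz (h.mpr h'))]

theorem integral_errorWeight (T : Finset ι) (t : ι) {R : ℝ} (hR : 0 < R) (q : ι) :
    ∫ z, errorWeight T t R q z =
      R ^ (if q ∈ T then 2 else if q = t then 1 else 0) * ∫ z, errorWeight T t 1 q z := by
  unfold errorWeight
  split_ifs
  · have h : ∀ z : ℂ, (Metric.closedBall (0 : ℂ) (2 * R)).indicator (1 : ℂ → ℝ) z =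
        (Metric.closedBall (0 : ℂ) (2 * 1)).indicator (1 : ℂ → ℝ) (R⁻¹ • z) := fun z =>
      indicator_ball_scale hR _ z
    rw [integral_congr_ae (Eventually.of_forall h), Measure.integral_comp_inv_smul_of_nonneg _ _ hR.le]
    simp
  · have h : ∀ z : ℂ, (Metric.closedBall (0 : ℂ) (2 * R)).indicator (fun z => ‖z‖⁻¹) z =
        R⁻¹ * (Metric.closedBall (0 : ℂ) (2 * 1)).indicator (fun z => ‖z‖⁻¹) (R⁻¹ • z) := fun z => by
      rw [indicator_ball_scale hR]
      by_cases hz : R⁻¹ • z ∈ Metric.closedBall (0 : ℂ) (2 * 1)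
      · rw [Set.indicator_of_mem hz, Set.indicator_of_mem hz, norm_smul, mul_inv,
          Real.norm_of_nonneg hR.le]
      · rw [Set.indicator_of_notMem hz, Set.indicator_of_notMem hz, mul_zero]
    rw [integral_congr_ae (Eventually.of_forall h), integral_const_mul,
      Measure.integral_comp_inv_smul_of_nonneg _ _ hR.le]
    simp only [Complex.finrank_real_complex, smul_eq_mul]
    field_simp
  · simp

/-- The constant in the bound of the error terms. -/
def errorConst (κ : Type) [Fintype κ] (T : Finset ι) (t : ι) : ℝ :=
  (∏ q, ∫ z, errorWeight T t 1 q z) *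
    ∫ Y, (Metric.closedBall (0 : κ → ℝ) (2 * 1)).indicator (1 : (κ → ℝ) → ℝ) Y

/-- The terms with a derivative of a cutoff are small.  On the support of such a derivative the
projected point has norm at least `R`, so that `H` is at most `ε R^{-p}`.  The weights have mass of
order `R^{p+1}`, the Cauchy kernel in the coordinate `t` contributing one power instead of two, and
the derivative contributes `C / R`. -/
theorem norm_integral_error_le {T P : Finset ι} {t : ι} (ht : t ∉ T) {R C ε : ℝ}
    (hR : 0 < R) (hε : 0 ≤ ε) {w : ι → ℂ → ℂ} {v : (κ → ℝ) → ℂ}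
    (hw : ∀ m : ι → ℂ, ‖∏ q, w q (m q)‖ ≤ C / R * ∏ q, errorWeight T t R q (m q))
    (hv : ∀ Y, ‖v Y‖ ≤ (Metric.closedBall (0 : κ → ℝ) (2 * R)).indicator 1 Y)
    (hvan : ∀ y : (ι → ℂ) × (κ → ℝ), ‖planeProj P y‖ < R → ∏ q, w q (y.1 q) = 0)
    {H : (ι → ℂ) × (κ → ℝ) → ℂ}
    (hH : ∀ y, R ≤ ‖y‖ → ‖H y‖ * R ^ (Fintype.card κ + 2 * T.card) ≤ ε) :
    ‖∫ y, prodWeight w v y * H (planeProj P y)‖ ≤ ε * C * errorConst κ T t := by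
  set p := Fintype.card κ + 2 * T.card with hp
  set W : (ι → ℂ) × (κ → ℝ) → ℝ := fun y => (∏ q, errorWeight T t R q (y.1 q)) *
    (Metric.closedBall (0 : κ → ℝ) (2 * R)).indicator 1 y.2 with hW
  have hWint : Integrable W :=
    Integrable.mul_prod (Integrable.fintype_prod (f := errorWeight T t R) (μ := fun _ => volume)
      (integrable_errorWeight T t R)) (integrable_indicator_ball _)
  have hWval : ∫ y, W y = R ^ (p + 1) * errorConst κ T t := by
    have h1 : ∫ y, W y = (∏ q, ∫ z, errorWeight T t R q z) *
        ∫ Y, (Metric.closedBall (0 : κ → ℝ) (2 * R)).indicator (1 : (κ → ℝ) → ℝ) Y := by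
      rw [← integral_fintype_prod_volume_eq_prod (errorWeight T t R)]
      exact integral_prod_mul (fun m : ι → ℂ => ∏ q, errorWeight T t R q (m q)) _
    have h2 : ∫ Y, (Metric.closedBall (0 : κ → ℝ) (2 * R)).indicator (1 : (κ → ℝ) → ℝ) Y =
        R ^ Fintype.card κ *
          ∫ Y, (Metric.closedBall (0 : κ → ℝ) (2 * 1)).indicator (1 : (κ → ℝ) → ℝ) Y := by
      have h : ∀ z : κ → ℝ, (Metric.closedBall (0 : κ → ℝ) (2 * R)).indicator (1 : (κ → ℝ) → ℝ) z =
          (Metric.closedBall (0 : κ → ℝ) (2 * 1)).indicator (1 : (κ → ℝ) → ℝ) (R⁻¹ • z) := fun z =>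
        indicator_ball_scale hR _ z
      rw [integral_congr_ae (Eventually.of_forall h),
        Measure.integral_comp_inv_smul_of_nonneg _ _ hR.le]
      simp
    have h3 : ∑ q, (if q ∈ T then 2 else if q = t then 1 else 0) = 2 * T.card + 1 := by
      have : ∀ q, (if q ∈ T then 2 else if q = t then 1 else 0) =
          (if q ∈ T then 2 else 0) + (if q = t then 1 else 0) := by
        intro q
        by_cases h : q ∈ T
        · have : q ≠ t := fun h' => ht (h' ▸ h)
          simp [h, this]
        · simp [h]
      simp only [this, Finset.sum_add_distrib]
      simp [mul_comm]
    rw [h1, h2, errorConst, Finset.prod_congr rfl fun q _ => integral_errorWeight T t hR q,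
      Finset.prod_mul_distrib, Finset.prod_pow_eq_pow_sum, h3, hp]
    ring
  have hRp : 0 < R ^ p := pow_pos hR p
  have hbound : ∀ y, ‖prodWeight w v y * H (planeProj P y)‖ ≤ ε / R ^ p * (C / R) * W y := by
    intro y
    have hnn : 0 ≤ C / R * ∏ q, errorWeight T t R q (y.1 q) := (norm_nonneg _).trans (hw y.1)
    by_cases hy : ‖planeProj P y‖ < R
    · have h0 : prodWeight w v y = 0 := by rw [prodWeight, hvan y hy, zero_mul]
      rw [h0, zero_mul, norm_zero, hW]
      have := Set.indicator_nonneg (s := Metric.closedBall (0 : κ → ℝ) (2 * R)) (f := 1)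
        (fun _ _ => zero_le_one (α := ℝ)) y.2
      calc (0 : ℝ) ≤ ε / R ^ p * ((C / R * ∏ q, errorWeight T t R q (y.1 q)) *
          (Metric.closedBall (0 : κ → ℝ) (2 * R)).indicator 1 y.2) := by positivity
        _ = _ := by ring
    · have h1 : ‖H (planeProj P y)‖ ≤ ε / R ^ p := by
        rw [le_div_iff₀ hRp]; exact hH _ (not_lt.mp hy)
      rw [norm_mul, prodWeight, norm_mul]
      calc ‖∏ q, w q (y.1 q)‖ * ‖v y.2‖ * ‖H (planeProj P y)‖
          ≤ (C / R * ∏ q, errorWeight T t R q (y.1 q)) *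
            (Metric.closedBall (0 : κ → ℝ) (2 * R)).indicator 1 y.2 * (ε / R ^ p) := by
            gcongr
            · exact mul_nonneg hnn (Set.indicator_nonneg (fun _ _ => zero_le_one) _)
            · exact hw y.1
            · exact hv y.2
        _ = _ := by rw [hW]; ring
  refine (norm_integral_le_of_norm_le (hWint.const_mul _) (Eventually.of_forall hbound)).trans ?_
  rw [integral_const_mul, hWval]
  apply le_of_eq
  field_simp
  ring

/-! ### Localization in one complex coordinate -/

/-- Scaling of the complex coordinate `t`. -/
def scaleAt (t : ι) (s : ℝ) (y : (ι → ℂ) × (κ → ℝ)) : (ι → ℂ) × (κ → ℝ) :=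
  (Function.update y.1 t (s • y.1 t), y.2)

theorem integral_comp_scaleAt (t : ι) {s : ℝ} (hs : 0 < s) (F : (ι → ℂ) × (κ → ℝ) → ℂ) :
    ∫ y, F y = ((s ^ 2 : ℝ) : ℂ) * ∫ y, F (scaleAt t s y) := by
  let f : ((ι → ℂ) × (κ → ℝ)) →ₗ[ℝ] ((ι → ℂ) × (κ → ℝ)) := LinearMap.prodMap
    (LinearMap.pi fun q => ((if q = t then s else 1) • LinearMap.id) ∘ₗ LinearMap.proj q)
    LinearMap.id
  have hf : ∀ y, f y = scaleAt t s y := by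
    intro y
    refine Prod.ext (funext fun q => ?_) rfl
    by_cases h : q = t
    · subst h; simp [f, scaleAt]
    · simp [f, scaleAt, h]
  have hdet : LinearMap.det f = s ^ 2 := by
    simp only [f, LinearMap.det_prodMap, LinearMap.det_pi, LinearMap.det_smul, LinearMap.det_id,
      Complex.finrank_real_complex, mul_one]
    rw [Finset.prod_eq_single t] <;> simp +contextual
  have hne : LinearMap.det f ≠ 0 := by rw [hdet]; positivity
  have hmap := Measure.map_linearMap_addHaar_eq_smul_addHaar
    (volume : Measure ((ι → ℂ) × (κ → ℝ))) hne
  have hemb : MeasurableEmbedding f :=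
    ((LinearEquiv.ofIsUnitDet (f := f) (v := Module.finBasis ℝ _) (v' := Module.finBasis ℝ _)
      (by rw [LinearMap.det_toMatrix]; exact hne.isUnit)).toContinuousLinearEquiv.toHomeomorph
      ).measurableEmbedding
  have h := hemb.integral_map (μ := volume) F
  rw [hmap, integral_smul_measure, hdet] at h
  simp only [hf] at h
  rw [← h, ENNReal.toReal_ofReal (abs_nonneg _), abs_of_pos (by positivity), Complex.real_smul,
    ← mul_assoc, ← Complex.ofReal_mul, mul_inv_cancel₀ (by positivity), Complex.ofReal_one, one_mul]

theorem ae_fst_apply_ne_zero (t : ι) : ∀ᵐ y : (ι → ℂ) × (κ → ℝ), y.1 t ≠ 0 := by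
  let f : ((ι → ℂ) × (κ → ℝ)) →ₗ[ℝ] ℂ := LinearMap.proj t ∘ₗ LinearMap.fst ℝ _ _
  have h := Measure.addHaar_submodule (volume : Measure ((ι → ℂ) × (κ → ℝ))) (LinearMap.ker f) (by
    intro h
    have : ((Pi.single t 1, 0) : (ι → ℂ) × (κ → ℝ)) ∈ LinearMap.ker f := h ▸ Submodule.mem_top
    simp [f] at this)
  rw [ae_iff]
  convert h using 2
  ext y
  simp [f]

theorem tendsto_integral_mul_cauchyReg {T : Finset ι} (t : ι) {R : ℝ} (hR : 0 < R)
    {G : (ι → ℂ) × (κ → ℝ) → ℂ} (hG : Continuous G) :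
    Tendsto (fun s => ∫ y, prodWeight (planeWeight T R) (cutReal R) y * G (planeProj T y) *
      (y.1 t * cauchyReg s (y.1 t))) (𝓝[>] 0) (𝓝 (planeIntegral T R G)) := by
  have hint := (admissible_planeWeight (κ := κ) T hR).integrable_mul hG
  refine tendsto_integral_filter_of_dominated_convergence
    (fun y => ‖prodWeight (planeWeight T R) (cutReal R) y * G (planeProj T y)‖) ?_ ?_ hint.norm ?_
  · filter_upwards [self_mem_nhdsWithin] with s hs
    refine hint.aestronglyMeasurable.mul (Continuous.aestronglyMeasurable ?_)
    have := (contDiff_cauchyReg hs).continuous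
    fun_prop
  · filter_upwards [self_mem_nhdsWithin] with s hs
    refine Eventually.of_forall fun y => ?_
    rw [norm_mul]
    exact mul_le_of_le_one_right (norm_nonneg _) (norm_mul_cauchyReg_le hs _)
  · filter_upwards [ae_fst_apply_ne_zero t] with y hy
    simpa using (tendsto_mul_cauchyReg hy).const_mul
      (prodWeight (planeWeight T R) (cutReal R) y * G (planeProj T y))

theorem planeProj_scaleAt_zero {T : Finset ι} {t : ι} (ht : t ∉ T) (y : (ι → ℂ) × (κ → ℝ)) :
    planeProj (insert t T) (scaleAt t 0 y) = planeProj T y := by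
  refine Prod.ext (funext fun q => ?_) rfl
  by_cases h : q = t
  · subst h; simp [planeProj, scaleAt, ht]
  · simp [planeProj, scaleAt, h]

theorem continuous_scaleAt (t : ι) :
    Continuous fun p : ℝ × ((ι → ℂ) × (κ → ℝ)) => scaleAt t p.1 p.2 := by
  unfold scaleAt
  refine Continuous.prodMk ?_ (by fun_prop)
  exact Continuous.update (by fun_prop) t (by fun_prop)

theorem continuous_comp_planeProj_scaleAt (T : Finset ι) (t : ι)
    {G : (ι → ℂ) × (κ → ℝ) → ℂ} (hG : Continuous G) :
    Continuous fun p : ℝ × ((ι → ℂ) × (κ → ℝ)) => G (planeProj T (scaleAt t p.1 p.2)) :=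
  hG.comp ((continuous_planeProj T).comp (continuous_scaleAt t))

theorem tendsto_integral_scaleAt {T : Finset ι} {t : ι} (ht : t ∉ T) {R : ℝ} (hR : 0 < R)
    {G : (ι → ℂ) × (κ → ℝ) → ℂ} (hG : Continuous G) :
    Tendsto (fun s : ℝ => ∫ y, prodWeight (planeWeight T R) (cutReal R) y *
      (cut R (s • y.1 t) * G (planeProj (insert t T) (scaleAt t s y))))
      (𝓝[>] 0) (𝓝 (planeIntegral T R G)) := by
  have hcut : Continuous (cut R) := (contDiff_cut R).continuous
  have hGc := continuous_comp_planeProj_scaleAt (κ := κ) (insert t T) t hG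
  have hadm := admissible_planeWeight (κ := κ) T hR
  have hpw := continuous_prodWeight hadm.cont hadm.contReal
  obtain ⟨M, hM0, hM⟩ := exists_bound_on_ball hG (2 * R)
  refine tendsto_integral_filter_of_dominated_convergence
    (fun y => ‖prodWeight (planeWeight T R) (cutReal R) y‖ * M) ?_ ?_ ?_ ?_
  · refine Eventually.of_forall fun s => Continuous.aestronglyMeasurable ?_
    have h1 : Continuous fun y : (ι → ℂ) × (κ → ℝ) => cut R (s • y.1 t) :=
      hcut.comp (by fun_prop)
    exact hpw.mul (h1.mul (hGc.comp (Continuous.prodMk_right s)))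
  · refine Eventually.of_forall fun s => Eventually.of_forall fun y => ?_
    refine norm_prodWeight_mul_le hadm.support hadm.supportReal fun h1 h2 => ?_
    by_cases hz : ‖s • y.1 t‖ ≤ 2 * R
    · rw [norm_mul]
      refine (mul_le_of_le_one_left (norm_nonneg _) (norm_cut_le R _)).trans (hM _ ?_)
      refine norm_planeProj_le _ hadm.nonneg (fun q hq => ?_) h2
      by_cases h : q = t
      · subst h; simpa [scaleAt] using hz
      · simpa [scaleAt, h] using h1 q ((Finset.mem_insert.mp hq).resolve_left h)
    · rw [cut_eq_zero hR (not_le.mp hz), zero_mul, norm_zero]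
      exact hM0
  · exact (integrable_prodWeight hadm.integrable
      (integrable_of_support hadm.contReal hadm.supportReal)).norm.mul_const M
  · refine Eventually.of_forall fun y => ?_
    have h1 : Tendsto (fun s : ℝ => cut R (s • y.1 t)) (𝓝[>] 0) (𝓝 1) := by
      have h : Continuous fun s : ℝ => cut R (s • y.1 t) := hcut.comp (by fun_prop)
      have h0 := (h.tendsto 0).mono_left (nhdsWithin_le_nhds (s := Set.Ioi 0))
      rwa [zero_smul, cut_eq_one hR (by simpa using hR.le)] at h0
    have h2 : Tendsto (fun s : ℝ => G (planeProj (insert t T) (scaleAt t s y))) (𝓝[>] 0)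
        (𝓝 (G (planeProj T y))) := by
      have h : Continuous fun s : ℝ => G (planeProj (insert t T) (scaleAt t s y)) :=
        hGc.comp (Continuous.prodMk_left y)
      have h0 := (h.tendsto 0).mono_left (nhdsWithin_le_nhds (s := Set.Ioi 0))
      rwa [planeProj_scaleAt_zero ht] at h0
    simpa using (h1.mul h2).const_mul (prodWeight (planeWeight T R) (cutReal R) y)

theorem prodWeight_insert {T : Finset ι} {t : ι} (ht : t ∉ T) (R s : ℝ)
    (y : (ι → ℂ) × (κ → ℝ)) :
    prodWeight (planeWeight T R) (cutReal R) y = (bubble (y.1 t) : ℂ) *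
      (∏ q ∈ Finset.univ.erase t, planeWeight (insert t T) R q ((scaleAt t s y).1 q)) *
      cutReal R (scaleAt t s y).2 := by
  rw [prodWeight, ← Finset.mul_prod_erase _ _ (Finset.mem_univ t)]
  congr 2
  · simp [planeWeight, ht]
  · refine Finset.prod_congr rfl fun q hq => ?_
    have hq := Finset.ne_of_mem_erase hq
    simp [planeWeight, scaleAt, hq]

/-- The derivative of the regularized Cauchy kernel localizes to the smaller plane. -/
theorem tendsto_integral_dbar_cauchyReg {T : Finset ι} {t : ι} (ht : t ∉ T) {R : ℝ} (hR : 0 < R)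
    {G : (ι → ℂ) × (κ → ℝ) → ℂ} (hG : Continuous G) :
    Tendsto (fun s => ∫ y, prodWeight (Function.update (planeWeight (insert t T) R) t
      fun z => cut R z * dbar (cauchyReg s) z) (cutReal R) y * G (planeProj (insert t T) y))
      (𝓝[>] 0) (𝓝 (planeIntegral T R G)) := by
  refine (tendsto_integral_scaleAt ht hR hG).congr' ?_
  filter_upwards [self_mem_nhdsWithin] with s hs
  have hs : 0 < s := hs
  symm
  rw [integral_comp_scaleAt t hs, ← integral_const_mul]
  refine integral_congr_ae (Eventually.of_forall fun y => ?_)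
  have e1 : (scaleAt t s y).1 t = s • y.1 t := by simp [scaleAt]
  have hsc : (s : ℂ) ≠ 0 := by exact_mod_cast hs.ne'
  have e3 : ((s ^ 2 : ℝ) : ℂ) * (((s ^ 2)⁻¹ * bubble (y.1 t) : ℝ) : ℂ) = bubble (y.1 t) := by
    push_cast
    field_simp
  beta_reduce
  rw [prodWeight_update, prodWeight_insert ht R s, e1, dbar_cauchyReg hs, inv_smul_smul₀ hs.ne',
    ← e3]
  ring

/-- `h y = o(‖y‖^{-p})` at infinity. -/
def Decays (p : ℕ) (h : (ι → ℂ) × (κ → ℝ) → ℂ) : Prop :=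
  ∀ ε > 0, ∃ R₀, ∀ y, R₀ ≤ ‖y‖ → ‖h y‖ * ‖y‖ ^ p ≤ ε

theorem Decays.exists_bound {p : ℕ} {h : (ι → ℂ) × (κ → ℝ) → ℂ} (hh : Decays p h) {ε : ℝ}
    (hε : 0 < ε) : ∃ R₀, ∀ R, R₀ ≤ R → 0 < R → ∀ y, R ≤ ‖y‖ → ‖h y‖ * R ^ p ≤ ε := by
  obtain ⟨R₀, h0⟩ := hh ε hε
  refine ⟨R₀, fun R hR hpos y hy => le_trans ?_ (h0 y (hR.trans hy))⟩
  gcongr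

theorem norm_cut_le_indicator {R : ℝ} (hR : 0 < R) (z : ℂ) :
    ‖cut R z‖ ≤ (Metric.closedBall (0 : ℂ) (2 * R)).indicator 1 z := by
  by_cases hz : z ∈ Metric.closedBall (0 : ℂ) (2 * R)
  · rw [Set.indicator_of_mem hz]; exact norm_cut_le R z
  · rw [Set.indicator_of_notMem hz, cut_eq_zero hR (by simpa using hz), norm_zero]

theorem norm_dbar_cut_le_indicator {R C : ℝ} (hR : 0 < R) (z : ℂ)
    (hC : ‖dbar (cut R) z‖ ≤ C / R) :
    ‖dbar (cut R) z‖ ≤ C / R * (Metric.closedBall (0 : ℂ) (2 * R)).indicator 1 z := by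
  by_cases hz : z ∈ Metric.closedBall (0 : ℂ) (2 * R)
  · rw [Set.indicator_of_mem hz]; simpa using hC
  · rw [dbar_eq_zero_of_support (ρ := 2 * R) (fun z hz => cut_eq_zero hR hz) (by simpa using hz)]
    rw [Set.indicator_of_notMem hz]; simp

theorem norm_mul_cauchyReg_le_indicator {R s B : ℝ} (hs : 0 < s) {z u : ℂ}
    (hu : ‖u‖ ≤ B * (Metric.closedBall (0 : ℂ) (2 * R)).indicator 1 z) :
    ‖u * cauchyReg s z‖ ≤ B * (Metric.closedBall (0 : ℂ) (2 * R)).indicator (fun z => ‖z‖⁻¹) z := by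
  by_cases hz : z ∈ Metric.closedBall (0 : ℂ) (2 * R)
  · rw [Set.indicator_of_mem hz] at hu ⊢
    rw [norm_mul]
    refine mul_le_mul (by simpa using hu) (norm_cauchyReg_le hs z) (norm_nonneg _) ?_
    simpa using (norm_nonneg _).trans hu
  · rw [Set.indicator_of_notMem hz] at hu ⊢
    rw [mul_zero] at hu
    rw [norm_le_zero_iff.mp hu, zero_mul, norm_zero, mul_zero]

theorem norm_planeWeight_le {T : Finset ι} {t : ι} {R : ℝ} (hR : 0 < R) {q : ι} (hq : q ≠ t)
    (z : ℂ) : ‖planeWeight (insert t T) R q z‖ ≤ errorWeight T t R q z := by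
  by_cases h : q ∈ T
  · simpa [planeWeight, errorWeight, h] using norm_cut_le_indicator hR z
  · simp [planeWeight, errorWeight, h, hq, abs_of_nonneg (bubble_nonneg z)]

/-- The weight with the regularized Cauchy kernel in the coordinate `t`. -/
def kernelWeight (T : Finset ι) (t : ι) (R s : ℝ) : ι → ℂ → ℂ :=
  Function.update (planeWeight (insert t T) R) t fun z => cut R z * cauchyReg s z

theorem norm_prod_le_of_forall_ne {T : Finset ι} {t : ι} {R B : ℝ} {w : ι → ℂ → ℂ}
    (i : ι) (h : ∀ q ≠ i, ∀ z, ‖w q z‖ ≤ errorWeight T t R q z)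
    (hi : ∀ z, ‖w i z‖ ≤ B * errorWeight T t R i z) (m : ι → ℂ) :
    ‖∏ q, w q (m q)‖ ≤ B * ∏ q, errorWeight T t R q (m q) := by
  rw [norm_prod, ← Finset.mul_prod_erase _ _ (Finset.mem_univ i),
    ← Finset.mul_prod_erase (a := i) Finset.univ (fun q => errorWeight T t R q (m q))
      (Finset.mem_univ i), ← mul_assoc]
  refine mul_le_mul (hi _) (Finset.prod_le_prod (fun _ _ => norm_nonneg _) fun q hq =>
    h q (Finset.ne_of_mem_erase hq) _) (Finset.prod_nonneg fun _ _ => norm_nonneg _) ?_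
  exact (norm_nonneg _).trans (hi (m i))

theorem norm_cutReal_le_indicator {R : ℝ} (hR : 0 < R) (Y : κ → ℝ) :
    ‖cutReal R Y‖ ≤ (Metric.closedBall (0 : κ → ℝ) (2 * R)).indicator 1 Y := by
  by_cases hz : Y ∈ Metric.closedBall (0 : κ → ℝ) (2 * R)
  · rw [Set.indicator_of_mem hz]; exact norm_cutReal_le R Y
  · rw [Set.indicator_of_notMem hz, cutReal_eq_zero hR (by simpa using hz), norm_zero]

/-- The bound of the error terms for the weight whose factor `i` is differentiated: for `i = t` the
derivative hits the cutoff and not the Cauchy kernel. -/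
theorem norm_integral_kernel_error_le {T : Finset ι} {t : ι} (ht : t ∉ T) {i : ι}
    (hi : i ∈ insert t T) {R C ε s : ℝ} (hR : 0 < R) (hε : 0 ≤ ε) (hs : 0 < s)
    (hC : ∀ z, ‖dbar (cut R) z‖ ≤ C / R) {g : ℂ → ℂ}
    (hg : ∀ z, g z = dbar (cut R) z * (if i = t then cauchyReg s z else 1))
    {H : (ι → ℂ) × (κ → ℝ) → ℂ}
    (hH : ∀ y, R ≤ ‖y‖ → ‖H y‖ * R ^ (Fintype.card κ + 2 * T.card) ≤ ε) :
    ‖∫ y, prodWeight (Function.update (kernelWeight T t R s) i g) (cutReal R) y *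
      H (planeProj (insert t T) y)‖ ≤ ε * C * errorConst κ T t := by
  have hgi : ∀ z, ‖g z‖ ≤ C / R * errorWeight T t R i z := by
    intro z
    have hd := norm_dbar_cut_le_indicator hR z (hC z)
    rw [hg]
    by_cases h : i = t
    · subst h
      simpa [errorWeight, ht] using norm_mul_cauchyReg_le_indicator hs hd
    · have hiT := (Finset.mem_insert.mp hi).resolve_left h
      simpa [errorWeight, hiT, h] using hd
  have hq : ∀ q ≠ i, ∀ z,
      ‖Function.update (kernelWeight T t R s) i g q z‖ ≤ errorWeight T t R q z := by
    intro q hq z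
    rw [Function.update_of_ne hq]
    by_cases h : q = t
    · subst h
      have := norm_mul_cauchyReg_le_indicator hs (u := cut R z) (B := 1)
        (by simpa using norm_cut_le_indicator hR z)
      simpa [kernelWeight, errorWeight, ht] using this
    · rw [kernelWeight, Function.update_of_ne h]
      exact norm_planeWeight_le hR h z
  refine norm_integral_error_le ht hR hε
    (norm_prod_le_of_forall_ne i hq (by simpa using hgi)) (norm_cutReal_le_indicator hR) ?_ hH
  intro y hy
  refine Finset.prod_eq_zero (Finset.mem_univ i) ?_
  rw [Function.update_self, hg, dbar_cut_eq_zero_of_lt hR, zero_mul]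
  exact (le_norm_planeProj _ hi y).trans_lt hy

/-! ### The localization step -/

theorem admissible_kernelWeight {T : Finset ι} {t : ι} {R s : ℝ} (hR : 0 < R) (hs : 0 < s) :
    AdmissibleWeight (insert t T) (2 * R) (kernelWeight T t R s) (cutReal R : (κ → ℝ) → ℂ) :=
  (admissible_planeWeight (insert t T) hR).update t
    ((contDiff_cut R).continuous.mul (contDiff_cauchyReg hs).continuous) fun z hz => by
      rw [cut_eq_zero hR hz, zero_mul]

theorem prodWeight_kernelWeight (T : Finset ι) (t : ι) (R s : ℝ) (y : (ι → ℂ) × (κ → ℝ)) :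
    prodWeight (kernelWeight T t R s) (cutReal R) y =
      prodWeight (planeWeight (insert t T) R) (cutReal R) y * cauchyReg s (y.1 t) := by
  rw [kernelWeight, prodWeight_update, prodWeight, ← Finset.mul_prod_erase _ _ (Finset.mem_univ t)]
  have : planeWeight (insert t T) R t (y.1 t) = cut R (y.1 t) := by simp [planeWeight]
  rw [this]
  ring

theorem dbar_kernelWeight_self (T : Finset ι) (t : ι) (R : ℝ) {s : ℝ} (hs : 0 < s) (z : ℂ) :
    dbar (kernelWeight T t R s t) z =
      dbar (cut R) z * cauchyReg s z + cut R z * dbar (cauchyReg s) z := by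
  rw [kernelWeight, Function.update_self]
  exact dbar_mul ((contDiff_cut R).differentiable one_ne_zero z)
    ((contDiff_cauchyReg hs).differentiable one_ne_zero z)

theorem kernelWeight_of_mem {T : Finset ι} {t i : ι} (ht : t ∉ T) (hi : i ∈ T) (R s : ℝ) :
    kernelWeight T t R s i = cut R := by
  have : i ≠ t := fun h => ht (h ▸ hi)
  rw [kernelWeight, Function.update_of_ne this]
  simp [planeWeight, hi]

/-- The identity `y_t G = κ₀ ∂̄_t G' + ∑ c ∂̄_i h`, integrated against the weight with the Cauchy
kernel in `y_t`.  After integration by parts the kernel turns `y_t G` into `G` and `∂̄_t G'` into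
the values of `G'` near `y_t = 0`, and all else contains a derivative of a cutoff. -/
theorem norm_kernel_identity_le {σ : Type} [Fintype σ] {T : Finset ι} {t : ι} (ht : t ∉ T)
    {G G' : (ι → ℂ) × (κ → ℝ) → ℂ} {κ₀ : ℂ} {i : σ → ι} {c : σ → ℂ}
    {h : σ → (ι → ℂ) × (κ → ℝ) → ℂ} (hG' : ContDiff ℝ 1 G')
    (hi : ∀ k, c k ≠ 0 → i k ∈ T) (hh : ∀ k, ContDiff ℝ 1 (h k))
    (hid : ∀ y : (ι → ℂ) × (κ → ℝ), (∀ q ∉ insert t T, y.1 q = 0) →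
      y.1 t * G y = κ₀ * dbarAt t G' y + ∑ k, c k * dbarAt (i k) (h k) y)
    {R s C ε : ℝ} (hR : 0 < R) (hs : 0 < s) (hε : 0 ≤ ε)
    (hC : ∀ z, ‖dbar (cut R) z‖ ≤ C / R)
    (hbG : ∀ y, R ≤ ‖y‖ → ‖G' y‖ * R ^ (Fintype.card κ + 2 * T.card) ≤ ε)
    (hbh : ∀ k, c k ≠ 0 → ∀ y, R ≤ ‖y‖ → ‖h k y‖ * R ^ (Fintype.card κ + 2 * T.card) ≤ ε) :
    ‖(∫ y, prodWeight (planeWeight (insert t T) R) (cutReal R) y * G (planeProj (insert t T) y) *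
        (y.1 t * cauchyReg s (y.1 t))) +
      κ₀ * ∫ y, prodWeight (Function.update (planeWeight (insert t T) R) t
        fun z => cut R z * dbar (cauchyReg s) z) (cutReal R) y * G' (planeProj (insert t T) y)‖ ≤
      (‖κ₀‖ + ∑ k, ‖c k‖) * (ε * C * errorConst κ T t) := by
  set W := kernelWeight T t R s with hW
  set P : (ι → ℂ) × (κ → ℝ) → (ι → ℂ) × (κ → ℝ) := planeProj (insert t T) with hP
  have hadm : AdmissibleWeight (insert t T) (2 * R) W (cutReal R : (κ → ℝ) → ℂ) :=
    admissible_kernelWeight hR hs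
  have htT : t ∈ insert t T := Finset.mem_insert_self t T
  have hWt : ContDiff ℝ 1 (W t) := by
    rw [hW, kernelWeight, Function.update_self]
    exact (contDiff_cut R).mul (contDiff_cauchyReg hs)
  -- the error terms
  set A := ∫ y, prodWeight (Function.update W t fun z => dbar (cut R) z * cauchyReg s z)
    (cutReal R) y * G' (P y) with hA
  set B : σ → ℂ := fun k => ∫ y, prodWeight (Function.update W (i k) (dbar (cut R)))
    (cutReal R) y * h k (P y) with hB
  set D := ∫ y, prodWeight (Function.update (planeWeight (insert t T) R) t
    fun z => cut R z * dbar (cauchyReg s) z) (cutReal R) y * G' (P y) with hD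
  have hdc := continuous_dbar (contDiff_cut R)
  have hdK := continuous_dbar (contDiff_cauchyReg hs)
  have hA' : ∫ y, prodWeight W (cutReal R) y * dbarAt t G' (P y) = -(A + D) := by
    rw [integral_mul_dbarAt hadm htT hWt hG', hA, hD, ← integral_add]
    · congr 2
      funext y
      simp only [prodWeight_update, dbar_kernelWeight_self T t R hs, hW]
      have : ∏ q ∈ Finset.univ.erase t, kernelWeight T t R s q (y.1 q) =
          ∏ q ∈ Finset.univ.erase t, planeWeight (insert t T) R q (y.1 q) :=
        Finset.prod_congr rfl fun q hq => by
          rw [kernelWeight, Function.update_of_ne (Finset.ne_of_mem_erase hq)]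
      rw [this]
      ring
    · refine (hadm.update t (hdc.mul (contDiff_cauchyReg hs).continuous) fun z hz => ?_
        ).integrable_mul hG'.continuous
      rw [Pi.mul_apply, dbar_eq_zero_of_support (fun z hz => cut_eq_zero hR hz) hz, zero_mul]
    · refine ((admissible_planeWeight (insert t T) hR).update t
        ((contDiff_cut R).continuous.mul hdK) fun z hz => ?_).integrable_mul hG'.continuous
      rw [Pi.mul_apply, cut_eq_zero hR hz, zero_mul]
  have hB' : ∀ k, c k * ∫ y, prodWeight W (cutReal R) y * dbarAt (i k) (h k) (P y) =
      -(c k * B k) := by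
    intro k
    by_cases hc : c k = 0
    · simp [hc]
    · have hik := hi k hc
      have hWi : W (i k) = cut R := kernelWeight_of_mem ht hik R s
      rw [integral_mul_dbarAt hadm (Finset.mem_insert_of_mem hik)
        (by rw [hWi]; exact contDiff_cut R) (hh k), hWi, mul_neg]
  have hintd : ∀ (q : ι) {g : (ι → ℂ) × (κ → ℝ) → ℂ}, ContDiff ℝ 1 g →
      Integrable fun y => prodWeight W (cutReal R) y * dbarAt q g (P y) := by
    intro q g hg
    have hcg := hg.continuous_fderiv one_ne_zero
    exact hadm.integrable_mul (by unfold dbarAt; fun_prop)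
  have hmain : ∫ y, prodWeight (planeWeight (insert t T) R) (cutReal R) y * G (P y) *
        (y.1 t * cauchyReg s (y.1 t)) = -(κ₀ * (A + D)) - ∑ k, c k * B k := by
    have e1 : (fun y => prodWeight (planeWeight (insert t T) R) (cutReal R) y * G (P y) *
        (y.1 t * cauchyReg s (y.1 t))) = fun y =>
        κ₀ * (prodWeight W (cutReal R) y * dbarAt t G' (P y)) +
          ∑ k, c k * (prodWeight W (cutReal R) y * dbarAt (i k) (h k) (P y)) := by
      funext y
      have hy := hid (P y) fun q hq => by simp only [hP, planeProj, hq, if_false]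
      have hyt : (P y).1 t = y.1 t := by simp only [hP, planeProj, htT, if_true]
      have hsum : ∑ k, c k * (prodWeight W (cutReal R) y * dbarAt (i k) (h k) (P y)) =
          prodWeight W (cutReal R) y * ∑ k, c k * dbarAt (i k) (h k) (P y) := by
        rw [Finset.mul_sum]
        exact Finset.sum_congr rfl fun k _ => by ring
      calc _ = prodWeight W (cutReal R) y * ((P y).1 t * G (P y)) := by
            rw [hyt, hW, prodWeight_kernelWeight]; ring
        _ = _ := by rw [hy, hsum]; ring
    rw [e1, integral_add ((hintd t hG').const_mul _)
      (integrable_finsetSum _ fun k _ => (hintd (i k) (hh k)).const_mul _),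
      integral_const_mul, hA', integral_finsetSum _ fun k _ => (hintd (i k) (hh k)).const_mul _]
    simp only [integral_const_mul, hB', Finset.sum_neg_distrib]
    ring
  have hAb : ‖A‖ ≤ ε * C * errorConst κ T t :=
    norm_integral_kernel_error_le ht htT hR hε hs hC (fun z => by simp) hbG
  have hBb : ∀ k, ‖c k * B k‖ ≤ ‖c k‖ * (ε * C * errorConst κ T t) := by
    intro k
    rw [norm_mul]
    by_cases hc : c k = 0
    · simp [hc]
    · have hne : i k ≠ t := fun h => ht (h ▸ hi k hc)
      refine mul_le_mul_of_nonneg_left ?_ (norm_nonneg _)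
      exact norm_integral_kernel_error_le ht (Finset.mem_insert_of_mem (hi k hc)) hR hε hs hC
        (fun z => by simp [hne]) (hbh k hc)
  have hfin : (∫ y, prodWeight (planeWeight (insert t T) R) (cutReal R) y * G (P y) *
        (y.1 t * cauchyReg s (y.1 t))) + κ₀ * D = -(κ₀ * A + ∑ k, c k * B k) := by
    rw [hmain]; ring
  rw [hfin, norm_neg, add_mul, Finset.sum_mul]
  refine (norm_add_le _ _).trans (add_le_add ?_ ((norm_sum_le _ _).trans
    (Finset.sum_le_sum fun k _ => hBb k)))
  rw [norm_mul]
  exact mul_le_mul_of_nonneg_left hAb (norm_nonneg _)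

/-- Localization of the integral over the plane of `insert t T` to that over the plane of `T`: at
fixed cutoff the regularization of the Cauchy kernel is removed, then the cutoff. -/
theorem tendsto_planeIntegral_add {σ : Type} [Fintype σ] {T : Finset ι} {t : ι} (ht : t ∉ T)
    {G G' : (ι → ℂ) × (κ → ℝ) → ℂ} {κ₀ : ℂ} {i : σ → ι} {c : σ → ℂ}
    {h : σ → (ι → ℂ) × (κ → ℝ) → ℂ} (hG : Continuous G) (hG' : ContDiff ℝ 1 G')
    (hi : ∀ k, c k ≠ 0 → i k ∈ T) (hh : ∀ k, ContDiff ℝ 1 (h k))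
    (hid : ∀ y : (ι → ℂ) × (κ → ℝ), (∀ q ∉ insert t T, y.1 q = 0) →
      y.1 t * G y = κ₀ * dbarAt t G' y + ∑ k, c k * dbarAt (i k) (h k) y)
    (hdG : Decays (Fintype.card κ + 2 * T.card) G')
    (hdh : ∀ k, c k ≠ 0 → Decays (Fintype.card κ + 2 * T.card) (h k)) :
    Tendsto (fun R => planeIntegral (insert t T) R G + κ₀ * planeIntegral T R G') atTop (𝓝 0) := by
  obtain ⟨C, hC0, hC⟩ := exists_norm_dbar_cut_le
  set K := (‖κ₀‖ + ∑ k, ‖c k‖) * (C * errorConst κ T t) with hK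
  rw [Metric.tendsto_atTop]
  intro δ hδ
  set ε := δ / (2 * (|K| + 1)) with hε
  have hεpos : 0 < ε := by positivity
  obtain ⟨R₁, h1⟩ := hdG.exists_bound hεpos
  have h2 : ∀ k, ∃ R₀, c k ≠ 0 → ∀ R, R₀ ≤ R → 0 < R → ∀ y, R ≤ ‖y‖ →
      ‖h k y‖ * R ^ (Fintype.card κ + 2 * T.card) ≤ ε := by
    intro k
    by_cases hc : c k = 0
    · exact ⟨0, fun h => absurd hc h⟩
    · obtain ⟨R₀, h⟩ := (hdh k hc).exists_bound hεpos
      exact ⟨R₀, fun _ => h⟩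
  choose ρ hρ using h2
  have hev : ∀ᶠ R : ℝ in atTop, R₁ ≤ R ∧ 0 < R ∧ ∀ k, ρ k ≤ R :=
    (eventually_ge_atTop R₁).and ((eventually_gt_atTop 0).and
      (eventually_all.mpr fun k => eventually_ge_atTop (ρ k)))
  obtain ⟨R₂, hR₂⟩ := eventually_atTop.mp hev
  refine ⟨R₂, fun R hR => ?_⟩
  obtain ⟨hR1, hR0, hRk⟩ := hR₂ R hR
  have hbound : ‖planeIntegral (insert t T) R G + κ₀ * planeIntegral T R G'‖ ≤
      (‖κ₀‖ + ∑ k, ‖c k‖) * (ε * C * errorConst κ T t) := by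
    refine le_of_tendsto (((tendsto_integral_mul_cauchyReg t hR0 hG).add
      ((tendsto_integral_dbar_cauchyReg ht hR0 hG'.continuous).const_mul κ₀)).norm) ?_
    filter_upwards [self_mem_nhdsWithin] with s hs
    exact norm_kernel_identity_le ht hG' hi hh hid hR0 hs hεpos.le (hC R hR0)
      (h1 R hR1 hR0) fun k hk => hρ k hk R (hRk k) hR0
  rw [dist_zero_right]
  refine hbound.trans_lt ?_
  calc (‖κ₀‖ + ∑ k, ‖c k‖) * (ε * C * errorConst κ T t) = ε * K := by rw [hK]; ring
    _ ≤ ε * (|K| + 1) := by gcongr; linarith [le_abs_self K]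
    _ = δ / 2 := by rw [hε]; field_simp
    _ < δ := by linarith

/-! ### Iteration of the localization step -/

theorem tendsto_cut_atTop (z : ℂ) : Tendsto (fun R => cut R z) atTop (𝓝 1) := by
  refine tendsto_const_nhds.congr' ?_
  filter_upwards [eventually_gt_atTop 0, eventually_ge_atTop ‖z‖] with R h0 h1
  exact (cut_eq_one h0 h1).symm

theorem tendsto_cutReal_atTop (Y : κ → ℝ) : Tendsto (fun R => cutReal R Y) atTop (𝓝 1) := by
  refine tendsto_const_nhds.congr' ?_
  filter_upwards [eventually_gt_atTop 0, eventually_ge_atTop ‖Y‖] with R h0 h1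
  exact (cutReal_eq_one h0 h1).symm

theorem tendsto_planeIntegral_univ {G : (ι → ℂ) × (κ → ℝ) → ℂ} (hG : Integrable G) :
    Tendsto (fun R => planeIntegral Finset.univ R G) atTop (𝓝 (∫ y, G y)) := by
  have hP : ∀ y : (ι → ℂ) × (κ → ℝ), planeProj Finset.univ y = y := fun y =>
    Prod.ext (funext fun q => by simp [planeProj]) rfl
  have hw : ∀ R (y : (ι → ℂ) × (κ → ℝ)), prodWeight (planeWeight Finset.univ R) (cutReal R) y =
      (∏ q, cut R (y.1 q)) * cutReal R y.2 := fun R y => by simp [prodWeight, planeWeight]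
  unfold planeIntegral
  simp only [hP, hw]
  refine tendsto_integral_filter_of_dominated_convergence (fun y => ‖G y‖) ?_ ?_ hG.norm ?_
  · refine Eventually.of_forall fun R => Continuous.aestronglyMeasurable ?_ |>.mul hG.1
    refine Continuous.mul (continuous_finsetProd _ fun q _ => ?_)
      ((continuous_cutReal R).comp continuous_snd)
    exact (contDiff_cut R).continuous.comp ((continuous_apply q).comp continuous_fst)
  · refine Eventually.of_forall fun R => Eventually.of_forall fun y => ?_
    rw [norm_mul, norm_mul, norm_prod]
    refine mul_le_of_le_one_left (norm_nonneg _) (mul_le_one₀ ?_ (norm_nonneg _)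
      (norm_cutReal_le _ _))
    exact Finset.prod_le_one (fun _ _ => norm_nonneg _) fun q _ => norm_cut_le _ _
  · refine Eventually.of_forall fun y => ?_
    have h := ((tendsto_finsetProd Finset.univ fun q _ => tendsto_cut_atTop (y.1 q)).mul
      (tendsto_cutReal_atTop y.2)).mul_const (G y)
    simpa using h

theorem tendsto_planeIntegral_empty {G : (ι → ℂ) × (κ → ℝ) → ℂ}
    (hG : Integrable fun Y : κ → ℝ => G (0, Y)) :
    Tendsto (fun R => planeIntegral ∅ R G) atTop
      (𝓝 ((Real.pi : ℂ) ^ Fintype.card ι * ∫ Y : κ → ℝ, G (0, Y))) := by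
  have h : ∀ R, planeIntegral ∅ R G =
      (Real.pi : ℂ) ^ Fintype.card ι * ∫ Y : κ → ℝ, cutReal R Y * G (0, Y) := by
    intro R
    have e : ∀ y : (ι → ℂ) × (κ → ℝ), prodWeight (planeWeight ∅ R) (cutReal R) y *
        G (planeProj ∅ y) = prodWeight (fun _ z => (bubble z : ℂ))
          (fun Y => cutReal R Y * G (0, Y)) y := by
      intro y
      have : planeProj ∅ y = (0, y.2) := Prod.ext (funext fun q => by simp [planeProj]) rfl
      rw [this]
      simp only [prodWeight, planeWeight, Finset.notMem_empty, if_false, mul_assoc]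
    unfold planeIntegral
    rw [integral_congr_ae (Eventually.of_forall e), integral_prodWeight]
    simp [integral_complex_ofReal, integral_bubble]
  simp only [h]
  refine Tendsto.const_mul _ ?_
  refine tendsto_integral_filter_of_dominated_convergence (fun y => ‖G (0, y)‖) ?_ ?_ hG.norm ?_
  · exact Eventually.of_forall fun R => (continuous_cutReal R).aestronglyMeasurable.mul hG.1
  · refine Eventually.of_forall fun R => Eventually.of_forall fun y => ?_
    rw [norm_mul]
    exact mul_le_of_le_one_left (norm_nonneg _) (norm_cutReal_le _ _)
  · refine Eventually.of_forall fun y => ?_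
    simpa using (tendsto_cutReal_atTop y).mul_const (G (0, y))

/-- Iterated localization: along a list of all the complex coordinates, the integral over the full
space reduces to that over the real coordinates. -/
theorem integral_eq_of_localization {l₀ : List ι} (hnd : l₀.Nodup) (hall : ∀ q, q ∈ l₀)
    {g : Finset ι → (ι → ℂ) × (κ → ℝ) → ℂ} {κ₀ : ι → ℂ}
    (hstep : ∀ (l₁ l₂ : List ι) (t : ι), l₀ = l₁ ++ t :: l₂ →
      Tendsto (fun R => planeIntegral (t :: l₂).toFinset R (g (t :: l₂).toFinset) -
        κ₀ t * planeIntegral l₂.toFinset R (g l₂.toFinset)) atTop (𝓝 0))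
    (htop : Integrable (g Finset.univ)) (hbot : Integrable fun Y : κ → ℝ => g ∅ (0, Y)) :
    ∫ y, g Finset.univ y =
      (∏ q, κ₀ q) * ((Real.pi : ℂ) ^ Fintype.card ι * ∫ Y : κ → ℝ, g ∅ (0, Y)) := by
  have hind : ∀ (l₂ l₁ : List ι), l₀ = l₁ ++ l₂ →
      Tendsto (fun R => planeIntegral l₂.toFinset R (g l₂.toFinset)) atTop
        (𝓝 ((l₂.map κ₀).prod *
          ((Real.pi : ℂ) ^ Fintype.card ι * ∫ Y : κ → ℝ, g ∅ (0, Y)))) := by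
    intro l₂
    induction l₂ with
    | nil =>
      intro l₁ _
      simpa using tendsto_planeIntegral_empty hbot
    | cons t l₂ ih =>
      intro l₁ hl
      have h := (hstep l₁ l₂ t hl).add ((ih (l₁ ++ [t]) (by simpa using hl)).const_mul (κ₀ t))
      simpa [mul_assoc] using h
  have huniv : l₀.toFinset = Finset.univ := Finset.eq_univ_of_forall fun q => by simpa using hall q
  have h := hind l₀ [] rfl
  rw [huniv] at h
  rw [tendsto_nhds_unique (tendsto_planeIntegral_univ htop) h, ← huniv,
    List.prod_toFinset κ₀ hnd]

end SuperInt

end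

noncomputable section

namespace SuperInt

open MeasureTheory Filter Topology

set_option linter.unusedSectionVars false

variable {k₁ k₂ : ℕ}

/-! ### Coordinates adapted to an odd rotation -/

theorem sum_mul_single {α : Type} [Fintype α] [DecidableEq α] (V : α → ℂ) (r : α) :
    ∑ p, V p * ((Pi.single p 1 : α → ℝ) r : ℂ) = V r := by
  rw [Finset.sum_eq_single r]
  · simp
  · intro p _ hp
    simp [Pi.single_eq_of_ne' hp]
  · simp

theorem conj_hermMatrix {k : ℕ} (a : Fin k × Fin k → ℝ) (n m : Fin k) :
    starRingEnd ℂ (hermMatrix (fun p => (a p : ℂ)) n m) = hermMatrix (fun p => (a p : ℂ)) m n := by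
  rcases lt_trichotomy n m with h | h | h
  · simp [hermMatrix, h, h.not_gt, sub_eq_add_neg]
  · subst h; simp [hermMatrix]
  · simp [hermMatrix, h, h.not_gt]

theorem sum_mul_bosonBlock (V : EvenIdx k₁ k₂ → ℂ) (n m : Fin k₁) :
    ∑ p, V p * bosonBlock (Pi.single p 1) n m = hermMatrix (fun p => V (Sum.inl p)) n m := by
  have h := sum_mul_single V
  rcases lt_trichotomy n m with hnm | hnm | hnm
  · simp only [bosonBlock, hermMatrix, Matrix.of_apply, hnm, if_true, smul_eq_mul, mul_add,
      mul_left_comm _ Complex.I, Finset.sum_add_distrib, ← Finset.mul_sum, h]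
  · subst hnm; simp only [bosonBlock, hermMatrix, Matrix.of_apply, lt_irrefl, if_false, h]
  · simp only [bosonBlock, hermMatrix, Matrix.of_apply, hnm, hnm.not_gt, if_true, if_false,
      smul_eq_mul, mul_sub, mul_left_comm _ Complex.I, Finset.sum_sub_distrib, ← Finset.mul_sum, h]

theorem sum_mul_fermionBlock (V : EvenIdx k₁ k₂ → ℂ) (n m : Fin k₂) :
    ∑ p, V p * fermionBlock (Pi.single p 1) n m = hermMatrix (fun p => V (Sum.inr p)) n m := by
  have h := sum_mul_single V
  rcases lt_trichotomy n m with hnm | hnm | hnm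
  · simp only [fermionBlock, hermMatrix, Matrix.of_apply, hnm, if_true, smul_eq_mul, mul_add,
      mul_left_comm _ Complex.I, Finset.sum_add_distrib, ← Finset.mul_sum, h]
  · subst hnm; simp only [fermionBlock, hermMatrix, Matrix.of_apply, lt_irrefl, if_false, h]
  · simp only [fermionBlock, hermMatrix, Matrix.of_apply, hnm, hnm.not_gt, if_true, if_false,
      smul_eq_mul, mul_sub, mul_left_comm _ Complex.I, Finset.sum_sub_distrib, ← Finset.mul_sum, h]

/-- The complex linear extension of `upperVariation`. -/
theorem sum_mul_upperVariation (ψ : ℝ) (b : Fin k₁ → Fin k₂ → ℝ) (V : EvenIdx k₁ k₂ → ℂ)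
    (i : Fin k₁) (j : Fin k₂) :
    ∑ p, V p * upperVariation ψ b (Pi.single p 1) i j =
      ∑ l, hermMatrix (fun p => V (Sum.inl p)) i l * b l j -
        halfPhase ψ ^ 2 * ∑ l, b i l * hermMatrix (fun p => V (Sum.inr p)) l j := by
  simp only [upperVariation, mul_sub, Finset.mul_sum, Finset.sum_sub_distrib,
    ← sum_mul_bosonBlock, ← sum_mul_fermionBlock, Finset.sum_mul]
  rw [Finset.sum_comm, Finset.sum_comm (s := Finset.univ (α := Fin k₂))]
  congr 1
  · exact Finset.sum_congr rfl fun _ _ => Finset.sum_congr rfl fun _ _ => by ring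
  · exact Finset.sum_congr rfl fun _ _ => Finset.sum_congr rfl fun _ _ => by ring

theorem conj_halfPhase (ψ : ℝ) : starRingEnd ℂ (halfPhase ψ) = (halfPhase ψ)⁻¹ := by
  rw [halfPhase, ← Complex.exp_conj, ← Complex.exp_neg]
  congr 1
  simp [map_ofNat, neg_div]

/-- The complex linear extension of the conjugate of `upperVariation`. -/
theorem sum_mul_conj_upperVariation (ψ : ℝ) (b : Fin k₁ → Fin k₂ → ℝ) (V : EvenIdx k₁ k₂ → ℂ)
    (i : Fin k₁) (j : Fin k₂) :
    ∑ p, V p * starRingEnd ℂ (upperVariation ψ b (Pi.single p 1) i j) =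
      ∑ l, hermMatrix (fun p => V (Sum.inl p)) l i * b l j -
        (halfPhase ψ)⁻¹ ^ 2 * ∑ l, b i l * hermMatrix (fun p => V (Sum.inr p)) j l := by
  have h1 : ∀ (x : HermPair k₁ k₂) n m, starRingEnd ℂ (bosonBlock x n m) = bosonBlock x m n :=
    fun x => conj_hermMatrix _
  have h2 : ∀ (x : HermPair k₁ k₂) n m, starRingEnd ℂ (fermionBlock x n m) = fermionBlock x m n :=
    fun x => conj_hermMatrix _
  simp only [upperVariation, map_sub, map_sum, map_mul, map_pow, conj_halfPhase, h1, h2,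
    Complex.conj_ofReal, mul_sub, Finset.mul_sum, Finset.sum_sub_distrib,
    ← sum_mul_bosonBlock, ← sum_mul_fermionBlock, Finset.sum_mul]
  rw [Finset.sum_comm, Finset.sum_comm (s := Finset.univ (α := Fin k₂))]
  congr 1
  · exact Finset.sum_congr rfl fun _ _ => Finset.sum_congr rfl fun _ _ => by ring
  · exact Finset.sum_congr rfl fun _ _ => Finset.sum_congr rfl fun _ _ => by ring

section Pairing

variable {A B C : Type} [Fintype A] [Fintype B] [Fintype C] [DecidableEq A] [DecidableEq B]
  [DecidableEq C]
  (e₁ : A ⊕ C ≃ Fin k₁) (e₂ : B ⊕ C ≃ Fin k₂)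

/-- The matrix `b` that pairs the boson and the fermion indices with a common label in `C`. -/
def pairing (i : Fin k₁) (j : Fin k₂) : ℝ :=
  Sum.elim (fun _ => 0)
    (fun c => Sum.elim (fun _ => 0) (fun c' => if c = c' then 1 else 0) (e₂.symm j)) (e₁.symm i)

theorem sum_mul_pairing (F : Fin k₁ → ℂ) (v : B ⊕ C) :
    ∑ l, F l * pairing e₁ e₂ l (e₂ v) = Sum.elim (fun _ => 0) (fun c => F (e₁ (Sum.inr c))) v := by
  rw [← Equiv.sum_comp e₁, Fintype.sum_sum_type]
  rcases v with v | v
  · simp [pairing]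
  · simp only [pairing, Equiv.symm_apply_apply, Sum.elim_inl, Sum.elim_inr]
    rw [Finset.sum_eq_zero (by simp), zero_add, Finset.sum_eq_single v] <;> simp +contextual

theorem sum_pairing_mul (F : Fin k₂ → ℂ) (u : A ⊕ C) :
    ∑ l, (pairing e₁ e₂ (e₁ u) l : ℂ) * F l =
      Sum.elim (fun _ => 0) (fun c => F (e₂ (Sum.inr c))) u := by
  rw [← Equiv.sum_comp e₂, Fintype.sum_sum_type]
  rcases u with u | u
  · simp [pairing]
  · simp only [pairing, Equiv.symm_apply_apply, Sum.elim_inl, Sum.elim_inr]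
    rw [Finset.sum_eq_zero (by simp), zero_add, Finset.sum_eq_single u] <;>
      simp +contextual [eq_comm]

theorem pairing_inl_left (a : A) (j : Fin k₂) : pairing e₁ e₂ (e₁ (Sum.inl a)) j = 0 := by
  simp [pairing]

theorem pairing_inl_right (i : Fin k₁) (a : B) : pairing e₁ e₂ i (e₂ (Sum.inl a)) = 0 := by
  unfold pairing
  rcases e₁.symm i with u | u <;> simp

theorem pairing_inr_inr (c c' : C) :
    pairing e₁ e₂ (e₁ (Sum.inr c)) (e₂ (Sum.inr c')) = if c = c' then 1 else 0 := by
  simp [pairing]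

/-- The factor of `∂/∂m̄_q` in the derivative along `oddDirection`. -/
def dbarFactor (ψ : ℝ) (q : OddIdx k₁ k₂) : ℂ :=
  Sum.elim (fun _ => 0) (fun _ => -halfPhase ψ) (e₂.symm q.1) +
    Sum.elim (fun _ => 0) (fun _ => (halfPhase ψ)⁻¹ ^ 3) (e₁.symm q.2)

/-- The linear map to the coordinates: the odd variation of the boson-fermion block, and the
corners of the diagonal blocks that the pairing leaves out. -/
def coordMap (ψ : ℝ) : HermPair k₁ k₂ →ₗ[ℝ] (OddIdx k₁ k₂ → ℂ) × ((A × A) ⊕ (B × B) → ℝ) where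
  toFun x := (fun q => upperVariation ψ (pairing e₁ e₂) x q.2 q.1,
    Sum.elim (fun p => x (Sum.inl (e₁ (Sum.inl p.1), e₁ (Sum.inl p.2))))
      fun p => x (Sum.inr (e₂ (Sum.inl p.1), e₂ (Sum.inl p.2))))
  map_add' x y := by
    have h1 : bosonBlock (x + y) = bosonBlock x + bosonBlock y := by
      ext n m
      rw [Matrix.add_apply, bosonBlock, bosonBlock, bosonBlock, ← hermMatrix_add]
      simp
    have h2 : fermionBlock (x + y) = fermionBlock x + fermionBlock y := by
      ext n m
      rw [Matrix.add_apply, fermionBlock, fermionBlock, fermionBlock, ← hermMatrix_add]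
      simp
    refine Prod.ext (funext fun q => ?_) (funext fun w => ?_)
    · simp only [upperVariation, h1, h2, Matrix.add_apply, add_mul, mul_add,
        Finset.sum_add_distrib, Prod.fst_add, Pi.add_apply]
      ring
    · rcases w with w | w <;> simp
  map_smul' r x := by
    have h0 : ∀ {k : ℕ} (a : Fin k × Fin k → ℂ) n m,
        hermMatrix (fun p => (r : ℂ) * a p) n m = r * hermMatrix a n m := by
      intro k a n m
      simp only [hermMatrix, Matrix.of_apply, smul_eq_mul]
      split_ifs <;> ring
    have h1 : ∀ n m, bosonBlock (r • x) n m = r * bosonBlock x n m := fun n m => by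
      rw [bosonBlock, bosonBlock, ← h0]; simp
    have h2 : ∀ n m, fermionBlock (r • x) n m = r * fermionBlock x n m := fun n m => by
      rw [fermionBlock, fermionBlock, ← h0]; simp
    refine Prod.ext (funext fun q => ?_) (funext fun w => ?_)
    · simp only [upperVariation, h1, h2, RingHom.id_apply, Prod.smul_fst, Pi.smul_apply,
        Complex.real_smul, mul_sub, Finset.mul_sum]
      congr 1
      · exact Finset.sum_congr rfl fun _ _ => by ring
      · exact Finset.sum_congr rfl fun _ _ => by ring
    · rcases w with w | w <;> simp

theorem hermMatrix_oddDirection_inl (ψ : ℝ) (b : Fin k₁ → Fin k₂ → ℝ) (q : OddIdx k₁ k₂)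
    (n m : Fin k₁) : hermMatrix (fun p => oddDirection ψ b q (Sum.inl p)) n m =
      if m = q.2 then -(halfPhase ψ * b n q.1) else 0 := by
  have h := hermMatrix_hermCoord (A := ℂ) (V := ℂ) LinearMap.id
    (fun n m => if m = q.2 then -(halfPhase ψ * b n q.1) else 0) n m
  simpa only [oddDirection, Sum.elim_inl, LinearMap.id_apply] using h

theorem hermMatrix_oddDirection_inr (ψ : ℝ) (b : Fin k₁ → Fin k₂ → ℝ) (q : OddIdx k₁ k₂)
    (n m : Fin k₂) : hermMatrix (fun p => oddDirection ψ b q (Sum.inr p)) n m =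
      if n = q.1 then -((halfPhase ψ)⁻¹ * b q.2 m) else 0 := by
  have h := hermMatrix_hermCoord (A := ℂ) (V := ℂ) LinearMap.id
    (fun n m => if n = q.1 then -((halfPhase ψ)⁻¹ * b q.2 m) else 0) n m
  simpa only [oddDirection, Sum.elim_inr, LinearMap.id_apply] using h

/-- The square of the odd symmetry vanishes. -/
theorem oddDirection_upperVariation (ψ : ℝ) (b : Fin k₁ → Fin k₂ → ℝ) (q q' : OddIdx k₁ k₂) :
    ∑ p, oddDirection ψ b q p * upperVariation ψ b (Pi.single p 1) q'.2 q'.1 = 0 := by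
  have he := halfPhase_ne_zero ψ
  rw [sum_mul_upperVariation]
  simp only [hermMatrix_oddDirection_inl, hermMatrix_oddDirection_inr, ite_mul, mul_ite, zero_mul,
    mul_zero, Finset.sum_ite_eq', Finset.mem_univ, if_true]
  field_simp
  ring

/-- Along `oddDirection`, extended complex linearly, the only adapted coordinate that changes is the
conjugate of the one with the same label. -/
theorem oddDirection_conj_upperVariation (ψ : ℝ) (q q' : OddIdx k₁ k₂) :
    ∑ p, oddDirection ψ (pairing e₁ e₂) q p *
      starRingEnd ℂ (upperVariation ψ (pairing e₁ e₂) (Pi.single p 1) q'.2 q'.1) =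
      if q' = q then dbarFactor e₁ e₂ ψ q else 0 := by
  rw [sum_mul_conj_upperVariation]
  obtain ⟨j, i⟩ := q
  obtain ⟨j', i'⟩ := q'
  obtain ⟨u, rfl⟩ := e₁.surjective i
  obtain ⟨v, rfl⟩ := e₂.surjective j
  obtain ⟨u', rfl⟩ := e₁.surjective i'
  obtain ⟨v', rfl⟩ := e₂.surjective j'
  have h1 : ∑ l, (pairing e₁ e₂ l (e₂ v) : ℂ) * pairing e₁ e₂ l (e₂ v') =
      if v' = v then Sum.elim (fun _ => 0) (fun _ => 1) v else 0 := by
    rw [sum_mul_pairing e₁ e₂ (fun l => (pairing e₁ e₂ l (e₂ v) : ℂ))]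
    rcases v' with v' | v'
    · rcases v with v | v <;> simp
    · rcases v with v | v
      · simp [pairing]
      · by_cases h : v' = v <;> simp [pairing_inr_inr, h]
  have h2 : ∑ l, (pairing e₁ e₂ (e₁ u') l : ℂ) * pairing e₁ e₂ (e₁ u) l =
      if u' = u then Sum.elim (fun _ => 0) (fun _ => 1) u else 0 := by
    rw [sum_pairing_mul e₁ e₂ (fun l => (pairing e₁ e₂ (e₁ u) l : ℂ))]
    rcases u' with u' | u'
    · rcases u with u | u <;> simp
    · rcases u with u | u
      · simp [pairing]
      · by_cases h : u' = u <;> simp [pairing_inr_inr, h, eq_comm]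
  have e1 : ∑ l, hermMatrix (fun p => oddDirection ψ (pairing e₁ e₂) (e₂ v, e₁ u) (Sum.inl p)) l
      (e₁ u') * pairing e₁ e₂ l (e₂ v') = if u' = u then -halfPhase ψ * (if v' = v then
        Sum.elim (fun _ => 0) (fun _ => 1) v else 0) else 0 := by
    simp only [hermMatrix_oddDirection_inl, EmbeddingLike.apply_eq_iff_eq]
    by_cases hu : u' = u
    · simp only [hu, if_true]
      rw [← h1, Finset.mul_sum]
      exact Finset.sum_congr rfl fun _ _ => by ring
    · simp [hu]
  have e2 : ∑ l, (pairing e₁ e₂ (e₁ u') l : ℂ) *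
      hermMatrix (fun p => oddDirection ψ (pairing e₁ e₂) (e₂ v, e₁ u) (Sum.inr p)) (e₂ v') l =
      if v' = v then -(halfPhase ψ)⁻¹ * (if u' = u then
        Sum.elim (fun _ => 0) (fun _ => 1) u else 0) else 0 := by
    simp only [hermMatrix_oddDirection_inr, EmbeddingLike.apply_eq_iff_eq]
    by_cases hv : v' = v
    · simp only [hv, if_true]
      rw [← h2, Finset.mul_sum]
      exact Finset.sum_congr rfl fun _ _ => by ring
    · simp [hv]
  rw [e1, e2]
  by_cases hu : u' = u
  · by_cases hv : v' = v
    · subst hu hv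
      simp only [if_true, dbarFactor, Equiv.symm_apply_apply]
      rcases u' with u | u <;> rcases v' with v | v <;> simp <;> ring
    · simp [hv]
  · simp [hu]

theorem oddDirection_corner (ψ : ℝ) (q : OddIdx k₁ k₂) (w : (A × A) ⊕ (B × B)) :
    ∑ p, oddDirection ψ (pairing e₁ e₂) q p *
      ((coordMap e₁ e₂ ψ (Pi.single p 1)).2 w : ℂ) = 0 := by
  rcases w with w | w
  · simp only [coordMap, LinearMap.coe_mk, AddHom.coe_mk, Sum.elim_inl]
    rw [sum_mul_single (oddDirection ψ (pairing e₁ e₂) q)]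
    simp [oddDirection, hermCoord, pairing_inl_left]
  · simp only [coordMap, LinearMap.coe_mk, AddHom.coe_mk, Sum.elim_inr]
    rw [sum_mul_single (oddDirection ψ (pairing e₁ e₂) q)]
    simp [oddDirection, hermCoord, pairing_inl_right]

end Pairing

theorem continuousLinearMap_eq_sum_wirtinger {ι κ : Type} [Fintype ι] [DecidableEq ι] [Fintype κ]
    [DecidableEq κ] (D : ((ι → ℂ) × (κ → ℝ)) →L[ℝ] ℂ) (y : (ι → ℂ) × (κ → ℝ)) :
    D y = ∑ q, (y.1 q * ((1 / 2 : ℂ) * (D (Pi.single q 1, 0) -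
        Complex.I * D (Pi.single q Complex.I, 0))) +
      starRingEnd ℂ (y.1 q) * ((1 / 2 : ℂ) * (D (Pi.single q 1, 0) +
        Complex.I * D (Pi.single q Complex.I, 0)))) + ∑ w, (y.2 w : ℂ) * D (0, Pi.single w 1) := by
  have hy : y = ∑ q, ((y.1 q).re • ((Pi.single q 1, 0) : (ι → ℂ) × (κ → ℝ)) +
      (y.1 q).im • ((Pi.single q Complex.I, 0) : (ι → ℂ) × (κ → ℝ))) +
      ∑ w, y.2 w • ((0, Pi.single w 1) : (ι → ℂ) × (κ → ℝ)) := by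
    refine Prod.ext (funext fun q => ?_) (funext fun w => ?_)
    · simp [Prod.fst_sum, Finset.sum_apply, Pi.single_apply, Finset.sum_add_distrib]
    · simp [Prod.snd_sum, Finset.sum_apply, Pi.single_apply]
  conv_lhs => rw [hy]
  simp only [map_add, map_sum, map_smul, Complex.real_smul]
  congr 1
  refine Finset.sum_congr rfl fun q _ => ?_
  have h1 := Complex.re_eq_add_conj (y.1 q)
  have h2 := Complex.im_eq_sub_conj (y.1 q)
  rw [h1, h2]
  field_simp
  ring_nf
  simp only [Complex.I_sq]
  ring

/-- In the adapted coordinates the derivative along `oddDirection` is a multiple of `∂/∂m̄_q`. -/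
theorem oddDeriv_eq_dbarAt {A B C : Type} [Fintype A] [Fintype B] [Fintype C] [DecidableEq C]
    [DecidableEq A] [DecidableEq B]
    (e₁ : A ⊕ C ≃ Fin k₁) (e₂ : B ⊕ C ≃ Fin k₂) (ψ : ℝ)
    (L : HermPair k₁ k₂ ≃L[ℝ] (OddIdx k₁ k₂ → ℂ) × ((A × A) ⊕ (B × B) → ℝ))
    (hL : ∀ x, L x = coordMap e₁ e₂ ψ x) (q : OddIdx k₁ k₂) (f : HermPair k₁ k₂ → ℂ)
    (x : HermPair k₁ k₂) :
    oddDeriv ψ (pairing e₁ e₂) q f x =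
      dbarFactor e₁ e₂ ψ q * dbarAt q (fun y => f (L.symm y)) (L x) := by
  set D := fderiv ℝ (fun y => f (L.symm y)) (L x) with hD
  have hfD : ∀ v, fderiv ℝ f x v = D (coordMap e₁ e₂ ψ v) := by
    intro v
    have h := L.symm.comp_right_fderiv (f := f) (x := L x)
    have h' : D = (fderiv ℝ f (L.symm (L x))).comp (L.symm : _ →L[ℝ] _) := h
    rw [h', ← hL]
    simp
  unfold oddDeriv
  have hm : ∀ v q', (coordMap e₁ e₂ ψ v).1 q' = upperVariation ψ (pairing e₁ e₂) v q'.2 q'.1 :=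
    fun v q' => rfl
  simp only [hfD]
  calc _ = ∑ p, (∑ q', (oddDirection ψ (pairing e₁ e₂) q p *
          upperVariation ψ (pairing e₁ e₂) (Pi.single p 1) q'.2 q'.1 *
            ((1 / 2 : ℂ) * (D (Pi.single q' 1, 0) - Complex.I * D (Pi.single q' Complex.I, 0))) +
          oddDirection ψ (pairing e₁ e₂) q p *
            starRingEnd ℂ (upperVariation ψ (pairing e₁ e₂) (Pi.single p 1) q'.2 q'.1) *
            ((1 / 2 : ℂ) * (D (Pi.single q' 1, 0) + Complex.I * D (Pi.single q' Complex.I, 0)))) +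
        ∑ w, oddDirection ψ (pairing e₁ e₂) q p * ((coordMap e₁ e₂ ψ (Pi.single p 1)).2 w : ℂ) *
          D (0, Pi.single w 1)) := by
        refine Finset.sum_congr rfl fun p _ => ?_
        rw [continuousLinearMap_eq_sum_wirtinger D, mul_add, Finset.mul_sum, Finset.mul_sum]
        congr 1
        · exact Finset.sum_congr rfl fun q' _ => by rw [hm]; ring
        · exact Finset.sum_congr rfl fun w _ => by ring
    _ = ∑ q', ((∑ p, oddDirection ψ (pairing e₁ e₂) q p *
          upperVariation ψ (pairing e₁ e₂) (Pi.single p 1) q'.2 q'.1) *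
            ((1 / 2 : ℂ) * (D (Pi.single q' 1, 0) - Complex.I * D (Pi.single q' Complex.I, 0))) +
          (∑ p, oddDirection ψ (pairing e₁ e₂) q p *
            starRingEnd ℂ (upperVariation ψ (pairing e₁ e₂) (Pi.single p 1) q'.2 q'.1)) *
            ((1 / 2 : ℂ) * (D (Pi.single q' 1, 0) + Complex.I * D (Pi.single q' Complex.I, 0)))) +
        ∑ w, (∑ p, oddDirection ψ (pairing e₁ e₂) q p *
          ((coordMap e₁ e₂ ψ (Pi.single p 1)).2 w : ℂ)) * D (0, Pi.single w 1) := by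
        rw [Finset.sum_add_distrib, Finset.sum_comm]
        congr 1
        · exact Finset.sum_congr rfl fun q' _ => by
            rw [Finset.sum_add_distrib, Finset.sum_mul, Finset.sum_mul]
        · rw [Finset.sum_comm]
          exact Finset.sum_congr rfl fun w _ => by rw [Finset.sum_mul]
    _ = _ := by
        simp only [oddDirection_upperVariation, oddDirection_conj_upperVariation,
          oddDirection_corner, zero_mul, zero_add, Finset.sum_const_zero, add_zero, ite_mul,
          Finset.sum_ite_eq', Finset.mem_univ, if_true]
        rfl

/-! ### The Jacobian of the adapted coordinates -/

theorem norm_sq_hermMatrix {k : ℕ} (a : Fin k × Fin k → ℝ) (n m : Fin k) :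
    ‖hermMatrix (fun p => (a p : ℂ)) n m‖ ^ 2 =
      a (n, m) ^ 2 + if n = m then 0 else a (m, n) ^ 2 := by
  rw [← Complex.normSq_eq_norm_sq, Complex.normSq_apply]
  rcases lt_trichotomy n m with h | h | h
  · simp [hermMatrix, h, h.ne, sq]
  · subst h; simp [hermMatrix, sq]
  · simp [hermMatrix, h, h.ne', h.not_gt, sq]; ring

/-- For Hermitian `Z` and `H` the cross terms of `|Z - i s H|²` at transposed entries cancel. -/
theorem sum_norm_sub_sq {C : Type} [Fintype C] (Z H : C → C → ℂ)
    (hZ : ∀ c c', starRingEnd ℂ (Z c c') = Z c' c) (hH : ∀ c c', starRingEnd ℂ (H c c') = H c' c)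
    (s : ℝ) : ∑ c, ∑ c', ‖Z c c' - Complex.I * s * H c c'‖ ^ 2 =
      ∑ c, ∑ c', (‖Z c c'‖ ^ 2 + s ^ 2 * ‖H c c'‖ ^ 2) := by
  set τ : C → C → ℝ := fun c c' => 2 * s * (starRingEnd ℂ (Z c c') * H c c').im with hτ
  have h1 : ∀ c c', ‖Z c c' - Complex.I * s * H c c'‖ ^ 2 =
      (‖Z c c'‖ ^ 2 + s ^ 2 * ‖H c c'‖ ^ 2) + τ c c' := by
    intro c c'
    simp only [← Complex.normSq_eq_norm_sq, Complex.normSq_apply, hτ]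
    simp
    ring
  have h2 : ∀ c c', τ c c' = -τ c' c := by
    intro c c'
    have h : starRingEnd ℂ (starRingEnd ℂ (Z c' c) * H c' c) = starRingEnd ℂ (Z c c') * H c c' := by
      rw [map_mul, hZ, hZ, hH]
    simp only [hτ]
    rw [← h, Complex.conj_im]
    ring
  have h3 : ∑ c, ∑ c', τ c c' = 0 := by
    have h4 : ∑ c, ∑ c', τ c c' = -∑ c, ∑ c', τ c c' := by
      conv_lhs => rw [Finset.sum_comm]
      simp only [← Finset.sum_neg_distrib]
      exact Finset.sum_congr rfl fun c _ => Finset.sum_congr rfl fun c' _ => h2 _ _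
    linarith
  simp only [h1, Finset.sum_add_distrib] at h3 ⊢
  linarith

section Jacobian

variable {A B C : Type} [Fintype A] [Fintype B] [Fintype C]
  [DecidableEq A] [DecidableEq B] [DecidableEq C]
  (e₁ : A ⊕ C ≃ Fin k₁) (e₂ : B ⊕ C ≃ Fin k₂)

theorem upperVariation_pairing (ψ : ℝ) (x : HermPair k₁ k₂) (u : A ⊕ C) (v : B ⊕ C) :
    upperVariation ψ (pairing e₁ e₂) x (e₁ u) (e₂ v) =
      Sum.elim (fun _ => 0) (fun c => bosonBlock x (e₁ u) (e₁ (Sum.inr c))) v -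
        halfPhase ψ ^ 2 *
          Sum.elim (fun _ => 0) (fun c => fermionBlock x (e₂ (Sum.inr c)) (e₂ v)) u := by
  rw [upperVariation, sum_mul_pairing e₁ e₂ (fun l => bosonBlock x (e₁ u) l),
    sum_pairing_mul e₁ e₂ (fun l => fermionBlock x l (e₂ v))]

/-- The shear of the boson-boson block that decouples it from the fermion-fermion block. -/
def blockShear (ψ : ℝ) : Matrix (EvenIdx k₁ k₂) (EvenIdx k₁ k₂) ℝ :=
  Matrix.fromBlocks 1 (Matrix.of fun p p' =>
    Sum.elim (fun _ => 0) (fun c => Sum.elim (fun _ => 0) (fun c' =>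
      if p' = (e₂ (Sum.inr c), e₂ (Sum.inr c')) then -Real.cos ψ else 0)
        (e₁.symm p.2)) (e₁.symm p.1)) 0 1

theorem det_blockShear (ψ : ℝ) : (blockShear e₁ e₂ ψ).det = 1 := by
  rw [blockShear, Matrix.det_fromBlocks_zero₂₁]; simp

theorem blockShear_inl (ψ : ℝ) (x : HermPair k₁ k₂) (u u' : A ⊕ C) :
    Matrix.toLin' (blockShear e₁ e₂ ψ) x (Sum.inl (e₁ u, e₁ u')) = x (Sum.inl (e₁ u, e₁ u')) +
      Sum.elim (fun _ => 0) (fun c => Sum.elim (fun _ => 0) (fun c' =>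
        -Real.cos ψ * x (Sum.inr (e₂ (Sum.inr c), e₂ (Sum.inr c')))) u') u := by
  rw [Matrix.toLin'_apply, blockShear, Matrix.fromBlocks_mulVec, Sum.elim_inl, Pi.add_apply,
    Matrix.one_mulVec]
  congr 1
  rcases u with u | u <;> rcases u' with u' | u' <;> simp [Matrix.mulVec, dotProduct]

theorem blockShear_inr (ψ : ℝ) (x : HermPair k₁ k₂) (p : Fin k₂ × Fin k₂) :
    Matrix.toLin' (blockShear e₁ e₂ ψ) x (Sum.inr p) = x (Sum.inr p) := by
  rw [Matrix.toLin'_apply, blockShear, Matrix.fromBlocks_mulVec, Sum.elim_inr, Pi.add_apply,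
    Matrix.one_mulVec, Matrix.zero_mulVec]
  simp

/-- The coefficient of a real coordinate of one block in the quadratic form, `s` for the diagonal
and `2 s` for the off-diagonal entries of the common subblock. -/
def commonCoeff {A C : Type} [DecidableEq C] (s : ℝ) (u u' : A ⊕ C) : ℝ :=
  Sum.elim (fun _ => 1) (fun c => Sum.elim (fun _ => 1) (fun c' =>
    if c = c' then s else 2 * s) u') u

/-- The coefficients of the quadratic form in the sheared coordinates. -/
def jacobianCoeff (ψ : ℝ) : EvenIdx k₁ k₂ → ℝ :=
  Sum.elim (fun p => commonCoeff 1 (e₁.symm p.1) (e₁.symm p.2))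
    (fun p => commonCoeff (Real.sin ψ ^ 2) (e₂.symm p.1) (e₂.symm p.2))

/-- Each off-diagonal coordinate enters the entries `(n, m)` and `(m, n)` of the Hermitian matrix:
both are present in the common subblock, and one of them next to it. -/
theorem sum_commonCoeff {A C : Type} [Fintype A] [Fintype C] [DecidableEq C] {k : ℕ}
    (e : A ⊕ C ≃ Fin k) (s : ℝ) (a : Fin k × Fin k → ℝ) :
    ∑ p, commonCoeff s (e.symm p.1) (e.symm p.2) * a p ^ 2 =
      ∑ p : A × A, a (e (Sum.inl p.1), e (Sum.inl p.2)) ^ 2 +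
      ∑ p : A, ∑ c : C, ‖hermMatrix (fun p => (a p : ℂ)) (e (Sum.inl p)) (e (Sum.inr c))‖ ^ 2 +
      ∑ c : C, ∑ c' : C,
        s * ‖hermMatrix (fun p => (a p : ℂ)) (e (Sum.inr c)) (e (Sum.inr c'))‖ ^ 2 := by
  have h1 : ∑ p, commonCoeff s (e.symm p.1) (e.symm p.2) * a p ^ 2 =
      ∑ u, ∑ u', commonCoeff s u u' * a (e u, e u') ^ 2 := by
    rw [Fintype.sum_prod_type, ← Equiv.sum_comp e]
    refine Finset.sum_congr rfl fun u _ => ?_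
    rw [← Equiv.sum_comp e]
    simp
  have h2 : ∑ c : C, ∑ c' : C,
      s * (if c = c' then 0 else a (e (Sum.inr c'), e (Sum.inr c)) ^ 2) = ∑ c : C, ∑ c' : C,
      s * (if c = c' then 0 else a (e (Sum.inr c), e (Sum.inr c')) ^ 2) := by
    rw [Finset.sum_comm]
    simp only [eq_comm]
  have h3 : ∑ c : C, ∑ c' : C, commonCoeff (A := A) s (Sum.inr c) (Sum.inr c') *
      a (e (Sum.inr c), e (Sum.inr c')) ^ 2 =
      ∑ c : C, ∑ c' : C, s * a (e (Sum.inr c), e (Sum.inr c')) ^ 2 + ∑ c : C, ∑ c' : C,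
        s * (if c = c' then 0 else a (e (Sum.inr c), e (Sum.inr c')) ^ 2) := by
    simp only [← Finset.sum_add_distrib]
    refine Finset.sum_congr rfl fun c _ => Finset.sum_congr rfl fun c' _ => ?_
    by_cases h : c = c'
    · simp [commonCoeff, h]
    · simp [commonCoeff, h]; ring
  rw [h1]
  simp only [Fintype.sum_sum_type, norm_sq_hermMatrix, EmbeddingLike.apply_eq_iff_eq,
    reduceCtorEq, if_false, Sum.inr.injEq, Finset.sum_add_distrib, mul_add, h2, h3,
    Fintype.sum_prod_type]
  rw [Finset.sum_comm (s := Finset.univ (α := A)) (t := Finset.univ (α := C))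
    (f := fun p c => a (e (Sum.inr c), e (Sum.inl p)) ^ 2)]
  simp only [commonCoeff, Sum.elim_inl, Sum.elim_inr, one_mul]
  ring

/-- The quadratic form `∑ |m|² + ∑ Y²` of the adapted coordinates is diagonal in the sheared
coordinates. -/
theorem sum_sq_coordMap (ψ : ℝ)
    (hord : ∀ c c', e₁ (Sum.inr c) < e₁ (Sum.inr c') ↔ e₂ (Sum.inr c) < e₂ (Sum.inr c'))
    (x : HermPair k₁ k₂) :
    ∑ q, ‖(coordMap e₁ e₂ ψ x).1 q‖ ^ 2 + ∑ w, (coordMap e₁ e₂ ψ x).2 w ^ 2 =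
      ∑ p, jacobianCoeff e₁ e₂ ψ p * Matrix.toLin' (blockShear e₁ e₂ ψ) x p ^ 2 := by
  set z := Matrix.toLin' (blockShear e₁ e₂ ψ) x with hz
  set Z : C → C → ℂ := fun c c' =>
    hermMatrix (fun p => (z (Sum.inl p) : ℂ)) (e₁ (Sum.inr c)) (e₁ (Sum.inr c')) with hZdef
  set H : C → C → ℂ := fun c c' => fermionBlock x (e₂ (Sum.inr c)) (e₂ (Sum.inr c')) with hHdef
  have he2 : halfPhase ψ ^ 2 = Real.cos ψ + Complex.I * Real.sin ψ := by
    rw [halfPhase_sq, mul_comm, Complex.exp_mul_I, Complex.ofReal_cos, Complex.ofReal_sin]; ring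
  have hnorm : ‖halfPhase ψ ^ 2‖ = 1 := by
    rw [halfPhase_sq, mul_comm, Complex.norm_exp_ofReal_mul_I]
  have hzc : ∀ c c', z (Sum.inl (e₁ (Sum.inr c), e₁ (Sum.inr c'))) =
      x (Sum.inl (e₁ (Sum.inr c), e₁ (Sum.inr c'))) -
        Real.cos ψ * x (Sum.inr (e₂ (Sum.inr c), e₂ (Sum.inr c'))) := fun c c' => by
    rw [hz, blockShear_inl]; simp; ring
  have hcc : ∀ c c', bosonBlock x (e₁ (Sum.inr c)) (e₁ (Sum.inr c')) - halfPhase ψ ^ 2 * H c c' =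
      Z c c' - Complex.I * Real.sin ψ * H c c' := by
    intro c c'
    have : Z c c' = bosonBlock x (e₁ (Sum.inr c)) (e₁ (Sum.inr c')) - Real.cos ψ * H c c' := by
      simp only [hZdef, hHdef, bosonBlock, fermionBlock, hermMatrix, Matrix.of_apply, hord, hzc]
      push_cast
      simp only [smul_eq_mul]
      split_ifs <;> ring
    rw [this, he2]; ring
  have hAc : ∀ a c, hermMatrix (fun p => (z (Sum.inl p) : ℂ)) (e₁ (Sum.inl a)) (e₁ (Sum.inr c)) =
      bosonBlock x (e₁ (Sum.inl a)) (e₁ (Sum.inr c)) := by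
    intro a c
    simp only [bosonBlock, hermMatrix, Matrix.of_apply]
    simp only [hz, blockShear_inl]
    simp
  have hF : (fun p => (z (Sum.inr p) : ℂ)) = fun p => (x (Sum.inr p) : ℂ) := by
    funext p; rw [hz, blockShear_inr]
  have hq : ∑ q, ‖(coordMap e₁ e₂ ψ x).1 q‖ ^ 2 =
      ∑ a : A, ∑ c : C, ‖bosonBlock x (e₁ (Sum.inl a)) (e₁ (Sum.inr c))‖ ^ 2 +
      ∑ a : B, ∑ c : C, ‖fermionBlock x (e₂ (Sum.inl a)) (e₂ (Sum.inr c))‖ ^ 2 +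
      ∑ c, ∑ c', (‖Z c c'‖ ^ 2 + Real.sin ψ ^ 2 * ‖H c c'‖ ^ 2) := by
    rw [← sum_norm_sub_sq Z H (fun c c' => conj_hermMatrix _ _ _) (fun c c' => conj_hermMatrix _ _ _)]
    have e0 : ∑ q, ‖(coordMap e₁ e₂ ψ x).1 q‖ ^ 2 =
        ∑ u, ∑ v, ‖upperVariation ψ (pairing e₁ e₂) x (e₁ u) (e₂ v)‖ ^ 2 := by
      rw [Fintype.sum_prod_type, Finset.sum_comm, ← Equiv.sum_comp e₁]
      refine Finset.sum_congr rfl fun u _ => ?_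
      rw [← Equiv.sum_comp e₂]
      rfl
    have hconj : ∀ (c : C) (a : B), ‖fermionBlock x (e₂ (Sum.inr c)) (e₂ (Sum.inl a))‖ =
        ‖fermionBlock x (e₂ (Sum.inl a)) (e₂ (Sum.inr c))‖ := fun c a => by
      rw [fermionBlock, ← conj_hermMatrix, RCLike.norm_conj]
    rw [e0]
    simp only [Fintype.sum_sum_type, upperVariation_pairing, Sum.elim_inl, Sum.elim_inr, mul_zero,
      sub_zero, zero_sub, norm_neg, norm_mul, hnorm, one_mul, norm_zero, ne_eq,
      OfNat.ofNat_ne_zero, not_false_eq_true, zero_pow, Finset.sum_const_zero, zero_add, hconj,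
      Finset.sum_add_distrib]
    have hcc' : ∀ c c', bosonBlock x (e₁ (Sum.inr c)) (e₁ (Sum.inr c')) - halfPhase ψ ^ 2 *
        fermionBlock x (e₂ (Sum.inr c)) (e₂ (Sum.inr c')) =
        Z c c' - Complex.I * Real.sin ψ * H c c' := hcc
    simp only [hcc']
    rw [Finset.sum_comm (s := Finset.univ (α := C)) (t := Finset.univ (α := B))]
    ring
  rw [hq, Fintype.sum_sum_type, Fintype.sum_sum_type]
  simp only [jacobianCoeff, Sum.elim_inl, Sum.elim_inr]
  rw [sum_commonCoeff e₁ 1 (fun p => z (Sum.inl p)),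
    sum_commonCoeff e₂ (Real.sin ψ ^ 2) (fun p => z (Sum.inr p)), hF]
  simp only [hAc, one_mul]
  have hY1 : ∀ p : A × A, (coordMap e₁ e₂ ψ x).2 (Sum.inl p) =
      z (Sum.inl (e₁ (Sum.inl p.1), e₁ (Sum.inl p.2))) := fun p => by
    rw [hz, blockShear_inl]; simp [coordMap]
  have hY2 : ∀ p : B × B, (coordMap e₁ e₂ ψ x).2 (Sum.inr p) =
      z (Sum.inr (e₂ (Sum.inl p.1), e₂ (Sum.inl p.2))) := fun p => by
    rw [hz, blockShear_inr]; simp [coordMap]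
  simp only [hY1, hY2, Finset.sum_add_distrib]
  simp only [hZdef, hHdef, fermionBlock]
  ring

end Jacobian

section Jacobian

variable {A B C : Type} [Fintype A] [Fintype B] [Fintype C]
  [DecidableEq A] [DecidableEq B] [DecidableEq C]
  (e₁ : A ⊕ C ≃ Fin k₁) (e₂ : B ⊕ C ≃ Fin k₂)

theorem jacobianCoeff_pos {ψ : ℝ} (hψ : 0 < Real.sin ψ) (p : EvenIdx k₁ k₂) :
    0 < jacobianCoeff e₁ e₂ ψ p := by
  have h : ∀ {A : Type} (s : ℝ) (_ : 0 < s) (u u' : A ⊕ C), 0 < commonCoeff s u u' := by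
    intro A s hs u u'
    unfold commonCoeff
    rcases u with u | u <;> rcases u' with u' | u' <;> simp only [Sum.elim_inl, Sum.elim_inr,
      zero_lt_one]
    split_ifs <;> positivity
  rcases p with p | p
  · exact h 1 one_pos _ _
  · exact h _ (by positivity) _ _

theorem prod_commonCoeff {k : ℕ} (e : A ⊕ C ≃ Fin k) (s : ℝ) :
    ∏ p : Fin k × Fin k, commonCoeff s (e.symm p.1) (e.symm p.2) =
      s ^ Fintype.card C ^ 2 * 2 ^ (Fintype.card C * (Fintype.card C - 1)) := by
  have h1 : ∏ p : Fin k × Fin k, commonCoeff s (e.symm p.1) (e.symm p.2) =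
      ∏ c : C, ∏ c' : C, (s * if c = c' then 1 else 2) := by
    rw [Fintype.prod_prod_type, ← Equiv.prod_comp e, Fintype.prod_sum_type]
    have : ∀ c : C, ∏ j, commonCoeff s (Sum.inr c : A ⊕ C) (e.symm j) =
        ∏ c' : C, (s * if c = c' then 1 else 2) := by
      intro c
      rw [← Equiv.prod_comp e, Fintype.prod_sum_type]
      simp only [Equiv.symm_apply_apply, commonCoeff, Sum.elim_inl, Sum.elim_inr,
        Finset.prod_const_one, one_mul]
      exact Finset.prod_congr rfl fun c' _ => by split_ifs <;> ring
    simp only [Equiv.symm_apply_apply, this]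
    rw [Finset.prod_eq_one, one_mul]
    exact fun a _ => Finset.prod_eq_one fun _ _ => rfl
  rw [h1]
  have h2 : ∀ c : C, ∏ c' : C, (s * if c = c' then (1 : ℝ) else 2) =
      s ^ Fintype.card C * 2 ^ (Fintype.card C - 1) := by
    intro c
    rw [Finset.prod_mul_distrib, Finset.prod_const, Finset.card_univ,
      ← Finset.mul_prod_erase _ _ (Finset.mem_univ c), if_pos rfl, one_mul,
      Finset.prod_congr rfl fun c' hc' => if_neg (Finset.ne_of_mem_erase hc').symm,
      Finset.prod_const, Finset.card_erase_of_mem (Finset.mem_univ c), Finset.card_univ]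
  simp only [h2, Finset.prod_const, Finset.card_univ]
  rw [mul_pow, ← pow_mul, ← pow_mul, sq, mul_comm (_ - 1)]

theorem prod_sqrt_jacobianCoeff {ψ : ℝ} (hψ : 0 < Real.sin ψ) :
    ∏ p, √(jacobianCoeff e₁ e₂ ψ p) =
      2 ^ (Fintype.card C * (Fintype.card C - 1)) * Real.sin ψ ^ Fintype.card C ^ 2 := by
  have h : ∏ p, jacobianCoeff e₁ e₂ ψ p =
      (2 ^ (Fintype.card C * (Fintype.card C - 1)) * Real.sin ψ ^ Fintype.card C ^ 2) ^ 2 := by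
    rw [Fintype.prod_sum_type]
    simp only [jacobianCoeff, Sum.elim_inl, Sum.elim_inr]
    rw [prod_commonCoeff e₁, prod_commonCoeff e₂, one_pow]
    ring
  rw [← Real.sqrt_prod _ fun p _ => (jacobianCoeff_pos e₁ e₂ hψ p).le, h,
    Real.sqrt_sq (by positivity)]

theorem coordMap_injective {ψ : ℝ} (hψ : 0 < Real.sin ψ)
    (hord : ∀ c c', e₁ (Sum.inr c) < e₁ (Sum.inr c') ↔ e₂ (Sum.inr c) < e₂ (Sum.inr c')) :
    Function.Injective (coordMap e₁ e₂ ψ) := by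
  rw [injective_iff_map_eq_zero]
  intro x hx
  have h := sum_sq_coordMap e₁ e₂ ψ hord x
  rw [hx] at h
  simp only [Prod.fst_zero, Prod.snd_zero, Pi.zero_apply, norm_zero, ne_eq, OfNat.ofNat_ne_zero,
    not_false_eq_true, zero_pow, Finset.sum_const_zero, add_zero] at h
  have h1 := (Finset.sum_eq_zero_iff_of_nonneg fun p _ =>
    mul_nonneg (jacobianCoeff_pos e₁ e₂ hψ p).le (sq_nonneg _)).mp h.symm
  have h2 : Matrix.toLin' (blockShear e₁ e₂ ψ) x = 0 := by
    funext p
    have := h1 p (Finset.mem_univ p)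
    simpa [(jacobianCoeff_pos e₁ e₂ hψ p).ne'] using this
  rw [Matrix.toLin'_apply] at h2
  exact Matrix.eq_zero_of_mulVec_eq_zero (by rw [det_blockShear]; exact one_ne_zero) h2

theorem card_coord {A B C : Type} [Fintype A] [Fintype B] [Fintype C] (e₁ : A ⊕ C ≃ Fin k₁)
    (e₂ : B ⊕ C ≃ Fin k₂) (h : IsEmpty A ∨ IsEmpty B) :
    2 * Fintype.card (OddIdx k₁ k₂) + Fintype.card ((A × A) ⊕ (B × B)) =
      Fintype.card (EvenIdx k₁ k₂) := by
  have h1 := Fintype.card_congr e₁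
  have h2 := Fintype.card_congr e₂
  have h3 : Fintype.card A * Fintype.card B = 0 := by
    rcases h with h | h <;> simp
  simp only [Fintype.card_sum, Fintype.card_prod, Fintype.card_fin] at h1 h2 ⊢
  rw [← h1, ← h2]
  linear_combination 2 * h3

theorem exists_coordEquiv {ψ : ℝ} (hψ : 0 < Real.sin ψ) (h : IsEmpty A ∨ IsEmpty B)
    (hord : ∀ c c', e₁ (Sum.inr c) < e₁ (Sum.inr c') ↔ e₂ (Sum.inr c) < e₂ (Sum.inr c')) :
    ∃ L : HermPair k₁ k₂ ≃L[ℝ] (OddIdx k₁ k₂ → ℂ) × ((A × A) ⊕ (B × B) → ℝ),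
      ∀ x, L x = coordMap e₁ e₂ ψ x := by
  have hfin : Module.finrank ℝ (HermPair k₁ k₂) =
      Module.finrank ℝ ((OddIdx k₁ k₂ → ℂ) × ((A × A) ⊕ (B × B) → ℝ)) := by
    rw [Module.finrank_prod, Module.finrank_fintype_fun_eq_card,
      Module.finrank_fintype_fun_eq_card, Module.finrank_pi_fintype, ← card_coord e₁ e₂ h]
    simp [mul_comm]
  exact ⟨(LinearEquiv.ofInjectiveOfFinrankEq _ (coordMap_injective e₁ e₂ hψ hord)
    hfin).toContinuousLinearEquiv, fun x => rfl⟩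

end Jacobian

theorem integral_gaussian_coord (ι κ : Type) [Fintype ι] [DecidableEq ι] [Fintype κ] :
    ∫ y : (ι → ℂ) × (κ → ℝ), Real.exp (-(∑ q, ‖y.1 q‖ ^ 2 + ∑ w, y.2 w ^ 2)) =
      Real.pi ^ Fintype.card ι * √Real.pi ^ Fintype.card κ := by
  have h1 : ∫ z : ℂ, Real.exp (-‖z‖ ^ 2) = Real.pi := by
    have h := GaussianFourier.integral_rexp_neg_mul_sq_norm (V := ℂ) one_pos
    simpa using h
  have h2 : ∫ t : ℝ, Real.exp (-t ^ 2) = √Real.pi := by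
    simpa using integral_gaussian 1
  have e : ∀ y : (ι → ℂ) × (κ → ℝ), Real.exp (-(∑ q, ‖y.1 q‖ ^ 2 + ∑ w, y.2 w ^ 2)) =
      (∏ q, Real.exp (-‖y.1 q‖ ^ 2)) * ∏ w, Real.exp (-y.2 w ^ 2) := by
    intro y
    rw [← Real.exp_sum, ← Real.exp_sum, ← Real.exp_add]
    simp only [Finset.sum_neg_distrib]
    ring_nf
  simp only [e]
  rw [Measure.volume_eq_prod, integral_prod_mul (fun m : ι → ℂ => ∏ q, Real.exp (-‖m q‖ ^ 2))
    (fun Y : κ → ℝ => ∏ w, Real.exp (-Y w ^ 2)),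
    integral_fintype_prod_volume_eq_prod (fun (_ : ι) (z : ℂ) => Real.exp (-‖z‖ ^ 2)),
    integral_fintype_prod_volume_eq_prod (fun (_ : κ) (t : ℝ) => Real.exp (-t ^ 2))]
  simp [h1, h2]

theorem integral_gaussian_shear {α : Type} [Fintype α] [DecidableEq α] {M : Matrix α α ℝ}
    (hM : M.det = 1) {g : α → ℝ} :
    ∫ x : α → ℝ, Real.exp (-∑ p, g p * Matrix.toLin' M x p ^ 2) = ∏ p, √(Real.pi / g p) := by
  have hmap : Measure.map (Matrix.toLin' M) volume = (volume : Measure (α → ℝ)) := by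
    have := Real.map_matrix_volume_pi_eq_smul_volume_pi (M := M) (by rw [hM]; exact one_ne_zero)
    simpa [hM] using this
  have hc : Continuous (Matrix.toLin' M) := LinearMap.continuous_of_finiteDimensional _
  have h := integral_map (μ := (volume : Measure (α → ℝ))) hc.aemeasurable
    (f := fun x => Real.exp (-∑ p, g p * x p ^ 2)) (by
      refine Continuous.aestronglyMeasurable ?_
      fun_prop)
  rw [hmap] at h
  rw [← h]
  have e : ∀ x : α → ℝ, Real.exp (-∑ p, g p * x p ^ 2) = ∏ p, Real.exp (-g p * x p ^ 2) := by
    intro x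
    rw [← Real.exp_sum, ← Finset.sum_neg_distrib]
    simp only [neg_mul]
  simp only [e]
  rw [integral_fintype_prod_volume_eq_prod (fun p (t : ℝ) => Real.exp (-g p * t ^ 2))]
  simp only [integral_gaussian]

section Jacobian

variable {A B C : Type} [Fintype A] [Fintype B] [Fintype C]
  [DecidableEq A] [DecidableEq B] [DecidableEq C]
  (e₁ : A ⊕ C ≃ Fin k₁) (e₂ : B ⊕ C ≃ Fin k₂)

/-- The inverse Jacobian, found by comparison of two Gaussian integrals. -/
theorem map_coordEquiv {ψ : ℝ} (hψ : 0 < Real.sin ψ) (h : IsEmpty A ∨ IsEmpty B)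
    (hord : ∀ c c', e₁ (Sum.inr c) < e₁ (Sum.inr c') ↔ e₂ (Sum.inr c) < e₂ (Sum.inr c'))
    (L : HermPair k₁ k₂ ≃L[ℝ] (OddIdx k₁ k₂ → ℂ) × ((A × A) ⊕ (B × B) → ℝ))
    (hL : ∀ x, L x = coordMap e₁ e₂ ψ x) :
    Measure.map L volume = ENNReal.ofReal
      (2 ^ (Fintype.card C * (Fintype.card C - 1)) * Real.sin ψ ^ Fintype.card C ^ 2)⁻¹ •
        (volume : Measure ((OddIdx k₁ k₂ → ℂ) × ((A × A) ⊕ (B × B) → ℝ))) := by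
  have hpi : 0 < √Real.pi := Real.sqrt_pos.mpr Real.pi_pos
  have : (Measure.map L (volume : Measure (HermPair k₁ k₂))).IsAddHaarMeasure :=
    L.isAddHaarMeasure_map volume
  obtain ⟨c, hctop, hc⟩ : ∃ c : ENNReal, c ≠ ⊤ ∧ Measure.map L volume =
      c • (volume : Measure ((OddIdx k₁ k₂ → ℂ) × ((A × A) ⊕ (B × B) → ℝ))) := by
    refine ⟨(Measure.addHaarScalarFactor (Measure.map L volume) volume : NNReal),
      ENNReal.coe_ne_top, ?_⟩
    exact Measure.isAddLeftInvariant_eq_smul (Measure.map L volume) volume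
  have hg : ∫ y, Real.exp (-(∑ q, ‖y.1 q‖ ^ 2 + ∑ w, y.2 w ^ 2)) ∂(Measure.map L volume) =
      ∏ p, √(Real.pi / jacobianCoeff e₁ e₂ ψ p) := by
    have hemb : MeasurableEmbedding L := L.toHomeomorph.measurableEmbedding
    rw [hemb.integral_map, ← integral_gaussian_shear (det_blockShear e₁ e₂ ψ)]
    simp only [← sum_sq_coordMap e₁ e₂ ψ hord, ← hL]
  rw [hc, integral_smul_measure, integral_gaussian_coord] at hg
  have hprod : ∏ p, √(Real.pi / jacobianCoeff e₁ e₂ ψ p) =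
      √Real.pi ^ Fintype.card (EvenIdx k₁ k₂) / ∏ p, √(jacobianCoeff e₁ e₂ ψ p) := by
    simp only [Real.sqrt_div Real.pi_pos.le, Finset.prod_div_distrib, Finset.prod_const,
      Finset.card_univ]
  have hpow : Real.pi ^ Fintype.card (OddIdx k₁ k₂) *
      √Real.pi ^ Fintype.card ((A × A) ⊕ (B × B)) = √Real.pi ^ Fintype.card (EvenIdx k₁ k₂) := by
    rw [← card_coord e₁ e₂ h, pow_add, pow_mul, Real.sq_sqrt Real.pi_pos.le]
  rw [hprod, prod_sqrt_jacobianCoeff e₁ e₂ hψ, hpow, smul_eq_mul, div_eq_inv_mul] at hg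
  have hval := mul_right_cancel₀ (pow_pos hpi _).ne' hg
  rw [hc, ← hval, ENNReal.ofReal_toReal hctop]

end Jacobian

/-! ### Localization of the superfunction -/

theorem decays_comp_symm {ι κ : Type} [Fintype ι] [Fintype κ] {α : Type} [Fintype α] {p : ℕ}
    (L : (α → ℝ) ≃L[ℝ] (ι → ℂ) × (κ → ℝ)) {f : (α → ℝ) → ℂ}
    (hf : Tendsto (fun x => (‖x‖ : ℂ) ^ p * f x) (cocompact (α → ℝ)) (𝓝 0)) :
    Decays p fun y => f (L.symm y) := by
  intro ε hε
  set K := ‖(L : (α → ℝ) →L[ℝ] (ι → ℂ) × (κ → ℝ))‖ with hK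
  have hδ : 0 < ε / (K ^ p + 1) := by positivity
  have h1 : Tendsto (fun y => (‖L.symm y‖ : ℂ) ^ p * f (L.symm y)) (cocompact _) (𝓝 0) :=
    hf.comp L.symm.toHomeomorph.isClosedEmbedding.tendsto_cocompact
  have h2 : ∀ᶠ y in cocompact ((ι → ℂ) × (κ → ℝ)),
      ‖(‖L.symm y‖ : ℂ) ^ p * f (L.symm y)‖ < ε / (K ^ p + 1) := by
    simpa using h1.eventually (Metric.ball_mem_nhds 0 hδ)
  rw [← Metric.cobounded_eq_cocompact, ← comap_norm_atTop, eventually_comap] at h2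
  obtain ⟨R₀, hR₀⟩ := eventually_atTop.mp h2
  refine ⟨R₀, fun y hy => ?_⟩
  have h3 := (hR₀ ‖y‖ hy y rfl).le
  have h4 : ‖y‖ ≤ K * ‖L.symm y‖ := by
    have := (L : (α → ℝ) →L[ℝ] (ι → ℂ) × (κ → ℝ)).le_opNorm (L.symm y)
    simpa using this
  rw [norm_mul, norm_pow, Complex.norm_real, norm_norm] at h3
  calc ‖f (L.symm y)‖ * ‖y‖ ^ p ≤ ‖f (L.symm y)‖ * (K * ‖L.symm y‖) ^ p := by gcongr
    _ = K ^ p * (‖L.symm y‖ ^ p * ‖f (L.symm y)‖) := by ring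
    _ ≤ K ^ p * (ε / (K ^ p + 1)) := by gcongr
    _ ≤ (K ^ p + 1) * (ε / (K ^ p + 1)) := by gcongr; linarith
    _ = ε := mul_div_cancel₀ _ (by positivity)

section Localization

variable {A B C : Type} [Fintype A] [Fintype B] [Fintype C]
  [DecidableEq A] [DecidableEq B] [DecidableEq C]
  (e₁ : A ⊕ C ≃ Fin k₁) (e₂ : B ⊕ C ≃ Fin k₂)

theorem card_corner {A B C : Type} [Fintype A] [Fintype B] [Fintype C] (e₁ : A ⊕ C ≃ Fin k₁)
    (e₂ : B ⊕ C ≃ Fin k₂) (h : IsEmpty A ∨ IsEmpty B) :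
    Fintype.card ((A × A) ⊕ (B × B)) = ((k₁ : ℤ) - k₂).natAbs ^ 2 := by
  have h1 := Fintype.card_congr e₁
  have h2 := Fintype.card_congr e₂
  have h3 : (Fintype.card A : ℤ) * Fintype.card B = 0 := by
    rcases h with h | h <;> simp
  simp only [Fintype.card_sum, Fintype.card_prod, Fintype.card_fin] at h1 h2 ⊢
  zify
  rw [sq_abs, ← h1, ← h2]
  push_cast
  linear_combination 2 * h3

/-- The Ward identity in the adapted coordinates, as a localization step.  Its right-hand side
involves only coefficients of the degree of the pairs in `l₂`, for which the boundary condition has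
the required exponent: the corners have `(k₁ - k₂)²` real coordinates. -/
theorem tendsto_planeIntegral_sub {N : ℕ} (hN : k₁ * k₂ ≤ N) {ψ : ℝ} {f : Superfunction k₁ k₂}
    (hdiff : ∀ J, ContDiff ℝ N (f J)) (hinv : f.IsInvariant N ψ) (hzero : f.VanishesAtInfinity)
    (h : IsEmpty A ∨ IsEmpty B)
    (L : HermPair k₁ k₂ ≃L[ℝ] (OddIdx k₁ k₂ → ℂ) × ((A × A) ⊕ (B × B) → ℝ))
    (hL : ∀ x, L x = coordMap e₁ e₂ ψ x) {l₁ l₂ : List (OddIdx k₁ k₂)} {t : OddIdx k₁ k₂}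
    (hl : List.finRange k₂ ×ˢ List.finRange k₁ = l₁ ++ t :: l₂) :
    Tendsto (fun R => planeIntegral (t :: l₂).toFinset R
        (fun y => f ((t :: l₂).toFinset, (t :: l₂).toFinset) (L.symm y)) -
      halfPhase ψ * dbarFactor e₁ e₂ ψ t * planeIntegral l₂.toFinset R
        (fun y => f (l₂.toFinset, l₂.toFinset) (L.symm y))) atTop (𝓝 0) := by
  have he := halfPhase_ne_zero ψ
  have hn : 1 ≤ N := by
    have h1 : 0 < k₂ := t.1.pos
    have h2 : 0 < k₁ := t.2.pos
    exact (Nat.mul_pos h2 h1).trans_le hN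
  obtain ⟨ν, hν⟩ : ∃ ν : OddIdx k₁ k₂ → Fin N, Function.Injective ν := by
    have hc : Fintype.card (OddIdx k₁ k₂) ≤ Fintype.card (Fin N) := by simpa [mul_comm] using hN
    obtain ⟨ν⟩ := Function.Embedding.nonempty_of_card_le hc
    exact ⟨ν, ν.injective⟩
  obtain ⟨c, hc, hward⟩ := ward_identity hn hinv hν (pairing e₁ e₂) hl
  have hnd : (l₁ ++ t :: l₂).Nodup := hl ▸
    List.Nodup.product (List.nodup_finRange _) (List.nodup_finRange _)
  have hnd2 : (t :: l₂).Nodup := hnd.of_append_right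
  have ht : t ∉ l₂.toFinset := by simpa using (List.nodup_cons.mp hnd2).1
  have hcard : l₂.toFinset.card = l₂.length := List.toFinset_card_of_nodup hnd2.of_cons
  have hlt : l₂.length < (Finset.univ : Finset (OddIdx k₁ k₂)).card := by
    rw [← hcard]
    exact Finset.card_lt_card (Finset.ssubset_univ_iff.mpr fun h => ht (h ▸ Finset.mem_univ t))
  have hsm : ∀ J, ContDiff ℝ 1 fun y => f J (L.symm y) := fun J =>
    ((hdiff J).of_le (by exact_mod_cast hn)).comp L.symm.contDiff
  have hdec : ∀ J : MonIdx k₁ k₂, J.1.card + J.2.card = 2 * l₂.length →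
      Decays (Fintype.card ((A × A) ⊕ (B × B)) + 2 * l₂.toFinset.card)
        fun y => f J (L.symm y) := by
    intro J hJ
    have hne : J ≠ (Finset.univ, Finset.univ) := by
      rintro rfl
      simp only at hJ
      omega
    rw [hcard, card_corner e₁ e₂ h, ← hJ]
    exact decays_comp_symm L (hzero J hne)
  have key := tendsto_planeIntegral_add (σ := OddIdx k₁ k₂ × MonIdx k₁ k₂) ht
    (G := fun y => f ((t :: l₂).toFinset, (t :: l₂).toFinset) (L.symm y))
    (G' := fun y => f (l₂.toFinset, l₂.toFinset) (L.symm y))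
    (κ₀ := -(halfPhase ψ * dbarFactor e₁ e₂ ψ t)) (i := Prod.fst)
    (c := fun k => if k.1 ∈ l₂.toFinset then
      -(halfPhase ψ * c k.2 k.1 * dbarFactor e₁ e₂ ψ k.1) else 0)
    (h := fun k y => f k.2 (L.symm y)) (hsm _).continuous (hsm _)
    (fun k hk => by by_contra hne; simp [hne] at hk) (fun k => hsm _) ?_
    (hdec _ (by simp only [hcard]; ring)) ?_
  · refine key.congr fun R => ?_
    rw [List.toFinset_cons]
    ring
  · intro y hy
    have hm : ∀ q : OddIdx k₁ k₂, upperVariation ψ (pairing e₁ e₂) (L.symm y) q.2 q.1 = y.1 q := by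
      intro q
      have := hL (L.symm y)
      rw [L.apply_symm_apply] at this
      exact (congrArg (fun z => z.1 q) this).symm
    have hw := hward (L.symm y) fun q hq => by
      rw [hm]
      refine hy q fun hq' => ?_
      rw [← List.toFinset_cons, List.mem_toFinset] at hq'
      exact List.disjoint_of_nodup_append hnd hq hq'
    simp only [hm, oddDeriv_eq_dbarAt e₁ e₂ ψ L hL, L.apply_symm_apply] at hw
    have hsum : ∑ k : OddIdx k₁ k₂ × MonIdx k₁ k₂, (if k.1 ∈ l₂.toFinset then
        -(halfPhase ψ * c k.2 k.1 * dbarFactor e₁ e₂ ψ k.1) else 0) *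
          dbarAt k.1 (fun y => f k.2 (L.symm y)) y =
        -halfPhase ψ * ∑ q ∈ l₂.toFinset, ∑ J, c J q *
          (dbarFactor e₁ e₂ ψ q * dbarAt q (fun y => f J (L.symm y)) y) := by
      rw [Fintype.sum_prod_type, Finset.mul_sum, ← Finset.sum_subset (Finset.subset_univ l₂.toFinset)]
      · refine Finset.sum_congr rfl fun q hq => ?_
        rw [Finset.mul_sum]
        refine Finset.sum_congr rfl fun J _ => ?_
        simp only [hq, if_true]
        ring
      · intro q _ hq
        simp [hq]
    rw [hsum]
    linear_combination halfPhase ψ * hw - y.1 t *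
      f ((t :: l₂).toFinset, (t :: l₂).toFinset) (L.symm y) * mul_inv_cancel₀ he
  · intro k hk
    refine hdec k.2 (hc k.2 k.1 fun h0 => hk ?_)
    simp [h0]

theorem hermMatrix_eq_zero {k : ℕ} {a : Fin k × Fin k → ℂ} {n m : Fin k} (h1 : a (n, m) = 0)
    (h2 : a (m, n) = 0) : hermMatrix a n m = 0 := by
  rcases lt_trichotomy n m with h | h | h
  · simp [hermMatrix, h, h1, h2]
  · subst h; simp [hermMatrix, h1]
  · simp [hermMatrix, h, h.not_gt, h1, h2]

/-- The point whose common subblocks vanish, with given corners. -/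
def cornerPoint (Y : (A × A) ⊕ (B × B) → ℝ) : HermPair k₁ k₂ :=
  Sum.elim
    (fun p => Sum.elim (fun a => Sum.elim (fun a' => Y (Sum.inl (a, a'))) (fun _ => 0)
      (e₁.symm p.2)) (fun _ => 0) (e₁.symm p.1))
    (fun p => Sum.elim (fun a => Sum.elim (fun a' => Y (Sum.inr (a, a'))) (fun _ => 0)
      (e₂.symm p.2)) (fun _ => 0) (e₂.symm p.1))

/-- The corners parametrize the plane where all odd variations vanish. -/
theorem coordMap_cornerPoint (ψ : ℝ) (Y : (A × A) ⊕ (B × B) → ℝ) :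
    coordMap e₁ e₂ ψ (cornerPoint e₁ e₂ Y) = (0, Y) := by
  have h1 : ∀ u c, bosonBlock (cornerPoint e₁ e₂ Y) (e₁ u) (e₁ (Sum.inr c)) = 0 := by
    intro u c
    rcases u with u | u <;> exact hermMatrix_eq_zero (by simp [cornerPoint]) (by simp [cornerPoint])
  have h2 : ∀ v c, fermionBlock (cornerPoint e₁ e₂ Y) (e₂ (Sum.inr c)) (e₂ v) = 0 := by
    intro v c
    rcases v with v | v <;> exact hermMatrix_eq_zero (by simp [cornerPoint]) (by simp [cornerPoint])
  refine Prod.ext (funext fun q => ?_) (funext fun w => ?_)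
  · obtain ⟨j, i⟩ := q
    obtain ⟨u, rfl⟩ := e₁.surjective i
    obtain ⟨v, rfl⟩ := e₂.surjective j
    change upperVariation ψ (pairing e₁ e₂) _ (e₁ u) (e₂ v) = 0
    rw [upperVariation_pairing]
    simp only [h1, h2]
    rcases u with u | u <;> rcases v with v | v <;> simp
  · rcases w with w | w <;> simp [coordMap, cornerPoint]

/-- The product of the factors of all localization steps.  The power of `sin ψ` is that of the
Jacobian. -/
theorem prod_dbarFactor {ψ : ℝ} (h : IsEmpty A ∨ IsEmpty B) :
    ∏ q, (halfPhase ψ * dbarFactor e₁ e₂ ψ q) =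
      (-Complex.exp (Complex.I * ψ)) ^ (Fintype.card A * Fintype.card C) *
      Complex.exp (-(Complex.I * ψ)) ^ (Fintype.card B * Fintype.card C) *
      (-2 * Complex.I * Real.sin ψ) ^ Fintype.card C ^ 2 := by
  have he := halfPhase_ne_zero ψ
  have h2 : halfPhase ψ * -halfPhase ψ = -Complex.exp (Complex.I * ψ) := by
    rw [← halfPhase_sq]; ring
  have h3 : halfPhase ψ * (halfPhase ψ)⁻¹ ^ 3 = Complex.exp (-(Complex.I * ψ)) := by
    rw [Complex.exp_neg, ← halfPhase_sq]; field_simp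
  have h4 : halfPhase ψ * (-halfPhase ψ + (halfPhase ψ)⁻¹ ^ 3) =
      -2 * Complex.I * Real.sin ψ := by
    rw [mul_add, h2, h3, mul_comm Complex.I, Complex.ofReal_sin, Complex.sin]
    ring_nf
    rw [Complex.I_sq]
    ring
  have e0 : ∏ q, (halfPhase ψ * dbarFactor e₁ e₂ ψ q) =
      ∏ u, ∏ v, (halfPhase ψ * dbarFactor e₁ e₂ ψ (e₂ v, e₁ u)) := by
    rw [Fintype.prod_prod_type, Finset.prod_comm, ← Equiv.prod_comp e₁]
    exact Finset.prod_congr rfl fun u _ => by rw [← Equiv.prod_comp e₂]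
  have e1 : ((0 : ℂ) ^ Fintype.card B) ^ Fintype.card A = 1 := by
    rcases h with h | h <;> simp
  rw [e0]
  simp only [Fintype.prod_sum_type, dbarFactor, Equiv.symm_apply_apply, Sum.elim_inl, Sum.elim_inr,
    add_zero, zero_add, mul_zero, h2, h3, h4]
  simp only [Finset.prod_mul_distrib, Finset.prod_const, Finset.card_univ, e1, one_mul]
  rw [← pow_mul, ← pow_mul, ← pow_mul, mul_comm (Fintype.card C), mul_comm (Fintype.card C), sq]
  ring

/-- The theorem in terms of the corners that the pairing leaves out. -/
theorem integral_berezin_eq {N : ℕ} (hN : k₁ * k₂ ≤ N) {ψ : ℝ} (hψ : ψ ∈ Set.Ioo 0 Real.pi)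
    {f : Superfunction k₁ k₂}
    (hdiff : ∀ J, ContDiff ℝ N (f J)) (hinv : f.IsInvariant N ψ) (hzero : f.VanishesAtInfinity)
    (hint : Integrable f.berezin) (h : IsEmpty A ∨ IsEmpty B)
    (hord : ∀ c c', e₁ (Sum.inr c) < e₁ (Sum.inr c') ↔ e₂ (Sum.inr c) < e₂ (Sum.inr c'))
    (hcorner : Integrable fun Y => f.atBody (cornerPoint e₁ e₂ Y)) :
    ∫ x, f.berezin x = (2 ^ (Fintype.card C * (Fintype.card C - 1)))⁻¹ *
      (-Complex.I) ^ Fintype.card C ^ 2 *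
      (-Complex.exp (Complex.I * ψ) / 2) ^ (Fintype.card A * Fintype.card C) *
      (Complex.exp (-(Complex.I * ψ)) / 2) ^ (Fintype.card B * Fintype.card C) *
      ∫ Y, f.atBody (cornerPoint e₁ e₂ Y) := by
  have hs : 0 < Real.sin ψ := Real.sin_pos_of_pos_of_lt_pi hψ.1 hψ.2
  obtain ⟨L, hL⟩ := exists_coordEquiv e₁ e₂ hs h hord
  have hmap := map_coordEquiv e₁ e₂ hs h hord L hL
  set K : ℝ := 2 ^ (Fintype.card C * (Fintype.card C - 1)) * Real.sin ψ ^ Fintype.card C ^ 2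
    with hK
  have hKpos : 0 < K := by positivity
  have hemb : MeasurableEmbedding L := L.toHomeomorph.measurableEmbedding
  have hcor : ∀ Y, L.symm (0, Y) = cornerPoint e₁ e₂ Y := fun Y => by
    rw [ContinuousLinearEquiv.symm_apply_eq, hL, coordMap_cornerPoint]
  have hpi : (2 * Real.pi : ℂ) ^ (k₁ * k₂) ≠ 0 :=
    pow_ne_zero _ (by exact_mod_cast Real.two_pi_pos.ne')
  have htop : Integrable (f (Finset.univ, Finset.univ)) := by
    have := hint.mul_const ((2 * Real.pi : ℂ) ^ (k₁ * k₂))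
    refine this.congr (Eventually.of_forall fun x => ?_)
    simp only [Superfunction.berezin]
    field_simp
  have htopL : Integrable fun y => f (Finset.univ, Finset.univ) (L.symm y) := by
    have h1 : Integrable (fun y => f (Finset.univ, Finset.univ) (L.symm y))
        (Measure.map L volume) := by
      rw [hemb.integrable_map_iff]
      refine htop.congr (Eventually.of_forall fun x => ?_)
      simp
    rw [hmap, integrable_smul_measure (by simpa using hKpos) ENNReal.ofReal_ne_top] at h1
    exact h1
  have hval : ∫ x, f (Finset.univ, Finset.univ) x =
      (K : ℂ)⁻¹ * ∫ y, f (Finset.univ, Finset.univ) (L.symm y) := by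
    have h1 := hemb.integral_map (μ := volume) fun y => f (Finset.univ, Finset.univ) (L.symm y)
    rw [hmap, integral_smul_measure, ENNReal.toReal_ofReal (by positivity)] at h1
    simp only [L.symm_apply_apply] at h1
    rw [← h1, Complex.real_smul, Complex.ofReal_inv]
  have hloc := integral_eq_of_localization (l₀ := List.finRange k₂ ×ˢ List.finRange k₁)
    (List.Nodup.product (List.nodup_finRange _) (List.nodup_finRange _))
    (fun q => List.mem_product.mpr ⟨List.mem_finRange _, List.mem_finRange _⟩)
    (g := fun S y => f (S, S) (L.symm y)) (κ₀ := fun q => halfPhase ψ * dbarFactor e₁ e₂ ψ q)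
    (fun l₁ l₂ t hl => tendsto_planeIntegral_sub e₁ e₂ hN hdiff hinv hzero h L hL hl) htopL
    (by simp only [hcor]; exact hcorner)
  simp only [hcor] at hloc
  have hber : ∫ x, f.berezin x =
      (∫ x, f (Finset.univ, Finset.univ) x) / (2 * Real.pi : ℂ) ^ (k₁ * k₂) := by
    simp only [Superfunction.berezin]
    rw [integral_div]
  have hk1 := Fintype.card_congr e₁
  have hk2 := Fintype.card_congr e₂
  simp only [Fintype.card_sum, Fintype.card_fin] at hk1 hk2
  have hcards : k₁ * k₂ = Fintype.card A * Fintype.card C + Fintype.card B * Fintype.card C +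
      Fintype.card C ^ 2 := by
    have h3 : Fintype.card A * Fintype.card B = 0 := by
      rcases h with h | h <;> simp
    rw [← hk1, ← hk2]
    linear_combination h3
  have hodd : Fintype.card (OddIdx k₁ k₂) = k₁ * k₂ := by simp [mul_comm]
  rw [hber, hval, hloc, prod_dbarFactor e₁ e₂ h, hodd, hcards, hK]
  have hpi' : (Real.pi : ℂ) ≠ 0 := by exact_mod_cast Real.pi_ne_zero
  have hsc : (Real.sin ψ : ℂ) ≠ 0 := by exact_mod_cast hs.ne'
  have hJ : ∫ Y, f (∅, ∅) (cornerPoint e₁ e₂ Y) = ∫ Y, f.atBody (cornerPoint e₁ e₂ Y) := rfl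
  rw [hJ]
  simp only [Complex.ofReal_mul, Complex.ofReal_pow, Complex.ofReal_ofNat, pow_add, mul_pow,
    div_pow, neg_mul, mul_assoc]
  have h5 : (-(2 * (Complex.I * Real.sin ψ)) : ℂ) ^ Fintype.card C ^ 2 =
      2 ^ Fintype.card C ^ 2 * ((-Complex.I) ^ Fintype.card C ^ 2 *
        (Real.sin ψ : ℂ) ^ Fintype.card C ^ 2) := by
    rw [← mul_pow, ← mul_pow]; congr 1; ring
  rw [h5]
  field_simp

end Localization

/-! ### The two orderings of the dimensions -/

theorem measurePreserving_reindex {α β : Type} [Fintype α] [Fintype β] (e : α ≃ β) :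
    MeasurePreserving (fun (a : α → ℝ) (b : β) => a (e.symm b)) := by
  have h := volume_measurePreserving_piCongrLeft (fun _ : β => ℝ) e
  have heq : (fun (a : α → ℝ) (b : β) => a (e.symm b)) =
      MeasurableEquiv.piCongrLeft (fun _ : β => ℝ) e := by
    funext a b
    obtain ⟨a', rfl⟩ := e.surjective b
    rw [MeasurableEquiv.coe_piCongrLeft, Equiv.piCongrLeft_apply_apply, Equiv.symm_apply_apply]
  rw [heq]
  exact h

theorem measurableEmbedding_reindex {α β : Type} [Fintype α] [Fintype β] (e : α ≃ β) :
    MeasurableEmbedding (fun (a : α → ℝ) (b : β) => a (e.symm b)) :=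
  (MeasurableEquiv.arrowCongr' e (MeasurableEquiv.refl ℝ)).measurableEmbedding

theorem integral_berezin_of_le {N : ℕ} (hk : k₂ ≤ k₁) (hN : k₁ * k₂ ≤ N) {ψ : ℝ}
    (hψ : ψ ∈ Set.Ioo 0 Real.pi) {f : Superfunction k₁ k₂}
    (hdiff : ∀ J, ContDiff ℝ N (f J)) (hinv : f.IsInvariant N ψ) (hzero : f.VanishesAtInfinity)
    (hint : Integrable f.berezin)
    (hcorner : Integrable fun a : Fin (k₁ - k₂) × Fin (k₁ - k₂) → ℝ =>
      f.atBody (embedBoson k₁ k₂ a)) :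
    ∫ x, f.berezin x = (2 ^ (k₂ * (k₂ - 1)))⁻¹ * (-Complex.I) ^ k₂ ^ 2 *
      (-Complex.exp (Complex.I * ψ) / 2) ^ ((k₁ - k₂) * k₂) *
      ∫ a : Fin (k₁ - k₂) × Fin (k₁ - k₂) → ℝ, f.atBody (embedBoson k₁ k₂ a) := by
  let e₁ : Fin (k₁ - k₂) ⊕ Fin k₂ ≃ Fin k₁ :=
    finSumFinEquiv.trans (finCongr (Nat.sub_add_cancel hk))
  let e₂ : Empty ⊕ Fin k₂ ≃ Fin k₂ := Equiv.emptySum Empty (Fin k₂)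
  let e : Fin (k₁ - k₂) × Fin (k₁ - k₂) ≃ (Fin (k₁ - k₂) × Fin (k₁ - k₂)) ⊕ (Empty × Empty) :=
    (Equiv.sumEmpty _ _).symm
  have hemb : ∀ a, cornerPoint e₁ e₂ (fun b => a (e.symm b)) = embedBoson k₁ k₂ a := by
    intro a
    funext p
    rcases p with ⟨i, j⟩ | ⟨i, j⟩
    · obtain ⟨u, rfl⟩ := e₁.surjective i
      obtain ⟨v, rfl⟩ := e₁.surjective j
      rcases u with u | u <;> rcases v with v | v <;>
        simp [cornerPoint, embedBoson, padZero, e₁, e]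
    · rfl
  have hmp := measurePreserving_reindex e
  have hme := measurableEmbedding_reindex e
  have h := integral_berezin_eq e₁ e₂ hN hψ hdiff hinv hzero hint (Or.inr inferInstance)
    (fun c c' => by simp [e₁, e₂, Fin.lt_def, -Fin.val_fin_lt]) (by
      rw [← hmp.integrable_comp_emb hme]
      exact hcorner.congr (Eventually.of_forall fun a => by simp [← hemb]))
  rw [h, ← hmp.integral_comp hme]
  simp [hemb]

theorem integral_berezin_of_ge {N : ℕ} (hk : k₁ ≤ k₂) (hN : k₁ * k₂ ≤ N) {ψ : ℝ}
    (hψ : ψ ∈ Set.Ioo 0 Real.pi) {f : Superfunction k₁ k₂}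
    (hdiff : ∀ J, ContDiff ℝ N (f J)) (hinv : f.IsInvariant N ψ) (hzero : f.VanishesAtInfinity)
    (hint : Integrable f.berezin)
    (hcorner : Integrable fun a : Fin (k₂ - k₁) × Fin (k₂ - k₁) → ℝ =>
      f.atBody (embedFermion k₁ k₂ a)) :
    ∫ x, f.berezin x = (2 ^ (k₁ * (k₁ - 1)))⁻¹ * (-Complex.I) ^ k₁ ^ 2 *
      (Complex.exp (-(Complex.I * ψ)) / 2) ^ ((k₂ - k₁) * k₁) *
      ∫ a : Fin (k₂ - k₁) × Fin (k₂ - k₁) → ℝ, f.atBody (embedFermion k₁ k₂ a) := by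
  let e₂ : Fin (k₂ - k₁) ⊕ Fin k₁ ≃ Fin k₂ :=
    finSumFinEquiv.trans (finCongr (Nat.sub_add_cancel hk))
  let e₁ : Empty ⊕ Fin k₁ ≃ Fin k₁ := Equiv.emptySum Empty (Fin k₁)
  let e : Fin (k₂ - k₁) × Fin (k₂ - k₁) ≃ (Empty × Empty) ⊕ (Fin (k₂ - k₁) × Fin (k₂ - k₁)) :=
    (Equiv.emptySum _ _).symm
  have hemb : ∀ a, cornerPoint e₁ e₂ (fun b => a (e.symm b)) = embedFermion k₁ k₂ a := by
    intro a
    funext p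
    rcases p with ⟨i, j⟩ | ⟨i, j⟩
    · rfl
    · obtain ⟨u, rfl⟩ := e₂.surjective i
      obtain ⟨v, rfl⟩ := e₂.surjective j
      rcases u with u | u <;> rcases v with v | v <;>
        simp [cornerPoint, embedFermion, padZero, e₂, e]
  have hmp := measurePreserving_reindex e
  have hme := measurableEmbedding_reindex e
  have h := integral_berezin_eq e₁ e₂ hN hψ hdiff hinv hzero hint (Or.inl inferInstance)
    (fun c c' => by simp [e₁, e₂, Fin.lt_def, -Fin.val_fin_lt]) (by
      rw [← hmp.integrable_comp_emb hme]
      exact hcorner.congr (Eventually.of_forall fun a => by simp [← hemb]))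
  rw [h, ← hmp.integral_comp hme]
  simp [hemb]

end SuperInt

end

theorem theorem4p1 (k₁ k₂ N : ℕ) (hN : k₁ * k₂ ≤ N) (ψ : ℝ) (hψ : ψ ∈ Set.Ioo 0 Real.pi)
    (f : SuperInt.Superfunction k₁ k₂)
    (hdiff : ∀ J, ContDiff ℝ N (f J))
    (hinv : f.IsInvariant N ψ)
    (hzero : f.VanishesAtInfinity)
    (hint : MeasureTheory.Integrable f.berezin) :
    (k₂ < k₁ →
      MeasureTheory.Integrable (fun a : Fin (k₁ - k₂) × Fin (k₁ - k₂) → ℝ =>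
        f.atBody (SuperInt.embedBoson k₁ k₂ a)) →
      ∫ x, f.berezin x =
        (-1) ^ (k₁ * k₂) * (2 ^ (k₂ * (k₂ - 1)))⁻¹ * Complex.I ^ (k₂ ^ 2) *
          (Complex.exp (Complex.I * ψ) / 2) ^ (k₂ * (k₁ - k₂)) *
          ∫ a : Fin (k₁ - k₂) × Fin (k₁ - k₂) → ℝ, f.atBody (SuperInt.embedBoson k₁ k₂ a)) ∧
    (k₁ = k₂ →
      ∫ x, f.berezin x =
        (2 ^ (k₁ * (k₁ - 1)))⁻¹ * (-Complex.I) ^ (k₁ ^ 2) * f.atBody 0) ∧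
    (k₁ < k₂ →
      MeasureTheory.Integrable (fun a : Fin (k₂ - k₁) × Fin (k₂ - k₁) → ℝ =>
        f.atBody (SuperInt.embedFermion k₁ k₂ a)) →
      ∫ x, f.berezin x =
        (2 ^ (k₁ * (k₁ - 1)))⁻¹ * (-Complex.I) ^ (k₁ ^ 2) *
          (Complex.exp (-(Complex.I * ψ)) / 2) ^ (k₁ * (k₂ - k₁)) *
          ∫ a : Fin (k₂ - k₁) × Fin (k₂ - k₁) → ℝ, f.atBody (SuperInt.embedFermion k₁ k₂ a)) := by
  refine ⟨fun hk hcorner => ?_, fun hk => ?_, fun hk hcorner => ?_⟩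
  · rw [SuperInt.integral_berezin_of_le hk.le hN hψ hdiff hinv hzero hint hcorner]
    obtain ⟨d, rfl⟩ := Nat.exists_eq_add_of_lt hk
    have hd : k₂ + d + 1 - k₂ = d + 1 := by omega
    have hsign : ((-1 : ℂ)) ^ ((k₂ + d + 1) * k₂) = (-1) ^ k₂ ^ 2 * (-1) ^ (k₂ * (d + 1)) := by
      rw [← pow_add]; congr 1; ring
    rw [hd, hsign, neg_pow Complex.I, neg_div, neg_pow (_ / 2), mul_comm (d + 1) k₂]
    ring
  · subst hk
    have hempty : IsEmpty (Fin (k₁ - k₁) × Fin (k₁ - k₁)) := by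
      rw [Nat.sub_self]; infer_instance
    have hpt : ∀ a : Fin (k₁ - k₁) × Fin (k₁ - k₁) → ℝ,
        f.atBody (SuperInt.embedBoson k₁ k₁ a) = f.atBody 0 := by
      intro a
      congr 1
      funext p
      rcases p with p | p
      · simp [SuperInt.embedBoson, SuperInt.padZero]
      · rfl
    have h := SuperInt.integral_berezin_of_le le_rfl hN hψ hdiff hinv hzero hint (by
      simp only [hpt]
      rw [MeasureTheory.volume_pi, MeasureTheory.Measure.pi_of_empty]
      exact MeasureTheory.integrable_dirac (by simp))
    rw [h]
    simp only [hpt]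
    rw [MeasureTheory.volume_pi, MeasureTheory.Measure.pi_of_empty]
    simp
  · rw [SuperInt.integral_berezin_of_ge hk.le hN hψ hdiff hinv hzero hint hcorner,
      mul_comm (k₂ - k₁)]
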